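/- All graphs and simplicial complexes below are finite, graphs are simple and connected, and simplices are nonempty sets. A graph is *bridged* if each of its isometric cycles has length $3$. A *systolic complex* is the clique complex $X$ of a bridged graph $G(X)$, its $1$-skeleton; it is considered *2-dimensional* if its simplices have at most three vertices, that is, if $G(X)$ is $K_4$-free. The *combinatorial boundary* $\partial X$ of a simplicial complex $X$ is the downward closure of the set of all non-maximal simplices of $X$ that are a facet of exactly one simplex of $X$. A *boundary distance matrix* of $X$ has its rows and columns indexed by the vertices of $\partial X$ and has as entries their distances in $G(X)$. **Theorem 1.2.** Every 2-dimensional systolic complex $X$ is determined up to isomorphism by its boundary distance matrix: if $X$ and $Y$ are 2-dimensional systolic complexes and $\pi$ is a bijection from the vertices of $\partial X$ to the vertices of $\partial Y$ such that $d_{G(Y)}(\pi(a),\pi(b))=d_{G(X)}(a,b)$ for all $a,b$, then $\pi$ extends to an isomorphism from $X$ to $Y$. Furthermore, $X$ can be reconstructed in polynomial time: there is an algorithm (a program for a random access machine with unit-cost addition, subtraction, test for zero, and direct and indirect memory access) that, given the number $n_0$ of vertices of $\partial X$ and a boundary distance matrix of a 2-dimensional systolic complex $X$, computes, in time $O(n_0\cdot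 m+1)$ where $m$ is the number of edges of $X$, the list of all vertices, edges and triangles of $X$, in which the vertices of $\partial X$ keep the names given by the order of the rows of the matrix. The implied constant does not depend on $X$. -/

import Mathlib

/-! ### Abstract simplicial complexes, combinatorial boundary -/

namespace AbstractSimplicialComplex

variable {V : Type*}

/-- The 1-skeleton of `X`, as a graph on the vertices of `X` (every element of the type `V` is a
vertex of an `AbstractSimplicialComplex V`). -/
def oneSkeleton (X : AbstractSimplicialComplex V) : SimpleGraph V where
  Adj u v := u ≠ v ∧ ∃ s ∈ X.faces, (s : Set V) = {u, v}
  symm := ⟨fun u v h => ⟨h.1.symm, by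
    obtain ⟨s, hs, h2⟩ := h.2
    exact ⟨s, hs, by rw [h2, Set.pair_comm]⟩⟩⟩
  loopless := ⟨fun _ h => h.1 rfl⟩

/-- `σ` is a facet of the simplex `ρ`: it is contained in `ρ` and has one vertex less. -/
def IsFacetOf (σ ρ : Finset V) : Prop :=
  σ ⊆ ρ ∧ ρ.card = σ.card + 1

/-- The combinatorial boundary of `X`: the downward closure (within nonempty sets) of the
non-maximal simplices of `X` that are a facet of exactly one simplex of `X`. -/
def boundary (X : AbstractSimplicialComplex V) : Set (Finset V) :=
  {τ | τ.Nonempty ∧ ∃ σ ∈ X.faces, ¬ Maximal (· ∈ X.faces) σ ∧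
    (∃! ρ, ρ ∈ X.faces ∧ IsFacetOf σ ρ) ∧ τ ⊆ σ}

/-- The vertices of the combinatorial boundary. -/
def boundaryVertices (X : AbstractSimplicialComplex V) : Set V :=
  {v | {v} ∈ X.boundary}

/-- The dimension of `X` is at most `d`. -/
def DimLE (X : AbstractSimplicialComplex V) (d : ℕ) : Prop :=
  ∀ s ∈ X.faces, s.card ≤ d + 1

/-- The number of simplices of dimension `d`. -/
noncomputable def numSimplices (X : AbstractSimplicialComplex V) (d : ℕ) : ℕ :=
  {s | s ∈ X.faces ∧ s.card = d + 1}.ncard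

end AbstractSimplicialComplex

/-! ### Bridged graphs and systolic complexes -/

namespace SimpleGraph

variable {V : Type*}

/-- A bridged graph: a connected graph all of whose isometric cycles have length `3`. An isometric
cycle of length `n` is a distance-preserving map from the cycle graph with `n ≥ 3` vertices. -/
def IsBridged (G : SimpleGraph V) : Prop :=
  G.Connected ∧ ∀ n : ℕ, 3 ≤ n → ∀ f : Fin n → V,
    (∀ i j, G.dist (f i) (f j) = (cycleGraph n).dist i j) → n = 3

/-- The clique complex of a graph: its simplices are the nonempty finite cliques. -/
def cliqueComplex (G : SimpleGraph V) : AbstractSimplicialComplex V where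
  faces := {s | s.Nonempty ∧ G.IsClique (s : Set V)}
  isRelLowerSet_faces := fun _ hs =>
    ⟨hs.1, fun _ hts ht => ⟨ht, hs.2.subset (Finset.coe_subset.mpr hts)⟩⟩
  singleton_mem := fun v => ⟨Finset.singleton_nonempty v, by simp⟩

end SimpleGraph

/-- Systolic complexes: the clique complexes of bridged graphs. -/
def AbstractSimplicialComplex.IsSystolic {V : Type*} (X : AbstractSimplicialComplex V) : Prop :=
  ∃ G : SimpleGraph V, G.IsBridged ∧ X = G.cliqueComplex

/-! ### A random access machine with a step count

The machine has natural-number registers and natural-number arrays (a program, being a finite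
object, mentions only finitely many of each). The only arithmetic operations are addition and
truncated subtraction; there is no multiplication, so that the uniform cost measure is the standard
one. Each operation costs one step. -/

namespace RAM

/-- A memory configuration. -/
structure State where
  /-- contents of the registers -/
  reg : ℕ → ℕ
  /-- `mem a i` is the entry with index `i` of the array number `a` -/
  mem : ℕ → ℕ → ℕ

/-- Arithmetic expressions. -/
inductive Expr where
  | lit (k : ℕ)
  | reg (x : ℕ)
  | get (a : ℕ) (i : Expr)
  | add (e₁ e₂ : Expr)
  | sub (e₁ e₂ : Expr)

/-- The value of an expression. -/
def Expr.eval (s : State) : Expr → ℕ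
  | .lit k => k
  | .reg x => s.reg x
  | .get a i => s.mem a (i.eval s)
  | .add e₁ e₂ => e₁.eval s + e₂.eval s
  | .sub e₁ e₂ => e₁.eval s - e₂.eval s

/-- The number of elementary operations in the evaluation of an expression. -/
def Expr.cost : Expr → ℕ
  | .lit _ => 1
  | .reg _ => 1
  | .get _ i => i.cost + 1
  | .add e₁ e₂ => e₁.cost + e₂.cost + 1
  | .sub e₁ e₂ => e₁.cost + e₂.cost + 1

/-- Programs. The tests in `cond` and `loop` are "the value of the expression is nonzero". -/
inductive Prog where
  | skip
  | assign (x : ℕ) (e : Expr)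
  | store (a : ℕ) (i e : Expr)
  | seq (p q : Prog)
  | cond (e : Expr) (p q : Prog)
  | loop (e : Expr) (p : Prog)

/-- `Exec p s t s'`: started in `s`, the program `p` halts after exactly `t` steps in `s'`. -/
inductive Exec : Prog → State → ℕ → State → Prop where
  | skip (s : State) : Exec .skip s 1 s
  | assign (s : State) (x : ℕ) (e : Expr) :
      Exec (.assign x e) s (e.cost + 1) ⟨Function.update s.reg x (e.eval s), s.mem⟩
  | store (s : State) (a : ℕ) (i e : Expr) :
      Exec (.store a i e) s (i.cost + e.cost + 1)
        ⟨s.reg, Function.update s.mem a (Function.update (s.mem a) (i.eval s) (e.eval s))⟩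
  | seq {p q : Prog} {s s' s'' : State} {t t' : ℕ} :
      Exec p s t s' → Exec q s' t' s'' → Exec (.seq p q) s (t + t') s''
  | cond_true {e : Expr} {p q : Prog} {s s' : State} {t : ℕ} :
      e.eval s ≠ 0 → Exec p s t s' → Exec (.cond e p q) s (e.cost + 1 + t) s'
  | cond_false {e : Expr} {p q : Prog} {s s' : State} {t : ℕ} :
      e.eval s = 0 → Exec q s t s' → Exec (.cond e p q) s (e.cost + 1 + t) s'
  | loop_true {e : Expr} {p : Prog} {s s' s'' : State} {t t' : ℕ} :
      e.eval s ≠ 0 → Exec p s t s' → Exec (.loop e p) s' t' s'' →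
        Exec (.loop e p) s (e.cost + 1 + t + t') s''
  | loop_false {e : Expr} {p : Prog} {s : State} :
      e.eval s = 0 → Exec (.loop e p) s (e.cost + 1) s

/-- The initial configuration for an input matrix `D` with `k` rows and columns: register `0` holds
`k`, array `0` holds the entries of `D` row by row (`D i j` has index `j + k * i`), and all the rest
of the memory is zero. -/
def input (k : ℕ) (D : Matrix (Fin k) (Fin k) ℕ) : State where
  reg x := if x = 0 then k else 0
  mem a l := if h : a = 0 ∧ l < k * k then
    D (finProdFinEquiv.symm ⟨l, h.2⟩).1 (finProdFinEquiv.symm ⟨l, h.2⟩).2 else 0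

/-- The simplices written in a configuration: register `0` holds the number of vertices, which are
named `0, 1, 2, …`; register `1` holds the number of edges, whose endpoints are in the arrays `1`
and `2`; register `2` holds the number of triangles, whose vertices are in the arrays
`3`, `4` and `5`. -/
def State.simplices (s : State) : Set (Finset ℕ) :=
  {σ | (∃ i < s.reg 0, σ = {i}) ∨
    (∃ l < s.reg 1, σ = {s.mem 1 l, s.mem 2 l}) ∨
    (∃ l < s.reg 2, σ = {s.mem 3 l, s.mem 4 l, s.mem 5 l})}

/-- The configuration `s` describes the complex `X` (of dimension at most `2`), up to a renaming `φ`
of the vertices under which the boundary vertices `e 0, e 1, …` keep their indices `0, 1, …` as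
names. The lists have the exact length, so each edge and each triangle is listed once. -/
def State.Describes {V : Type*} (s : State) (X : AbstractSimplicialComplex V) {k : ℕ}
    (e : Fin k ≃ X.boundaryVertices) : Prop :=
  ∃ φ : V ≃ Fin (s.reg 0),
    (∀ i : Fin k, (φ (e i) : ℕ) = i) ∧
    s.simplices = (fun σ : Finset V => σ.image (fun v => (φ v : ℕ))) '' X.faces ∧
    s.reg 1 = X.numSimplices 1 ∧ s.reg 2 = X.numSimplices 2

end RAM

/-!
Distances in a bridged graph `G` satisfy two conditions: the neighbours of `v` that are closer to
`x` form a clique (`SimpleGraph.IsBridged.adj_or_eq_of_closer`), and adjacent vertices at the same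
distance from `x` have a common neighbour closer to `x`
(`SimpleGraph.IsBridged.exists_common_closer`). Both are proved together by induction on the
distance: a violation gives two geodesics that stay as far apart as possible, and hence an
isometric cycle.

Let `G` moreover be `K₄`-free. Then the link of a vertex `v` has no cycles of length less than `6`.
If two vertices of the link have distance at least `3` in it, then on average they are at least as
far from any vertex as `v`. So if `v` maximizes the sum of the distances to a set containing `v`,
then its link has diameter at most `2` and is a star, that is, `v` is dominated by a neighbour `u`.
Dominated vertices belong to the boundary, so that such a `v` can be found among the boundary
vertices from their distances alone (`SimpleGraph.IsBridged.exists_isDominatedBy_of_max`). The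
other neighbours of `v` belong to the boundary too, and they are independent; hence the simplices
containing `v` are known. Deleting `v` yields an isometric subgraph which is again bridged, and in
which only `u` can become a new boundary vertex. If `u` is not among the vertices whose distances
are known, then its distances can be computed from those of `v` or of two neighbours of `v`
(`SimpleGraph.IsBridged.dist_of_leaf`, `SimpleGraph.IsBridged.dist_of_isDominatedBy`). So the
complex can be taken apart vertex by vertex.

The program `RAM.reconstruct` does this. With `k` boundary vertices, a round takes `O(k)` steps,
since the sums of the rows of the matrix are updated and not computed anew, and since the row of
`v` is reused for `u`, so that there are never more than `k` rows. As each round lists an edge,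
there are at most `m` rounds. The invariant is `RAM.Represents`, and the main lemmas are
`RAM.round_spec` and `RAM.mainLoop_spec`. The rigidity follows, because the output of the program
is determined by the matrix.
-/

/-! ### Geodesics and isometric cycles -/

namespace SimpleGraph

variable {V : Type*} {G : SimpleGraph V}

lemma Connected.dist_le_dist_add_one (hc : G.Connected) {a b : V} (h : G.Adj a b) (x : V) :
    G.dist x a ≤ G.dist x b + 1 := by
  have := hc.dist_triangle (u := x) (v := b) (w := a)
  rwa [dist_eq_one_iff_adj.2 h.symm] at this

lemma Connected.exists_adj_dist (hc : G.Connected) {x v : V} {n : ℕ} (h : G.dist x v = n + 1) :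
    ∃ u, G.Adj u v ∧ G.dist x u = n := by
  obtain ⟨p, hp⟩ := hc.exists_walk_length_eq_dist v x
  cases p with
  | nil => simp at h
  | @cons _ u _ hvu q =>
    refine ⟨u, hvu.symm, ?_⟩
    have h1 := dist_le q
    have h2 := hc.dist_le_dist_add_one hvu x
    rw [Walk.length_cons, dist_comm, h] at hp
    rw [dist_comm] at h1
    omega

/-- A geodesic, as a sequence of vertices. -/
lemma Connected.exists_geodesic (hc : G.Connected) (a b : V) :
    ∃ p : ℕ → V, p 0 = a ∧ p (G.dist a b) = b ∧
      (∀ i < G.dist a b, G.Adj (p i) (p (i + 1))) ∧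
      ∀ i ≤ G.dist a b, G.dist a (p i) = i ∧ G.dist (p i) b + i = G.dist a b := by
  generalize hn : G.dist a b = n
  induction n generalizing b with
  | zero =>
    have hab : a = b := (hc.dist_eq_zero_iff).1 hn
    subst hab
    exact ⟨fun _ => a, rfl, rfl, by omega, by intro i hi; simp; omega⟩
  | succ n ih =>
    obtain ⟨u, hu, hun⟩ := hc.exists_adj_dist hn
    obtain ⟨p, h0, h1, h2, h3⟩ := ih u hun
    refine ⟨fun i => if i ≤ n then p i else b, by simp [h0], by simp, ?_, ?_⟩
    · intro i hi
      rcases Nat.lt_succ_iff_lt_or_eq.1 hi with h | h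
      · simpa [h.le, Nat.succ_le_of_lt h] using h2 i h
      · subst h; simpa [h1] using hu
    · intro i hi
      rcases Nat.le_succ_iff.1 hi with h | h
      · simp only [h, if_true]
        obtain ⟨h4, h5⟩ := h3 i h
        refine ⟨h4, ?_⟩
        have h6 := hc.dist_le_dist_add_one hu.symm (p i)
        have h7 := hc.dist_triangle (u := a) (v := p i) (w := b)
        omega
      · subst h; simp [hn]

/-- The distance in the cycle graph is at most the length of either of the two arcs. -/
lemma dist_cycleGraph_le {n : ℕ} (i j : Fin n) (hij : i ≤ j) :
    (cycleGraph n).dist i j ≤ j.1 - i.1 ∧ (cycleGraph n).dist i j ≤ n - (j.1 - i.1) := by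
  obtain ⟨m, rfl⟩ : ∃ m, n = m + 1 := ⟨n - 1, by have := i.2; omega⟩
  have hc : (cycleGraph (m + 1)).Connected := cycleGraph_connected
  have key : ∀ d : ℕ, ∀ a b : Fin (m + 1), b.1 = a.1 + d → (cycleGraph (m + 1)).dist a b ≤ d := by
    intro d
    induction d with
    | zero => intro a b h; have : a = b := Fin.ext (by omega); simp [this]
    | succ d ih =>
      intro a b h
      let c : Fin (m + 1) := ⟨a.1 + d, by have := b.2; omega⟩
      have h1 := ih a c rfl
      have h2 : (cycleGraph (m + 1)).Adj b c := by
        apply pathGraph_le_cycleGraph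
        rw [pathGraph_adj]; right; simp [c]; omega
      have := hc.dist_le_dist_add_one h2 a
      omega
  refine ⟨key _ _ _ (by have : i.1 ≤ j.1 := hij; omega), ?_⟩
  rcases Nat.eq_zero_or_pos m with hm | hm
  · subst hm
    have : i = j := Fin.ext (by omega)
    subst this; simp
  · have h1 : (cycleGraph (m + 1)).Adj 0 (Fin.last m) := by
      rw [cycleGraph_adj']; left
      have : (0 : Fin (m + 1)) - Fin.last m = 1 := by
        have h : Fin.last m = -1 := by simp [Fin.ext_iff]
        rw [h]; simp
      rw [this]
      simp [Nat.mod_eq_of_lt (show 1 < m + 1 by omega)]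
    have h2 := key i.1 0 i (by simp)
    have h3 := key (m - j.1) j (Fin.last m) (by simp; omega)
    have h4 := hc.dist_le_dist_add_one h1 i
    have h5 := hc.dist_triangle (u := i) (v := Fin.last m) (w := j)
    rw [dist_comm] at h2
    rw [dist_comm] at h3
    have h7 : i.1 ≤ j.1 := hij
    have h6 : (cycleGraph (m + 1)).dist i (Fin.last m) ≤ i.1 + 1 := by
      have := hc.dist_le_dist_add_one h1.symm i
      omega
    omega

/-- In a bridged graph no cycle of length at least `4` is isometric. It suffices to bound the
distances from below by the length of one of the two arcs. -/
lemma IsBridged.false_of_isometric (hG : G.IsBridged) {n : ℕ} (hn : 4 ≤ n) (f : ℕ → V)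
    (h1 : ∀ i, i + 1 < n → G.Adj (f i) (f (i + 1))) (h2 : G.Adj (f (n - 1)) (f 0))
    (h3 : ∀ i j, i ≤ j → j < n → j - i ≤ G.dist (f i) (f j) ∨ n - (j - i) ≤ G.dist (f i) (f j)) :
    False := by
  have hn3 := hG.2 n (by omega) (fun i => f i) ?_
  · omega
  let φ : cycleGraph n →g G := ⟨fun i => f i, by
    intro a b hab
    have key : ∀ a b : Fin n, (a - b).1 = 1 → G.Adj (f a) (f b) := by
      intro a b h
      rw [Fin.sub_def] at h
      simp only at h
      have ha := a.2
      have hb := b.2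
      by_cases hlt : b.1 ≤ a.1
      · rw [show n - b.1 + a.1 = (a.1 - b.1) + n by omega, Nat.add_mod_right,
          Nat.mod_eq_of_lt (by omega)] at h
        rw [show a.1 = b.1 + 1 by omega]
        exact (h1 _ (by omega)).symm
      · rw [Nat.mod_eq_of_lt (by omega)] at h
        rw [show a.1 = 0 by omega, show b.1 = n - 1 by omega]
        exact h2.symm
    rw [cycleGraph_adj'] at hab
    rcases hab with h | h
    · exact key _ _ h
    · exact (key _ _ h).symm⟩
  have hcc : (cycleGraph n).Connected := by
    obtain ⟨m, rfl⟩ : ∃ m, n = m + 1 := ⟨n - 1, by omega⟩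
    exact cycleGraph_connected
  have hle : ∀ i j : Fin n, G.dist (f i) (f j) ≤ (cycleGraph n).dist i j := by
    intro i j
    obtain ⟨p, hp⟩ := hcc.exists_walk_length_eq_dist i j
    have := dist_le (p.map φ)
    rw [Walk.length_map, hp] at this
    exact this
  have key : ∀ i j : Fin n, i ≤ j → G.dist (f i) (f j) = (cycleGraph n).dist i j := by
    intro i j hij
    refine le_antisymm (hle i j) ?_
    have := dist_cycleGraph_le i j hij
    rcases h3 i j hij j.2 with h | h <;> omega
  intro i j
  rcases le_total i j with h | h
  · exact key i j h
  · rw [dist_comm, key j i h, dist_comm]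

lemma Connected.two_le_dist (hc : G.Connected) {a b : V} (h1 : a ≠ b) (h2 : ¬ G.Adj a b) :
    2 ≤ G.dist a b := hc.one_lt_dist_of_ne_of_not_adj h1 h2

/-- A bridged graph has no induced `4`-cycle. -/
lemma IsBridged.four_cycle (hG : G.IsBridged) {a b c d : V} (hab : G.Adj a b) (hbc : G.Adj b c)
    (hcd : G.Adj c d) (hda : G.Adj d a) (hac : a ≠ c) (hbd : b ≠ d) :
    G.Adj a c ∨ G.Adj b d := by
  by_contra! h
  have h1 := hG.1.two_le_dist hac h.1
  have h2 := hG.1.two_le_dist hbd h.2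
  have e1 := (dist_eq_one_iff_adj.2 hab).ge
  have e2 := (dist_eq_one_iff_adj.2 hbc).ge
  have e3 := (dist_eq_one_iff_adj.2 hcd).ge
  have e4 := (dist_eq_one_iff_adj.2 hda.symm).ge
  refine hG.false_of_isometric (n := 4) le_rfl
    (fun i => match i with | 0 => a | 1 => b | 2 => c | _ => d) ?_ hda ?_
  · intro i hi
    have : i < 3 := by omega
    interval_cases i <;> assumption
  · intro i j hij hj
    interval_cases j <;> interval_cases i <;> simp only [dist_self] <;> omega

/-- A bridged graph has no induced `5`-cycle. -/
lemma IsBridged.five_cycle (hG : G.IsBridged) {a b c d e : V} (hab : G.Adj a b) (hbc : G.Adj b c)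
    (hcd : G.Adj c d) (hde : G.Adj d e) (hea : G.Adj e a)
    (hac : a ≠ c ∧ ¬ G.Adj a c) (had : a ≠ d ∧ ¬ G.Adj a d) (hbd : b ≠ d ∧ ¬ G.Adj b d)
    (hbe : b ≠ e ∧ ¬ G.Adj b e) (hce : c ≠ e ∧ ¬ G.Adj c e) : False := by
  have h1 := hG.1.two_le_dist hac.1 hac.2
  have h2 := hG.1.two_le_dist had.1 had.2
  have h3 := hG.1.two_le_dist hbd.1 hbd.2
  have h4 := hG.1.two_le_dist hbe.1 hbe.2
  have h5 := hG.1.two_le_dist hce.1 hce.2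
  have e1 := (dist_eq_one_iff_adj.2 hab).ge
  have e2 := (dist_eq_one_iff_adj.2 hbc).ge
  have e3 := (dist_eq_one_iff_adj.2 hcd).ge
  have e4 := (dist_eq_one_iff_adj.2 hde).ge
  have e5 := (dist_eq_one_iff_adj.2 hea.symm).ge
  refine hG.false_of_isometric (n := 5) (by omega)
    (fun i => match i with | 0 => a | 1 => b | 2 => c | 3 => d | _ => e) ?_ hea ?_
  · intro i hi
    have : i < 4 := by omega
    interval_cases i <;> assumption
  · intro i j hij hj
    interval_cases j <;> interval_cases i <;> simp only [dist_self] <;> omega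

end SimpleGraph

/-! ### The clique condition -/

namespace SimpleGraph

variable {V : Type*} {G : SimpleGraph V}

/-- The neighbours of a vertex at distance `n` from `x` which are closer to `x` form a clique. -/
def CliqueCondition (G : SimpleGraph V) (n : ℕ) : Prop :=
  ∀ ⦃x v u w⦄, G.dist x v = n → G.Adj v u → G.Adj v w → G.dist x u + 1 = n →
    G.dist x w + 1 = n → u ≠ w → G.Adj u w

/-- Two adjacent vertices at distance `n` from `x` have a common neighbour closer to `x`. -/
def TriangleCondition (G : SimpleGraph V) (n : ℕ) : Prop :=
  ∀ ⦃x v w⦄, G.dist x v = n → G.dist x w = n → G.Adj v w →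
    ∃ y, G.Adj y v ∧ G.Adj y w ∧ G.dist x y + 1 = n

/-- Two families `S` and `T` of first steps of geodesics of length `l`, from `x` to `v` and from
`x` to `w`, such that no step in `S` is equal or adjacent to one in `T`, each closed under adjacency
among all such first steps. -/
structure Diverging (G : SimpleGraph V) (l : ℕ) (x v w : V) (S T : V → Prop) : Prop where
  dist_left : G.dist x v = l
  dist_right : G.dist x w = l
  not_adj : ∀ s t, S s → T t → s ≠ t ∧ ¬ G.Adj s t
  adj_left : ∀ s, S s → G.Adj x s
  adj_right : ∀ t, T t → G.Adj x t
  closed_left : ∀ s y, S s → G.Adj x y → G.Adj s y → G.dist y v + 1 = l → S y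
  closed_right : ∀ t y, T t → G.Adj x y → G.Adj t y → G.dist y w + 1 = l → T y

/-- The vertex `a` is at distance `i` from `x` on a geodesic of length `l` from `x` to `v` whose
first step is in `S`. -/
def OnGeodesic (G : SimpleGraph V) (l : ℕ) (x v : V) (S : V → Prop) (i : ℕ) (a : V) : Prop :=
  G.dist x a = i ∧ G.dist a v + i = l ∧ ∃ s, S s ∧ G.dist s a + 1 = i

lemma Diverging.symm {l : ℕ} {x v w : V} {S T : V → Prop} (h : G.Diverging l x v w S T) :
    G.Diverging l x w v T S :=
  ⟨h.2, h.1, fun s t hs ht => ⟨(h.3 t s ht hs).1.symm, fun h' => (h.3 t s ht hs).2 h'.symm⟩,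
    h.5, h.4, h.7, h.6⟩

lemma CliqueCondition.adj_or_eq {n : ℕ} (hA : G.CliqueCondition n) {x v u w : V}
    (h : G.dist x v = n) (hu : G.Adj v u) (hw : G.Adj v w) (hu' : G.dist x u + 1 = n)
    (hw' : G.dist x w + 1 = n) : u = w ∨ G.Adj u w := by
  by_cases huw : u = w
  · exact Or.inl huw
  · exact Or.inr (hA h hu hw hu' hw' huw)

/-- If going from `b'` to its neighbour `b` does not increase the distance to `a`, although `b` is
not adjacent to the previous vertex `b''` of a geodesic from `a` to `b'`, then there is another
geodesic to `b'` whose last but one vertex is adjacent to `b`. -/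
lemma exists_adj_of_dist_le (hc : G.Connected) {n : ℕ} (hA : G.CliqueCondition n)
    (hB : G.TriangleCondition n) {a b b' b'' : V} (hab' : G.dist a b' = n) (hb'' : G.Adj b'' b')
    (hab'' : G.dist a b'' + 1 = n) (hb : G.Adj b' b) (hne : b'' ≠ b) (hna : ¬ G.Adj b'' b)
    (hab : G.dist a b ≤ n) :
    ∃ y, G.Adj y b' ∧ G.Adj y b ∧ G.Adj b'' y ∧ G.dist a y + 1 = n := by
  have h1 := hc.dist_le_dist_add_one hb a
  rcases hab.lt_or_eq with h | h
  · rcases hA.adj_or_eq hab' hb''.symm hb hab'' (by omega) with h | h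
    · exact absurd h hne
    · exact absurd h hna
  · obtain ⟨y, hy1, hy2, hy⟩ := hB hab' h hb
    refine ⟨y, hy1, hy2, ?_, hy⟩
    rcases hA.adj_or_eq hab' hb''.symm hy1.symm hab'' hy with h | h
    · subst h; exact absurd hy2 hna
    · exact h

lemma Connected.exists_adj_between (hc : G.Connected) {x t b w : V} {m : ℕ}
    (h1 : G.dist x t + G.dist t b = G.dist x b) (h2 : G.dist x b + G.dist b w = G.dist x w)
    (h3 : G.dist t b = m + 1) :
    ∃ c, G.Adj c b ∧ G.dist t c = m ∧ G.dist x t + G.dist t c = G.dist x c ∧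
      G.dist x c + 1 = G.dist x b ∧ G.dist x c + G.dist c w = G.dist x w := by
  obtain ⟨c, hc1, hc2⟩ := hc.exists_adj_dist h3
  have e1 := hc.dist_triangle (u := x) (v := t) (w := c)
  have e2 := hc.dist_le_dist_add_one hc1.symm x
  have e3 := hc.dist_triangle (u := x) (v := c) (w := w)
  have e4 := hc.dist_le_dist_add_one hc1 w
  rw [dist_comm (u := w), dist_comm (u := w)] at e4
  exact ⟨c, hc1, hc2, by omega, by omega, by omega⟩

/-- Two vertices whose distances from `x` differ by `2` are neither equal nor adjacent. -/
lemma Connected.ne_and_not_adj_of_dist (hc : G.Connected) {x a b : V}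
    (h : G.dist x a + 2 ≤ G.dist x b) : a ≠ b ∧ ¬ G.Adj a b := by
  refine ⟨by rintro rfl; omega, fun h' => ?_⟩
  have := hc.dist_le_dist_add_one h'.symm x
  omega

/-- Inductive step of `Diverging.dist_eq`. -/
lemma Diverging.dist_eq_step (hc : G.Connected) {l : ℕ} {x : V} {n : ℕ}
    (hA : G.CliqueCondition n) (hB : G.TriangleCondition n) {v w : V} {S T : V → Prop}
    (hD : G.Diverging l x v w S T) {i j : ℕ} {a b : V} (hij : i + (j + 1) = n)
    (ha : G.OnGeodesic l x v S i a) (hb : G.OnGeodesic l x w T (j + 2) b)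
    (ih : ∀ m ≤ n, ∀ k c, i + k = m → G.OnGeodesic l x w T k c → G.dist a c = m) :
    G.dist a b = n + 1 := by
  obtain ⟨hb1, hb2, t, ht, htb⟩ := hb
  obtain ⟨ha1, -, -⟩ := ha
  have hxt := hD.adj_right t ht
  have hxt1 := dist_eq_one_iff_adj.2 hxt
  have hxw := hD.dist_right
  obtain ⟨b', hb'b, htb', hxtb', hxb', hxb'w⟩ := hc.exists_adj_between (x := x) (t := t) (b := b)
    (w := w) (m := j) (by omega) (by omega) (by omega)
  have hab' := ih n le_rfl (j + 1) b' hij ⟨by omega, by omega, t, ht, by omega⟩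
  have hab : G.dist a b ≤ n + 1 := by
    have h := hc.dist_triangle (u := a) (v := x) (w := b)
    rw [dist_comm (u := a) (v := x)] at h
    omega
  by_contra hne
  obtain ⟨b'', hb''b', hxb'', hab'', hTb''⟩ : ∃ b'', G.Adj b'' b' ∧ G.dist x b'' = j ∧
      G.dist a b'' + 1 = n ∧ ((b'' = x ∧ b' = t) ∨ (G.dist t b'' + 1 = j)) := by
    rcases j with _ | j
    · have : t = b' := hc.dist_eq_zero_iff.1 htb'
      refine ⟨x, this ▸ hxt, by simp, by rw [dist_comm]; omega, Or.inl ⟨rfl, this.symm⟩⟩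
    · obtain ⟨b'', hb'', htb'', h1, h2, h3⟩ := hc.exists_adj_between (x := x) (t := t) (b := b')
        (w := w) (m := j) (by omega) (by omega) (by omega)
      have h4 := ih (n - 1) (by omega) (j + 1) b'' (by omega)
        ⟨by omega, by omega, t, ht, by omega⟩
      exact ⟨b'', hb'', by omega, by omega, Or.inr (by omega)⟩
  obtain ⟨hne'', hna''⟩ := hc.ne_and_not_adj_of_dist (x := x) (a := b'') (b := b) (by omega)
  obtain ⟨y, hyb', hyb, hyb'', hay⟩ := exists_adj_of_dist_le hc hA hB hab' hb''b' hab'' hb'b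
    hne'' hna'' (by omega)
  have f1 := hc.dist_le_dist_add_one hyb''.symm x
  have f2 := hc.dist_le_dist_add_one hyb.symm x
  have hxy : G.dist x y = j + 1 := by omega
  have hyw : G.dist y w + (j + 1) = l := by
    have f3 := hc.dist_triangle (u := x) (v := y) (w := w)
    have f4 := hc.dist_le_dist_add_one hyb w
    rw [dist_comm (u := w), dist_comm (u := w)] at f4
    omega
  have hyT : ∃ t, T t ∧ G.dist t y + 1 = j + 1 := by
    rcases hTb'' with ⟨rfl, rfl⟩ | h
    · rw [dist_self] at hxb''
      exact ⟨y, hD.closed_right b' y ht hyb'' hyb'.symm (by omega), by simp; omega⟩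
    · refine ⟨t, ht, ?_⟩
      have g1 := hc.dist_le_dist_add_one hyb''.symm t
      have g2 := hc.dist_triangle (u := x) (v := t) (w := y)
      omega
  have := ih n le_rfl (j + 1) y hij ⟨hxy, hyw, hyT⟩
  omega

lemma Diverging.dist_eq_two (hc : G.Connected) {l : ℕ} {x v w a b : V} {S T : V → Prop}
    (hD : G.Diverging l x v w S T) (ha : G.OnGeodesic l x v S 1 a)
    (hb : G.OnGeodesic l x w T 1 b) : G.dist a b = 2 := by
  obtain ⟨hb1, hb2, t, ht, htb⟩ := hb
  obtain ⟨ha1, ha2, s, hs, hsa⟩ := ha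
  have h1 : s = a := hc.dist_eq_zero_iff.1 (by omega)
  have h2 : t = b := hc.dist_eq_zero_iff.1 (by omega)
  subst h1 h2
  obtain ⟨h3, h4⟩ := hD.not_adj s t hs ht
  have h5 := hc.two_le_dist h3 h4
  have h6 := hc.dist_triangle (u := s) (v := x) (w := t)
  rw [dist_comm (u := s) (v := x)] at h6
  omega

/-- Diverging geodesics stay as far apart as possible, up to a total length of `l`: the vertices at
distances `i` and `j` from `x` have distance `i + j`. -/
lemma Diverging.dist_eq (hc : G.Connected) {l : ℕ} (hA : ∀ m < l, G.CliqueCondition m)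
    (hB : ∀ m < l, G.TriangleCondition m) {x : V} {n : ℕ} (hn : n ≤ l) {v w : V} {S T : V → Prop}
    (hD : G.Diverging l x v w S T) {i j : ℕ} {a b : V} (hij : i + j = n)
    (ha : G.OnGeodesic l x v S i a) (hb : G.OnGeodesic l x w T j b) : G.dist a b = n := by
  induction n using Nat.strong_induction_on generalizing i j a b with
  | _ n ih =>
  have hi : 1 ≤ i := by obtain ⟨-, -, s, -, h⟩ := ha; omega
  have hj : 1 ≤ j := by obtain ⟨-, -, s, -, h⟩ := hb; omega
  obtain ⟨n, rfl⟩ : ∃ m, n = m + 1 := ⟨n - 1, by omega⟩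
  by_cases hj2 : 2 ≤ j
  · obtain ⟨j, rfl⟩ : ∃ m, j = m + 2 := ⟨j - 2, by omega⟩
    exact hD.dist_eq_step hc (hA n (by omega)) (hB n (by omega)) (by omega) ha hb
      (fun m hm k c hk h => ih m (by omega) (by omega) hk ha h)
  by_cases hi2 : 2 ≤ i
  · obtain ⟨i, rfl⟩ : ∃ m, i = m + 2 := ⟨i - 2, by omega⟩
    rw [dist_comm]
    refine hD.symm.dist_eq_step hc (hA n (by omega)) (hB n (by omega))
      (i := j) (by omega) hb ha (fun m hm k c hk h => ?_)
    rw [dist_comm]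
    exact ih m (by omega) (by omega) (by omega) h hb
  · obtain rfl : i = 1 := by omega
    obtain rfl : j = 1 := by omega
    rw [hD.dist_eq_two hc ha hb, ← hij]

/-- Being adjacent or equal is transitive on the neighbours of `v` closer to `x`: if this failed,
the triangle condition would give an induced cycle of length `4` or `5` through `v`. -/
lemma IsBridged.adj_trans (hG : G.IsBridged) {l : ℕ} (hA : ∀ m < l, G.CliqueCondition m)
    (hB : ∀ m < l, G.TriangleCondition m) {x v u y w : V} (hv : G.dist x v = l)
    (hu : G.Adj v u) (hw : G.Adj v w) (hu' : G.dist x u + 1 = l)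
    (hy' : G.dist x y + 1 = l) (hw' : G.dist x w + 1 = l) (huy : u = y ∨ G.Adj u y)
    (hyw : y = w ∨ G.Adj y w) : u = w ∨ G.Adj u w := by
  rcases huy with rfl | huy
  · exact hyw
  rcases hyw with rfl | hyw
  · exact Or.inr huy
  by_contra! hne
  obtain ⟨s, hsu, hsy, hs⟩ := hB (l - 1) (by omega) (x := x) (by omega) (by omega) huy
  obtain ⟨t, hty, htw, ht⟩ := hB (l - 1) (by omega) (x := x) (by omega) (by omega) hyw
  have hfar : ∀ z, G.dist x z + 1 = l - 1 → v ≠ z ∧ ¬ G.Adj v z := by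
    intro z hz
    refine ⟨fun h => by subst h; omega, fun h => ?_⟩
    have := hG.1.dist_le_dist_add_one h x
    omega
  have key : ∀ z, G.dist x z + 1 = l - 1 → G.Adj z u → ¬ G.Adj z w := by
    intro z hz hzu hzw
    rcases hG.four_cycle hu hzu.symm hzw hw.symm (hfar z hz).1 hne.1 with h | h
    · exact (hfar z hz).2 h
    · exact hne.2 h
  rcases (hA (l - 1) (by omega)).adj_or_eq (x := x) (by omega) hsy.symm hty.symm hs ht with h | h
  · subst h
    exact key s hs hsu htw
  · refine hG.five_cycle hu hsu.symm h htw hw.symm (hfar s hs) (hfar t ht)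
      ⟨?_, fun h => key t ht h.symm htw⟩ hne ⟨?_, key s hs hsu⟩
    · rintro rfl; omega
    · rintro rfl; omega

lemma exists_getVert_of_geodesics {l : ℕ} (hc : G.Connected) {x v p : V} (hv : G.dist v x = l)
    (hvp : G.Adj v p) (hpx : G.dist p x + 1 = l) :
    ∃ P : ℕ → V, P 0 = v ∧ P 1 = p ∧ P l = x ∧ (∀ i < l, G.Adj (P i) (P (i + 1))) ∧
      ∀ i ≤ l, G.dist v (P i) = i ∧ G.dist (P i) x + i = l ∧
        (1 ≤ i → G.dist p (P i) + 1 = i) := by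
  obtain ⟨P, h0, h1, h2, h3⟩ := hc.exists_geodesic p x
  refine ⟨fun i => if i = 0 then v else P (i - 1), by simp, by simpa using h0, ?_, ?_, ?_⟩
  · beta_reduce
    rw [if_neg (by omega), ← h1]; congr 1; omega
  · intro i hi
    rcases Nat.eq_zero_or_pos i with rfl | h
    · simpa [h0] using hvp
    · have := h2 (i - 1) (by omega)
      beta_reduce
      rw [if_neg (by omega), if_neg (by omega)]
      rwa [Nat.sub_add_cancel h] at this
  · intro i hi
    rcases Nat.eq_zero_or_pos i with rfl | h
    · simp [hv]
    · beta_reduce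
      rw [if_neg (by omega)]
      obtain ⟨h4, h5⟩ := h3 (i - 1) (by omega)
      have h6 := hc.dist_triangle (u := v) (v := p) (w := P (i - 1))
      have h7 := hc.dist_triangle (u := v) (v := P (i - 1)) (w := x)
      have h8 := dist_eq_one_iff_adj.2 hvp
      exact ⟨by omega, by omega, fun _ => by omega⟩

lemma le_dist_of_geodesic (hc : G.Connected) {P : ℕ → V} {l i j : ℕ} {v : V} (hij : i ≤ j)
    (hj : j ≤ l) (h : ∀ i ≤ l, G.dist v (P i) = i) : j - i ≤ G.dist (P i) (P j) := by
  have := hc.dist_triangle (u := v) (v := P i) (w := P j)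
  rw [h i (by omega), h j hj] at this
  omega

lemma dist_of_geodesic (hc : G.Connected) {P : ℕ → V} {l : ℕ} {v : V}
    (h : ∀ i ≤ l, G.dist v (P i) = i) (hP : ∀ i < l, G.Adj (P i) (P (i + 1))) {i d : ℕ}
    (hd : i + d ≤ l) : G.dist (P i) (P (i + d)) = d := by
  refine le_antisymm ?_ (by simpa using le_dist_of_geodesic hc (Nat.le_add_right i d) hd h)
  induction d with
  | zero => simp
  | succ d ih =>
    have g1 := ih (by omega)
    have g2 := hc.dist_le_dist_add_one (hP (i + d) (by omega)).symm (P i)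
    exact g2.trans (by omega)

/-- A cycle formed by two geodesics which diverge at both ends cannot occur in a bridged graph. -/
lemma IsBridged.false_of_diverging (hG : G.IsBridged) {l : ℕ} (hl : 2 ≤ l)
    (hA : ∀ m < l, G.CliqueCondition m) (hB : ∀ m < l, G.TriangleCondition m) {v x : V}
    {P Q : ℕ → V} (P0 : P 0 = v) (Pl : P l = x) (hP : ∀ i < l, G.Adj (P i) (P (i + 1)))
    (Q0 : Q 0 = v) (Ql : Q l = x) (hQ : ∀ i < l, G.Adj (Q i) (Q (i + 1)))
    {S T S' T' : V → Prop} (hD : G.Diverging l v x x S T) (hD' : G.Diverging l x v v S' T')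
    (hPv : ∀ i ≤ l, 1 ≤ i → G.OnGeodesic l v x S i (P i))
    (hQv : ∀ i ≤ l, 1 ≤ i → G.OnGeodesic l v x T i (Q i))
    (hPx : ∀ i < l, G.OnGeodesic l x v S' (l - i) (P i))
    (hQx : ∀ i < l, G.OnGeodesic l x v T' (l - i) (Q i)) : False := by
  have hc := hG.1
  have dP : ∀ i ≤ l, G.dist v (P i) = i := by
    intro i hi
    rcases Nat.eq_zero_or_pos i with rfl | h
    · simp [P0]
    · exact (hPv i hi h).1
  have dQ : ∀ i ≤ l, G.dist v (Q i) = i := by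
    intro i hi
    rcases Nat.eq_zero_or_pos i with rfl | h
    · simp [Q0]
    · exact (hQv i hi h).1
  have key : ∀ i j, 1 ≤ i → i < l → 1 ≤ j → j < l → i + j ≤ G.dist (P i) (Q j) ∨
      2 * l - (i + j) ≤ G.dist (P i) (Q j) := by
    intro i j hi hil hj hjl
    rcases le_total (i + j) l with h | h
    · exact Or.inl (hD.dist_eq hc hA hB h rfl (hPv i hil.le hi) (hQv j hjl.le hj)).ge
    · exact Or.inr ((hD'.dist_eq hc hA hB (n := 2 * l - (i + j)) (by omega) (by omega)
        (hPx i hil) (hQx j hjl))).ge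
  refine hG.false_of_isometric (n := 2 * l) (by omega)
    (fun i => if i ≤ l then P i else Q (2 * l - i)) ?_ ?_ ?_
  · intro i hi
    rcases lt_trichotomy i l with h | h | h
    · simpa [h.le, Nat.succ_le_of_lt h] using hP i h
    · subst h
      have := hQ (i - 1) (by omega)
      rw [Nat.sub_add_cancel (by omega), Ql, ← Pl] at this
      simp only [le_refl, if_true]
      rw [if_neg (by omega), show 2 * i - (i + 1) = i - 1 by omega]
      exact this.symm
    · have := hQ (2 * l - (i + 1)) (by omega)
      rw [if_neg (by omega), if_neg (by omega)]
      rw [show 2 * l - (i + 1) + 1 = 2 * l - i by omega] at this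
      exact this.symm
  · have := hQ 0 (by omega)
    rw [if_neg (by omega), if_pos (by omega), show 2 * l - (2 * l - 1) = 0 + 1 by omega, P0, ← Q0]
    exact this.symm
  · intro i j hij hj
    by_cases hjl : j ≤ l
    · rw [if_pos hjl, if_pos (by omega)]
      exact Or.inl (le_dist_of_geodesic hc hij hjl dP)
    rw [if_neg hjl]
    by_cases hil : i ≤ l
    · rw [if_pos hil]
      rcases Nat.eq_zero_or_pos i with rfl | hi
      · right; rw [P0, dQ _ (by omega)]; omega
      rcases hil.lt_or_eq with h | rfl
      · rcases key i (2 * l - j) hi h (by omega) (by omega) with h | h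
        · right; omega
        · left; omega
      · left
        have := le_dist_of_geodesic hc (show 2 * i - j ≤ i by omega) le_rfl dQ
        rw [Ql, dist_comm] at this
        rw [Pl]; omega
    · rw [if_neg hil]
      have := le_dist_of_geodesic hc (show 2 * l - j ≤ 2 * l - i by omega) (by omega) dQ
      rw [dist_comm] at this
      left; omega

/-- The first steps of geodesics of length `l` from `v` to `x` which are equal or adjacent
to `p`. -/
def FirstStepClass (G : SimpleGraph V) (l : ℕ) (v x p s : V) : Prop :=
  G.Adj v s ∧ G.dist s x + 1 = l ∧ (p = s ∨ G.Adj p s)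

/-- Two nonadjacent first steps of geodesics from `v` to `x` give diverging families, since being
adjacent or equal is an equivalence relation on the first steps. -/
lemma IsBridged.diverging_of_not_adj (hG : G.IsBridged) {l : ℕ}
    (hA : ∀ m < l, G.CliqueCondition m) (hB : ∀ m < l, G.TriangleCondition m) {v x p q : V}
    (hv : G.dist v x = l) (hp : G.Adj v p) (hq : G.Adj v q) (hpx : G.dist p x + 1 = l)
    (hqx : G.dist q x + 1 = l) (hpq : p ≠ q) (hna : ¬ G.Adj p q) :
    G.Diverging l v x x (G.FirstStepClass l v x p) (G.FirstStepClass l v x q) := by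
  have hv' : G.dist x v = l := by rw [dist_comm, hv]
  have tr : ∀ {a b c}, G.Adj v a → G.Adj v c → G.dist a x + 1 = l →
      G.dist b x + 1 = l → G.dist c x + 1 = l → (a = b ∨ G.Adj a b) → (b = c ∨ G.Adj b c) →
      (a = c ∨ G.Adj a c) := by
    intro a b c ha hcc ha' hb' hc' h1 h2
    rw [dist_comm] at ha' hb' hc'
    exact hG.adj_trans hA hB hv' ha hcc ha' hb' hc' h1 h2
  refine ⟨hv, hv, ?_, fun s hs => hs.1, fun s hs => hs.1, ?_, ?_⟩
  · rintro s t ⟨hs1, hs2, hs3⟩ ⟨ht1, ht2, ht3⟩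
    by_contra hcon
    have hst : s = t ∨ G.Adj s t := by
      by_cases h : s = t
      · exact Or.inl h
      · right; by_contra h'; exact hcon ⟨h, h'⟩
    rcases tr hp hq hpx ht2 hqx (tr hp ht1 hpx hs2 ht2 hs3 hst) (ht3.imp Eq.symm Adj.symm)
      with h | h
    · exact hpq h
    · exact hna h
  · rintro s y ⟨hs1, hs2, hs3⟩ hy hsy hyx
    exact ⟨hy, hyx, tr hp hy hpx hs2 hyx hs3 (Or.inr hsy)⟩
  · rintro s y ⟨hs1, hs2, hs3⟩ hy hsy hyx
    exact ⟨hy, hyx, tr hq hy hqx hs2 hyx hs3 (Or.inr hsy)⟩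

/-- If the last steps of two geodesics from `v` to `x` are adjacent, then so are the first steps,
unless they coincide. -/
lemma IsBridged.adj_first_of_adj_last (hG : G.IsBridged) {l : ℕ} (hl : 3 ≤ l)
    (hA : ∀ m < l, G.CliqueCondition m) (hB : ∀ m < l, G.TriangleCondition m) {v x p q p' q' : V}
    (hv : G.dist v x = l) (hp : G.Adj v p) (hq : G.Adj v q) (hpx : G.dist p x + 1 = l)
    (hqx : G.dist q x + 1 = l) (hp' : G.Adj p' x) (hpp' : G.dist p p' + 2 = l)
    (hqq' : G.dist q q' + 2 = l) (hvp' : G.dist v p' + 1 = l) (hvq' : G.dist v q' + 1 = l)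
    (h : G.Adj p' q') : p = q ∨ G.Adj p q := by
  have hc := hG.1
  obtain ⟨k, rfl⟩ : ∃ k, l = k + 3 := ⟨l - 3, by omega⟩
  obtain ⟨y, hyP, hyQ, hy⟩ := hB (k + 2) (by omega) (x := v) (by omega) (by omega) h
  obtain ⟨z, hz, hzy⟩ : ∃ z, G.Adj z v ∧ G.dist y z = k :=
    hc.exists_adj_dist (by rw [dist_comm]; omega)
  have hzx : G.dist x z + 1 = k + 3 := by
    have h0 := hc.dist_triangle (u := y) (v := p') (w := x)
    rw [dist_eq_one_iff_adj.2 hyP, dist_eq_one_iff_adj.2 hp'] at h0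
    have h1 := hc.dist_triangle (u := x) (v := y) (w := z)
    have h2 := hc.dist_le_dist_add_one hz.symm x
    rw [dist_comm (u := x) (v := y)] at h1
    rw [dist_comm (u := x) (v := v)] at h2
    omega
  have hside : ∀ {r r'}, G.Adj v r → G.dist v r' + 1 = k + 3 → G.dist r r' + 2 = k + 3 →
      G.Adj y r' → (r = z ∨ G.Adj r z) := by
    intro r r' hr h1 h2 h3
    have h4 := hc.dist_le_dist_add_one h3.symm z
    have h5 := hc.dist_triangle (u := v) (v := z) (w := r')
    rw [dist_eq_one_iff_adj.2 hz.symm] at h5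
    rw [dist_comm (u := z) (v := y)] at h4
    have h6 : G.dist z r' + 1 = k + 2 := by clear hzx h2; omega
    rw [dist_comm] at h1 h2 h6
    exact (hA (k + 2) (by omega)).adj_or_eq (x := r') (v := v) (by omega) hr hz.symm (by omega) h6
  have hpz := hside hp hvp' hpp' hyP
  have hqz := hside hq hvq' hqq' hyQ
  rw [dist_comm] at hpx hqx hv
  exact hG.adj_trans hA hB hv hp hq hpx hzx hqx hpz (hqz.imp Eq.symm Adj.symm)

/-- Geodesics from `v` to `x` with nonadjacent first steps also have nonadjacent last steps, so they
diverge at both ends and form an isometric cycle of length `2 * l`. -/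
lemma IsBridged.cliqueCondition_step (hG : G.IsBridged) {l : ℕ}
    (hA : ∀ m < l, G.CliqueCondition m) (hB : ∀ m < l, G.TriangleCondition m) :
    G.CliqueCondition l := by
  intro x v p q hv hp hq hpx hqx hpq
  by_contra hna
  have hc := hG.1
  have hl : 2 ≤ l := by
    by_contra h
    have h1 : x = p := hc.dist_eq_zero_iff.1 (by omega)
    have h2 : x = q := hc.dist_eq_zero_iff.1 (by omega)
    exact hpq (h1.symm.trans h2)
  obtain ⟨k, rfl⟩ : ∃ k, l = k + 2 := ⟨l - 2, by omega⟩
  have hvx : G.dist v x = k + 2 := by rw [dist_comm, hv]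
  rw [dist_comm] at hpx hqx
  obtain ⟨P, P0, P1, Pl, hP, hP'⟩ := exists_getVert_of_geodesics hc hvx hp hpx
  obtain ⟨Q, Q0, Q1, Ql, hQ, hQ'⟩ := exists_getVert_of_geodesics hc hvx hq hqx
  have Plast : G.Adj (P (k + 1)) x := Pl ▸ hP (k + 1) (by omega)
  have Qlast : G.Adj (Q (k + 1)) x := Ql ▸ hQ (k + 1) (by omega)
  obtain ⟨vP, Px, pP⟩ := hP' (k + 1) (by omega)
  obtain ⟨vQ, Qx, qQ⟩ := hQ' (k + 1) (by omega)
  have pP := pP (by omega)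
  have qQ := qQ (by omega)
  have hne : P (k + 1) ≠ Q (k + 1) := by
    intro h
    refine hna (hA (k + 1) (by omega) (x := P (k + 1)) (v := v) (by rw [dist_comm]; exact vP)
      hp hq ?_ ?_ hpq)
    · rw [dist_comm]; exact pP
    · rw [h, dist_comm]; exact qQ
  have hnad : ¬ G.Adj (P (k + 1)) (Q (k + 1)) := by
    intro h
    rcases Nat.eq_zero_or_pos k with rfl | hk
    · rw [zero_add, P1, Q1] at h
      exact hna h
    rcases hG.adj_first_of_adj_last (by omega) hA hB hvx hp hq hpx hqx Plast
      (by omega) (by omega) (by omega) (by omega) h with h | h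
    · exact hpq h
    · exact hna h
  rw [dist_comm] at vP vQ
  have back : ∀ R : ℕ → V, R (k + 2) = x → (∀ i < k + 2, G.Adj (R i) (R (i + 1))) →
      G.dist (R (k + 1)) v + 1 = k + 2 → (∀ i ≤ k + 2, G.dist v (R i) = i) →
      (∀ i ≤ k + 2, G.dist (R i) x + i = k + 2) → ∀ i < k + 2,
      G.OnGeodesic (k + 2) x v (G.FirstStepClass (k + 2) x v (R (k + 1))) (k + 2 - i) (R i) := by
    intro R Rl hR hRl hRv hRx i hi
    have h1 := hRv i hi.le
    have h2 := hRx i hi.le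
    refine ⟨by rw [dist_comm]; omega, by rw [dist_comm]; omega, R (k + 1),
      ⟨(Rl ▸ hR (k + 1) (by omega)).symm, hRl, Or.inl rfl⟩, ?_⟩
    have h3 := dist_of_geodesic hc hRv hR (i := i) (d := k + 1 - i) (by omega)
    rw [Nat.add_sub_cancel' (by omega), dist_comm] at h3
    omega
  refine hG.false_of_diverging hl hA hB P0 Pl hP Q0 Ql hQ
    (hG.diverging_of_not_adj hA hB hvx hp hq hpx hqx hpq hna)
    (hG.diverging_of_not_adj hA hB hv Plast.symm Qlast.symm (by omega) (by omega) hne hnad) ?_ ?_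
    (back P Pl hP (by omega) (fun i hi => (hP' i hi).1) (fun i hi => (hP' i hi).2.1))
    (back Q Ql hQ (by omega) (fun i hi => (hQ' i hi).1) (fun i hi => (hQ' i hi).2.1))
  · intro i hi h1
    obtain ⟨h2, h3, h4⟩ := hP' i hi
    exact ⟨h2, h3, p, ⟨hp, hpx, Or.inl rfl⟩, h4 h1⟩
  · intro i hi h1
    obtain ⟨h2, h3, h4⟩ := hQ' i hi
    exact ⟨h2, h3, q, ⟨hq, hqx, Or.inl rfl⟩, h4 h1⟩

end SimpleGraph

/-! ### The triangle condition -/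

namespace SimpleGraph

variable {V : Type*} {G : SimpleGraph V}

/-- Inductive step of `IsBridged.dist_eq_of_no_common`. -/
lemma IsBridged.dist_eq_step_of_no_common (hG : G.IsBridged) {l : ℕ}
    (hA : ∀ m ≤ l, G.CliqueCondition m) (hB : ∀ m < l, G.TriangleCondition m) {x v w : V}
    (hv : G.dist x v = l) (hw : G.dist x w = l) (hvw : G.Adj v w)
    (hno : ∀ y, G.Adj y v → G.Adj y w → G.dist x y + 1 ≠ l) {i j n : ℕ} {a b : V}
    (hij : i + j + 1 = n) (hn : n + 1 ≤ l) (ha : G.dist v a = i) (hax : G.dist x a + i = l)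
    (hb : G.dist w b = j + 1) (hbx : G.dist x b + (j + 1) = l)
    (ih : ∀ k ≤ j, ∀ c, G.dist w c = k → G.dist x c + k = l → G.dist a c = i + k + 1) :
    G.dist a b = n + 1 := by
  have hc := hG.1
  have hvw1 := dist_eq_one_iff_adj.2 hvw
  obtain ⟨b', hb'b, hwb', -, -, hb'x⟩ := hc.exists_adj_between (x := w) (t := w) (b := b)
    (w := x) (m := j) (by simp) (by rw [dist_comm (u := b), dist_comm (u := w) (v := x)]; omega) hb
  rw [dist_comm (u := b'), dist_comm (u := w) (v := x)] at hb'x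
  have hab' := ih j le_rfl b' hwb' (by omega)
  have hab : G.dist a b ≤ n + 1 := by
    have h1 := hc.dist_triangle (u := a) (v := v) (w := b)
    have h2 := hc.dist_triangle (u := v) (v := w) (w := b)
    rw [dist_comm (u := a) (v := v)] at h1
    omega
  by_contra hne
  rcases j with _ | j
  · obtain rfl : w = b' := hc.dist_eq_zero_iff.1 hwb'
    have hvb : v ≠ b := by rintro rfl; omega
    have hnvb : ¬ G.Adj v b := fun h => hno b h.symm hb'b.symm (by omega)
    obtain ⟨y, hyw, hyb, hvy, hay⟩ := exists_adj_of_dist_le hc (hA n (by omega))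
      (hB n (by omega)) (show G.dist a w = n by omega) hvw (by rw [dist_comm]; omega) hb'b
      hvb hnvb (by omega)
    have hxy : G.dist x y = l := by
      have h1 := hc.dist_le_dist_add_one hyb x
      have h2 := hc.dist_le_dist_add_one hvy x
      have h3 := hno y hvy.symm hyw
      omega
    rw [dist_comm] at ha
    obtain ⟨z, hzv, hzy, haz⟩ := hB i (by omega) ha (by omega) hvy
    have hxz : G.dist x z + 1 = l := by
      have h1 := hc.dist_triangle (u := x) (v := a) (w := z)
      have h2 := hc.dist_le_dist_add_one hzv.symm x
      omega
    have hzb : G.Adj z b := by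
      rcases (hA l le_rfl).adj_or_eq hxy hzy.symm hyb hxz (by omega) with rfl | h
      · exact absurd hzv.symm hnvb
      · exact h
    rcases hG.four_cycle hzv.symm hzb hb'b.symm hvw.symm hvb (by rintro rfl; omega) with h | h
    · exact hnvb h
    · exact hno z hzv h hxz
  · obtain ⟨b'', hb'', hwb'', -, h1, h2⟩ := hc.exists_adj_between (x := w) (t := w) (b := b')
      (w := x) (m := j) (by simp)
      (by rw [dist_comm (u := b'), dist_comm (u := w) (v := x)]; omega) hwb'
    rw [dist_comm (u := b''), dist_comm (u := w) (v := x)] at h2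
    have hab'' := ih j (by omega) b'' hwb'' (by omega)
    obtain ⟨hne'', hna''⟩ := hc.ne_and_not_adj_of_dist (x := w) (a := b'') (b := b) (by omega)
    obtain ⟨y, hyb', hyb, hyb'', hay⟩ := exists_adj_of_dist_le hc (hA n (by omega))
      (hB n (by omega)) (show G.dist a b' = n by omega) hb'' (by omega) hb'b hne'' hna'' (by omega)
    have f1 := hc.dist_le_dist_add_one hyb''.symm w
    have f2 := hc.dist_le_dist_add_one hyb.symm w
    have f3 := hc.dist_le_dist_add_one hyb''.symm x
    have f4 := hc.dist_le_dist_add_one hyb x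
    have f5 := hc.dist_triangle (u := x) (v := y) (w := w)
    rw [dist_comm (u := y)] at f5
    have := ih (j + 1) le_rfl y (by omega) (by omega)
    omega

/-- If the adjacent vertices `v` and `w`, both at distance `l` from `x`, have no common neighbour
closer to `x`, then geodesics from `v` and `w` to `x` stay as far apart as possible, up to a total
length of `l`. -/
lemma IsBridged.dist_eq_of_no_common (hG : G.IsBridged) {l : ℕ}
    (hA : ∀ m ≤ l, G.CliqueCondition m) (hB : ∀ m < l, G.TriangleCondition m) {x v w : V}
    (hv : G.dist x v = l) (hw : G.dist x w = l) (hvw : G.Adj v w)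
    (hno : ∀ y, G.Adj y v → G.Adj y w → G.dist x y + 1 ≠ l) {i j n : ℕ} {a b : V}
    (hij : i + j = n) (hn : n + 1 ≤ l) (ha : G.dist v a = i) (hax : G.dist x a + i = l)
    (hb : G.dist w b = j) (hbx : G.dist x b + j = l) : G.dist a b = n + 1 := by
  induction n using Nat.strong_induction_on generalizing i j a b with
  | _ n ih =>
  rcases j with _ | j
  · rcases i with _ | i
    · obtain rfl : v = a := hG.1.dist_eq_zero_iff.1 ha
      obtain rfl : w = b := hG.1.dist_eq_zero_iff.1 hb
      rw [dist_eq_one_iff_adj.2 hvw]; omega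
    · rw [dist_comm]
      refine hG.dist_eq_step_of_no_common hA hB hw hv hvw.symm (fun y h1 h2 => hno y h2 h1)
        (i := 0) (j := i) (by omega) hn hb hbx ha hax (fun k hk c h1 h2 => ?_)
      rw [dist_comm]
      exact (ih k (by omega) (j := 0) (by omega) (by omega) h1 h2 hb hbx).trans (by omega)
  · exact hG.dist_eq_step_of_no_common hA hB hv hw hvw hno (by omega) hn ha hax hb hbx
      (fun k hk c h1 h2 => ih (i + k) (by omega) rfl (by omega) ha hax h1 h2)

/-- Under the same assumptions, geodesics from `x` to `v` and to `w` diverge at `x`. -/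
lemma IsBridged.diverging_of_no_common (hG : G.IsBridged) {l : ℕ}
    (hA : ∀ m ≤ l, G.CliqueCondition m) (hB : ∀ m < l, G.TriangleCondition m) {x v w : V}
    (hv : G.dist x v = l) (hw : G.dist x w = l) (hvw : G.Adj v w)
    (hno : ∀ y, G.Adj y v → G.Adj y w → G.dist x y + 1 ≠ l) :
    G.Diverging l x v w (fun s => G.Adj x s ∧ G.dist s v + 1 = l)
      (fun t => G.Adj x t ∧ G.dist t w + 1 = l) := by
  have hc := hG.1
  have hne : ∀ s, G.Adj x s → G.dist s v + 1 = l → G.dist s w + 1 = l → False := by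
    intro s hs hsv hsw
    obtain ⟨y, hyv, hyw, hsy⟩ := hB (l - 1) (by omega) (x := s) (by omega) (by omega) hvw
    have h1 := hc.dist_triangle (u := x) (v := s) (w := y)
    have h2 := hc.dist_le_dist_add_one hyv.symm x
    rw [dist_eq_one_iff_adj.2 hs] at h1
    exact hno y hyv hyw (by omega)
  have hge : ∀ s u, G.Adj x s → G.dist x u = l → l ≤ G.dist s u + 1 := by
    intro s u hs hu
    have h := hc.dist_triangle (u := x) (v := s) (w := u)
    rw [dist_eq_one_iff_adj.2 hs] at h
    omega
  refine ⟨hv, hw, ?_, fun s hs => hs.1, fun t ht => ht.1, fun s y _ hy _ h => ⟨hy, h⟩,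
    fun s y _ hy _ h => ⟨hy, h⟩⟩
  rintro s t ⟨hs, hsv⟩ ⟨ht, htw⟩
  refine ⟨?_, fun hst => ?_⟩
  · rintro rfl
    exact hne s hs hsv htw
  have htv : G.dist t v = l := by
    have h1 := hge t v ht hv
    have h2 : G.dist t v + 1 ≠ l := fun h => hne t ht h htw
    have h3 := hc.dist_le_dist_add_one hst.symm v
    rw [dist_comm (u := v), dist_comm (u := v)] at h3
    omega
  rcases Nat.eq_zero_or_pos (G.dist s v) with h0 | hpos
  · obtain rfl : s = v := hc.dist_eq_zero_iff.1 h0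
    have h1 : t = w := hc.dist_eq_zero_iff.1 (by omega)
    subst h1
    exact hno x hs ht (by simp; omega)
  obtain ⟨p, hp, hsp⟩ := hc.exists_adj_dist (show G.dist s v = (G.dist s v - 1) + 1 by omega)
  have hxp : G.dist x p + 1 = l := by
    have h1 := hc.dist_triangle (u := x) (v := s) (w := p)
    have h2 := hc.dist_le_dist_add_one hp.symm x
    rw [dist_eq_one_iff_adj.2 hs] at h1
    omega
  have htp : G.dist t p + 1 = l := by
    have h1 := hc.dist_triangle (u := t) (v := s) (w := p)
    have h2 := hc.dist_le_dist_add_one hp.symm t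
    rw [dist_eq_one_iff_adj.2 hst.symm] at h1
    omega
  rcases (hA l le_rfl).adj_or_eq htv hp.symm hvw htp htw with rfl | h
  · omega
  · exact hno p hp h hxp

/-- If the triangle condition fails for an edge, then two geodesics from its ends to `x` form,
together with the edge, an isometric cycle of length `2 * l + 1`. -/
lemma IsBridged.triangleCondition_step (hG : G.IsBridged) {l : ℕ}
    (hA : ∀ m ≤ l, G.CliqueCondition m) (hB : ∀ m < l, G.TriangleCondition m) :
    G.TriangleCondition l := by
  intro x v w hv hw hvw
  by_contra! hno
  have hc := hG.1
  have hl : 2 ≤ l := by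
    by_contra hl
    rcases Nat.eq_zero_or_pos l with rfl | h
    · exact hvw.ne ((hc.dist_eq_zero_iff.1 hv).symm.trans (hc.dist_eq_zero_iff.1 hw))
    · obtain rfl : l = 1 := by omega
      exact hno x (dist_eq_one_iff_adj.1 hv) (dist_eq_one_iff_adj.1 hw) (by simp)
  have hD := hG.diverging_of_no_common hA hB hv hw hvw hno
  rw [dist_comm] at hv hw
  obtain ⟨P, P0, Pl, hP, hP'⟩ := hc.exists_geodesic v x
  obtain ⟨Q, Q0, Ql, hQ, hQ'⟩ := hc.exists_geodesic w x
  rw [hv] at Pl hP hP'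
  rw [hw] at Ql hQ hQ'
  have back : ∀ (u : V) (R : ℕ → V), R l = x → (∀ i < l, G.Adj (R i) (R (i + 1))) →
      (∀ i ≤ l, G.dist u (R i) = i ∧ G.dist (R i) x + i = l) → ∀ i < l,
      G.OnGeodesic l x u (fun s => G.Adj x s ∧ G.dist s u + 1 = l) (l - i) (R i) := by
    intro u R Rl hR hR' i hi
    obtain ⟨h1, h2⟩ := hR' i hi.le
    obtain ⟨h3, h4⟩ := hR' (l - 1) (by omega)
    have hlast := hR (l - 1) (by omega)
    rw [Nat.sub_add_cancel (by omega), Rl] at hlast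
    refine ⟨by rw [dist_comm]; omega, by rw [dist_comm]; omega, R (l - 1),
      ⟨hlast.symm, by rw [dist_comm]; omega⟩, ?_⟩
    have h5 := dist_of_geodesic hc (fun i hi => (hR' i hi).1) hR (i := i) (d := l - 1 - i)
      (by omega)
    rw [Nat.add_sub_cancel' (by omega), dist_comm] at h5
    omega
  have key : ∀ i j, i < l → j < l → i + j + 1 ≤ G.dist (P i) (Q j) ∨
      2 * l - (i + j) ≤ G.dist (P i) (Q j) := by
    intro i j hi hj
    by_cases h : i + j + 1 ≤ l
    · left
      obtain ⟨h1, h2⟩ := hP' i hi.le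
      obtain ⟨h3, h4⟩ := hQ' j hj.le
      rw [dist_comm] at h2 h4 hv hw
      exact (hG.dist_eq_of_no_common hA hB hv hw hvw hno rfl h h1 h2 h3 h4).ge
    · right
      exact (hD.dist_eq hc (fun m hm => hA m hm.le) hB (n := 2 * l - (i + j)) (by omega) (by omega)
        (back v P Pl hP hP' i hi) (back w Q Ql hQ hQ' j hj)).ge
  refine hG.false_of_isometric (n := 2 * l + 1) (by omega)
    (fun i => if i ≤ l then P i else Q (2 * l - i)) ?_ ?_ ?_
  · intro i hi
    rcases lt_trichotomy i l with h | h | h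
    · simpa [h.le, Nat.succ_le_of_lt h] using hP i h
    · subst h
      have := hQ (i - 1) (by omega)
      rw [Nat.sub_add_cancel (by omega), Ql, ← Pl] at this
      simp only [le_refl, if_true]
      rw [if_neg (by omega), show 2 * i - (i + 1) = i - 1 by omega]
      exact this.symm
    · have := hQ (2 * l - (i + 1)) (by omega)
      rw [if_neg (by omega), if_neg (by omega)]
      rw [show 2 * l - (i + 1) + 1 = 2 * l - i by omega] at this
      exact this.symm
  · rw [if_neg (by omega), if_pos (by omega), show 2 * l - (2 * l + 1 - 1) = 0 by omega, P0, Q0]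
    exact hvw.symm
  · intro i j hij hj
    by_cases hjl : j ≤ l
    · rw [if_pos hjl, if_pos (by omega)]
      exact Or.inl (le_dist_of_geodesic hc hij hjl (fun i hi => (hP' i hi).1))
    rw [if_neg hjl]
    by_cases hil : i ≤ l
    · rw [if_pos hil]
      rcases hil.lt_or_eq with h | rfl
      · rcases key i (2 * l - j) h (by omega) with h | h
        · right; omega
        · left; omega
      · left
        have := (hQ' (2 * i - j) (by omega)).2
        rw [dist_comm] at this
        rw [Pl]; omega
    · rw [if_neg hil]
      have := le_dist_of_geodesic hc (show 2 * l - j ≤ 2 * l - i by omega) (by omega)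
        (fun i hi => (hQ' i hi).1)
      rw [dist_comm] at this
      left; omega

/-- The two conditions hold in a bridged graph, by a simultaneous induction on the distance. -/
lemma IsBridged.conditions (hG : G.IsBridged) (n : ℕ) :
    G.CliqueCondition n ∧ G.TriangleCondition n := by
  induction n using Nat.strong_induction_on with
  | _ n ih =>
    have hA := hG.cliqueCondition_step (fun m hm => (ih m hm).1) (fun m hm => (ih m hm).2)
    refine ⟨hA, hG.triangleCondition_step (fun m hm => ?_) (fun m hm => (ih m hm).2)⟩
    rcases hm.lt_or_eq with h | rfl
    · exact (ih m h).1
    · exact hA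

/-- In a bridged graph, the neighbours of `v` closer to `x` form a clique. -/
lemma IsBridged.adj_or_eq_of_closer (hG : G.IsBridged) {x v u w : V} (hu : G.Adj v u)
    (hw : G.Adj v w) (hu' : G.dist x u + 1 = G.dist x v) (hw' : G.dist x w + 1 = G.dist x v) :
    u = w ∨ G.Adj u w :=
  (hG.conditions _).1.adj_or_eq rfl hu hw hu' hw'

/-- In a bridged graph, adjacent vertices at the same distance from `x` have a common neighbour
closer to `x`. -/
lemma IsBridged.exists_common_closer (hG : G.IsBridged) {x v w : V} (hvw : G.Adj v w)
    (h : G.dist x v = G.dist x w) :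
    ∃ y, G.Adj y v ∧ G.Adj y w ∧ G.dist x y + 1 = G.dist x v :=
  (hG.conditions _).2 rfl h.symm hvw

end SimpleGraph

/-! ### Dominated vertices of `K₄`-free bridged graphs -/

namespace SimpleGraph

variable {V : Type*} {G : SimpleGraph V}

lemma CliqueFree.false_of_four (h4 : G.CliqueFree 4) {a b c d : V} (hab : G.Adj a b)
    (hac : G.Adj a c) (had : G.Adj a d) (hbc : G.Adj b c) (hbd : G.Adj b d) (hcd : G.Adj c d) :
    False := by
  classical
  refine h4 {a, b, c, d} ⟨?_, ?_⟩
  · simp only [Finset.coe_insert, Finset.coe_singleton, isClique_insert, isClique_singleton]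
    simp [*]
  · rw [Finset.card_insert_of_notMem, Finset.card_insert_of_notMem, Finset.card_pair hcd.ne] <;>
    simp [hab.ne, hac.ne, had.ne, hbc.ne, hbd.ne]

/-- The vertex `v` is dominated by its neighbour `u`: every other neighbour of `v` is adjacent
to `u`. -/
def IsDominatedBy (G : SimpleGraph V) (v u : V) : Prop :=
  G.Adj v u ∧ ∀ w, G.Adj v w → w = u ∨ G.Adj w u

/-- The vertices of the combinatorial boundary in terms of the graph: the ends of an edge which is
in exactly one triangle, and the vertices of degree `1`. -/
def IsBoundaryVertex (G : SimpleGraph V) (a : V) : Prop :=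
  (∃ b, G.Adj a b ∧ ∀ c, G.Adj a c → c = b) ∨ ∃ b, G.Adj a b ∧ ∃! c, G.Adj a c ∧ G.Adj b c

namespace IsDominatedBy

variable {v u : V}

lemma not_adj (h4 : G.CliqueFree 4) (h : G.IsDominatedBy v u) {w w' : V} (hw : G.Adj v w)
    (hw' : G.Adj v w') (hwu : w ≠ u) (hwu' : w' ≠ u) : ¬ G.Adj w w' := fun hww =>
  h4.false_of_four h.1 hw hw' ((h.2 w hw).resolve_left hwu).symm
    ((h.2 w' hw').resolve_left hwu').symm hww

lemma existsUnique (h4 : G.CliqueFree 4) (h : G.IsDominatedBy v u) {w : V} (hw : G.Adj v w)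
    (hwu : w ≠ u) : ∃! c, G.Adj v c ∧ G.Adj w c := by
  refine ⟨u, ⟨h.1, (h.2 w hw).resolve_left hwu⟩, ?_⟩
  rintro c ⟨hc1, hc2⟩
  by_contra hcu
  exact h.not_adj h4 hw hc1 hwu hcu hc2

lemma isBoundaryVertex_leaf (h4 : G.CliqueFree 4) (h : G.IsDominatedBy v u) {w : V}
    (hw : G.Adj v w) (hwu : w ≠ u) : G.IsBoundaryVertex w := by
  refine Or.inr ⟨v, hw.symm, ?_⟩
  obtain ⟨c, hc, hc'⟩ := h.existsUnique h4 hw hwu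
  exact ⟨c, hc.symm, fun y hy => hc' y hy.symm⟩

lemma isBoundaryVertex (h4 : G.CliqueFree 4) (h : G.IsDominatedBy v u) :
    G.IsBoundaryVertex v := by
  by_cases hd : ∃ w, G.Adj v w ∧ w ≠ u
  · obtain ⟨w, hw, hwu⟩ := hd
    exact Or.inr ⟨w, hw, h.existsUnique h4 hw hwu⟩
  · push Not at hd
    exact Or.inl ⟨u, h.1, hd⟩

/-- The dominating vertex is on the boundary if `v` has degree `2`. -/
lemma isBoundaryVertex_center (h : G.IsDominatedBy v u) {w : V} (hw : G.Adj v w) (hwu : w ≠ u)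
    (h2 : ∀ c, G.Adj v c → c = u ∨ c = w) : G.IsBoundaryVertex u := by
  refine Or.inr ⟨v, h.1.symm, w, ⟨((h.2 w hw).resolve_left hwu).symm, hw⟩, ?_⟩
  rintro c ⟨hc1, hc2⟩
  exact (h2 c hc2).resolve_left (fun h => hc1.ne h.symm)

/-- If `v` has only two neighbours, then each of them dominates `v`. -/
lemma of_two (h : G.IsDominatedBy v u) {w : V} (hw : G.Adj v w)
    (h2 : ∀ c, G.Adj v c → c = u ∨ c = w) : G.IsDominatedBy v w := by
  refine ⟨hw, fun c hc => ?_⟩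
  rcases h2 c hc with rfl | rfl
  · exact (h.2 w hw).imp Eq.symm Adj.symm
  · exact Or.inl rfl

end IsDominatedBy

/-- The graph without the vertex `v`. -/
def delVertex (G : SimpleGraph V) (v : V) : SimpleGraph {x // x ≠ v} := G.comap Subtype.val

@[simp]
lemma delVertex_adj {v : V} {a b : {x // x ≠ v}} :
    (G.delVertex v).Adj a b ↔ G.Adj a.1 b.1 := Iff.rfl

namespace IsDominatedBy

variable {v u : V}

/-- Removing a dominated vertex preserves distances, since moving it to the dominating vertex is a
retraction. -/
lemma dist_delVertex (hc : G.Connected) (h : G.IsDominatedBy v u) (a b : {x // x ≠ v}) :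
    (G.delVertex v).Reachable a b ∧ (G.delVertex v).dist a b = G.dist a.1 b.1 := by
  classical
  let r : V → {x // x ≠ v} := fun x => if hx : x = v then ⟨u, h.1.ne.symm⟩ else ⟨x, hx⟩
  have hr : ∀ a : {x // x ≠ v}, r a.1 = a := fun a => by simp [r, a.2]
  have hadj : ∀ x y, G.Adj x y → r x = r y ∨ (G.delVertex v).Adj (r x) (r y) := by
    intro x y hxy
    by_cases hx : x = v
    · subst hx
      have hy : y ≠ x := hxy.ne.symm
      simp only [r, dif_pos, hy, dif_neg, not_false_eq_true, delVertex_adj, Subtype.mk.injEq]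
      exact (h.2 y hxy).imp Eq.symm Adj.symm
    · by_cases hy : y = v
      · subst hy
        simp only [r, dif_pos, hx, dif_neg, not_false_eq_true, delVertex_adj, Subtype.mk.injEq]
        exact h.2 x hxy.symm
      · right; simpa [r, hx, hy] using hxy
  have hw : ∀ {x y : V} (p : G.Walk x y),
      ∃ q : (G.delVertex v).Walk (r x) (r y), q.length ≤ p.length := by
    intro x y p
    induction p with
    | nil => exact ⟨Walk.nil, le_rfl⟩
    | @cons x y z hxy p ih =>
      obtain ⟨q, hq⟩ := ih
      rcases hadj x y hxy with he | he
      · exact ⟨q.copy he.symm rfl, by simp; omega⟩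
      · exact ⟨q.cons he, by simp [hq]⟩
  obtain ⟨p, hp⟩ := hc.exists_walk_length_eq_dist a.1 b.1
  obtain ⟨q, hq⟩ := hw p
  rw [hp] at hq
  let q' : (G.delVertex v).Walk a b := q.copy (hr a) (hr b)
  refine ⟨q'.reachable, le_antisymm ((dist_le q').trans (by simpa [q'] using hq)) ?_⟩
  obtain ⟨s, hs⟩ := q'.reachable.exists_walk_length_eq_dist
  let φ : G.delVertex v →g G := ⟨Subtype.val, fun h => h⟩
  rw [← hs, ← Walk.length_map φ s]
  exact dist_le (s.map φ)

lemma isBridged_delVertex (hG : G.IsBridged) (h : G.IsDominatedBy v u) :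
    (G.delVertex v).IsBridged := by
  have : Nonempty {x // x ≠ v} := ⟨⟨u, h.1.ne.symm⟩⟩
  refine ⟨⟨fun a b => (h.dist_delVertex hG.1 a b).1⟩, fun n hn f hf => ?_⟩
  refine hG.2 n hn (fun i => (f i).1) fun i j => ?_
  rw [← hf i j, (h.dist_delVertex hG.1 _ _).2]

/-- Removing a dominated vertex creates no new boundary vertices besides the dominating vertex. -/
lemma isBoundaryVertex_of_delVertex (h4 : G.CliqueFree 4) (h : G.IsDominatedBy v u)
    {a : {x // x ≠ v}} (ha : (G.delVertex v).IsBoundaryVertex a) :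
    G.IsBoundaryVertex a.1 ∨ a.1 = u := by
  by_cases hav : G.Adj v a.1
  · by_cases hau : a.1 = u
    · exact Or.inr hau
    · exact Or.inl (h.isBoundaryVertex_leaf h4 hav hau)
  left
  have hne : ∀ c, G.Adj a.1 c → c ≠ v := by rintro c hc rfl; exact hav hc.symm
  rcases ha with ⟨b, hb, hb'⟩ | ⟨b, hb, c, hc, hc'⟩
  · refine Or.inl ⟨b.1, hb, fun c hc => ?_⟩
    exact congrArg Subtype.val (hb' ⟨c, hne c hc⟩ hc)
  · refine Or.inr ⟨b.1, hb, c.1, hc, fun y hy => ?_⟩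
    exact congrArg Subtype.val (hc' ⟨y, hne y hy.1⟩ hy)

end IsDominatedBy

lemma CliqueFree.delVertex {n : ℕ} (h : G.CliqueFree n) (v : V) : (G.delVertex v).CliqueFree n :=
  h.comap ⟨⟨Subtype.val, fun h => h⟩, Subtype.val_injective⟩

/-- Two neighbours of `v` at distance at least `3` in its link are, on average, at least as far
from any vertex as `v`. -/
lemma IsBridged.two_mul_dist_le (hG : G.IsBridged) {v w w' x : V} (hw : G.Adj v w)
    (hw' : G.Adj v w') (hne : w ≠ w') (hna : ¬ G.Adj w w')
    (hno : ∀ c, G.Adj v c → G.Adj c w → ¬ G.Adj c w') :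
    2 * G.dist x v ≤ G.dist x w + G.dist x w' := by
  have key : ∀ {w w'}, G.Adj v w → G.Adj v w' → w ≠ w' → ¬ G.Adj w w' →
      (∀ c, G.Adj v c → G.Adj c w → ¬ G.Adj c w') → G.dist x w + 1 = G.dist x v →
      G.dist x v + 1 ≤ G.dist x w' := by
    intro w w' hw hw' hne hna hno h
    have h1 := hG.1.dist_le_dist_add_one hw' x
    by_contra hlt
    rcases Nat.lt_or_ge (G.dist x w') (G.dist x v) with h2 | h2
    · rcases hG.adj_or_eq_of_closer hw hw' h (by omega) with h3 | h3
      · exact hne h3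
      · exact hna h3
    · obtain ⟨y, hyv, hyw, hy⟩ := hG.exists_common_closer hw' (x := x) (by omega)
      rcases hG.adj_or_eq_of_closer hw hyv.symm h hy with rfl | h3
      · exact hna hyw
      · exact hno y hyv.symm h3.symm hyw
  have h1 := hG.1.dist_le_dist_add_one hw x
  have h2 := hG.1.dist_le_dist_add_one hw' x
  by_cases h3 : G.dist x w + 1 = G.dist x v
  · have := key hw hw' hne hna hno h3
    omega
  by_cases h4 : G.dist x w' + 1 = G.dist x v
  · have := key hw' hw hne.symm (fun h => hna h.symm) (fun c hc h5 h6 => hno c hc h6 h5) h4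
    omega
  omega

/-- The link of `v` contains no four-cycle, as a chord of it would give a `K₄`. -/
lemma IsBridged.link_four_cycle (hG : G.IsBridged) (h4 : G.CliqueFree 4) {v a b c d : V}
    (ha : G.Adj v a) (hb : G.Adj v b) (hc : G.Adj v c) (hd : G.Adj v d) (hab : G.Adj a b)
    (hbc : G.Adj b c) (hcd : G.Adj c d) (hda : G.Adj d a) (hac : a ≠ c) (hbd : b ≠ d) : False := by
  rcases hG.four_cycle hab hbc hcd hda hac hbd with h | h
  · exact h4.false_of_four ha hb hc hab h hbc
  · exact h4.false_of_four hb hc hd hbc h hcd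

/-- The link of `v` contains no five-cycle, as a chord of it would give a `K₄`. -/
lemma IsBridged.link_five_cycle (hG : G.IsBridged) (h4 : G.CliqueFree 4) {v a b c d e : V}
    (ha : G.Adj v a) (hb : G.Adj v b) (hc : G.Adj v c) (hd : G.Adj v d) (he : G.Adj v e)
    (hab : G.Adj a b) (hbc : G.Adj b c) (hcd : G.Adj c d) (hde : G.Adj d e) (hea : G.Adj e a)
    (hac : a ≠ c) (had : a ≠ d) (hbd : b ≠ d) (hbe : b ≠ e) (hce : c ≠ e) : False :=
  hG.five_cycle hab hbc hcd hde hea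
    ⟨hac, fun h => h4.false_of_four ha hb hc hab h hbc⟩
    ⟨had, fun h => h4.false_of_four hd he ha hde h.symm hea⟩
    ⟨hbd, fun h => h4.false_of_four hb hc hd hbc h hcd⟩
    ⟨hbe, fun h => h4.false_of_four he ha hb hea h.symm hab⟩
    ⟨hce, fun h => h4.false_of_four hc hd he hcd h hde⟩

/-- A vertex whose link has diameter at most `2` is dominated: the link, having girth at least `6`,
is a star. -/
lemma IsBridged.exists_isDominatedBy (hG : G.IsBridged) (h4 : G.CliqueFree 4) {v : V}
    (hv : ∃ w, G.Adj v w)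
    (h : ∀ w w', G.Adj v w → G.Adj v w' → w ≠ w' → ¬ G.Adj w w' →
      ∃ c, G.Adj v c ∧ G.Adj c w ∧ G.Adj c w') : ∃ u, G.IsDominatedBy v u := by
  by_cases hall : ∀ w w', G.Adj v w → G.Adj v w' → w ≠ w' → G.Adj w w'
  · obtain ⟨u, hu⟩ := hv
    refine ⟨u, hu, fun w hw => ?_⟩
    by_cases hwu : w = u
    · exact Or.inl hwu
    · exact Or.inr (hall w u hw hu hwu)
  push Not at hall
  obtain ⟨a, b, ha, hb, hab, hnab⟩ := hall
  obtain ⟨u, hu, hua, hub⟩ := h a b ha hb hab hnab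
  refine ⟨u, hu, fun c hc => ?_⟩
  by_contra! hcu
  have side : ∀ {a b}, G.Adj v a → G.Adj v b → a ≠ b → ¬ G.Adj a b → G.Adj u a → G.Adj u b →
      G.Adj c a → False := by
    intro a b ha hb hab hnab hua hub hca
    have hcb : ¬ G.Adj c b := fun hcb =>
      hG.link_four_cycle h4 hc ha hu hb hca hua.symm hub hcb.symm hcu.1 hab
    obtain ⟨e, he, hec, heb⟩ := h c b hc hb (by rintro rfl; exact hcu.2 hub.symm) hcb
    refine hG.link_five_cycle h4 ha hc he hb hu hca.symm hec.symm heb hub.symm hua ?_ hab ?_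
      hcu.1 ?_
    · rintro rfl; exact hnab heb
    · rintro rfl; exact hnab hca.symm
    · rintro rfl; exact hcu.2 hec.symm
  have hca : ¬ G.Adj c a := side ha hb hab hnab hua hub
  have hca' : c ≠ a := by rintro rfl; exact hcu.2 hua.symm
  obtain ⟨f, hf, hfc, hfa⟩ := h c a hc ha hca' hca
  obtain ⟨k, hk, hkc, hku⟩ := h c u hc hu hcu.1 hcu.2
  have hfu : f ≠ u := by rintro rfl; exact hcu.2 hfc.symm
  have hnfu : ¬ G.Adj f u := fun hh => h4.false_of_four hf ha hu hfa hh hua.symm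
  refine hG.link_five_cycle h4 hc hf ha hu hk hfc.symm hfa hua.symm hku.symm hkc hca' hcu.1
    hfu ?_ ?_
  · rintro rfl; exact hnfu hku
  · rintro rfl; exact hca hkc.symm

/-- A vertex `v` of a set `B` maximizing the sum of the distances to `B` is dominated. Otherwise
there would be two vertices at distance at least `3` in its link; on average, they are as far as `v`
from each vertex of `B`, and farther from `v` itself. -/
lemma IsBridged.exists_isDominatedBy_of_forall_sum_le (hG : G.IsBridged) (h4 : G.CliqueFree 4)
    {B : Finset V} {v : V} (hv : ∃ w, G.Adj v w) (hvB : v ∈ B)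
    (hmax : ∀ y, ∑ x ∈ B, G.dist x y ≤ ∑ x ∈ B, G.dist x v) : ∃ u, G.IsDominatedBy v u := by
  refine hG.exists_isDominatedBy h4 hv fun w w' hw hw' hne hna => ?_
  by_contra! hno
  have h1 := hmax w
  have h2 := hmax w'
  have h3 : ∑ x ∈ B, 2 * G.dist x v < ∑ x ∈ B, (G.dist x w + G.dist x w') := by
    refine Finset.sum_lt_sum (fun x _ => hG.two_mul_dist_le hw hw' hne hna hno) ⟨v, hvB, ?_⟩
    · rw [dist_self, dist_eq_one_iff_adj.2 hw]; omega
  rw [Finset.sum_add_distrib, ← Finset.mul_sum] at h3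
  omega

/-- For any set `B`, the sum of the distances to `B` is maximal at some dominated vertex. -/
lemma IsBridged.exists_forall_sum_le [Finite V] [Nontrivial V] (hG : G.IsBridged)
    (h4 : G.CliqueFree 4) (B : Finset V) :
    ∃ v u, G.IsDominatedBy v u ∧ ∀ y, ∑ x ∈ B, G.dist x y ≤ ∑ x ∈ B, G.dist x v := by
  classical
  cases nonempty_fintype V
  obtain ⟨v₀, -, hv₀⟩ := Finset.exists_max_image Finset.univ (fun y => ∑ x ∈ B, G.dist x y)
    Finset.univ_nonempty
  -- among the maximizing vertices, one that also maximizes the sum of all distances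
  obtain ⟨v, hv, hv'⟩ := Finset.exists_max_image
    (Finset.univ.filter fun y => ∑ x ∈ B, G.dist x y = ∑ x ∈ B, G.dist x v₀)
    (fun y => ∑ x, G.dist x y) ⟨v₀, by simp⟩
  simp only [Finset.mem_filter, Finset.mem_univ, true_and] at hv hv'
  have hmax : ∀ y, ∑ x ∈ B, G.dist x y ≤ ∑ x ∈ B, G.dist x v := fun y => by
    rw [hv]; exact hv₀ y (Finset.mem_univ y)
  obtain ⟨u, hu⟩ : ∃ u, G.IsDominatedBy v u := by
    refine hG.exists_isDominatedBy h4 ?_ fun w w' hw hw' hne hna => ?_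
    · exact hG.1.preconnected.exists_adj_of_nontrivial v
    by_contra! hno
    have hle : ∀ x, 2 * G.dist x v ≤ G.dist x w + G.dist x w' := fun x =>
      hG.two_mul_dist_le hw hw' hne hna hno
    have h1 := hmax w
    have h2 := hmax w'
    have h3 : ∑ x ∈ B, 2 * G.dist x v ≤ ∑ x ∈ B, (G.dist x w + G.dist x w') :=
      Finset.sum_le_sum fun x _ => hle x
    have h4 : ∑ x, 2 * G.dist x v < ∑ x, (G.dist x w + G.dist x w') := by
      refine Finset.sum_lt_sum (fun x _ => hle x) ⟨v, Finset.mem_univ v, ?_⟩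
      rw [dist_self, dist_eq_one_iff_adj.2 hw]; omega
    rw [Finset.sum_add_distrib, ← Finset.mul_sum] at h3 h4
    have h5 := hv' w (by omega)
    have h6 := hv' w' (by omega)
    omega
  exact ⟨v, u, hu, hmax⟩

/-- If `B` contains the boundary, then any vertex of `B` which maximizes, within `B`, the sum of
the distances to `B` is dominated. -/
lemma IsBridged.exists_isDominatedBy_of_max [Finite V] [Nontrivial V] (hG : G.IsBridged)
    (h4 : G.CliqueFree 4) {B : Finset V} (hB : ∀ a, G.IsBoundaryVertex a → a ∈ B) {v : V}
    (hv : v ∈ B) (hmax : ∀ y ∈ B, ∑ x ∈ B, G.dist x y ≤ ∑ x ∈ B, G.dist x v) :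
    ∃ u, G.IsDominatedBy v u := by
  obtain ⟨v', u', hu', hmax'⟩ := hG.exists_forall_sum_le h4 B
  refine hG.exists_isDominatedBy_of_forall_sum_le h4
    (hG.1.preconnected.exists_adj_of_nontrivial v) hv fun y => ?_
  exact (hmax' y).trans (hmax v' (hB v' (hu'.isBoundaryVertex h4)))

/-- There are at least two boundary vertices, since there are two dominated vertices. -/
lemma IsBridged.exists_boundary_pair [Finite V] [Nontrivial V] (hG : G.IsBridged)
    (h4 : G.CliqueFree 4) : ∃ a b, a ≠ b ∧ G.IsBoundaryVertex a ∧ G.IsBoundaryVertex b := by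
  obtain ⟨a, _, ha, -⟩ := hG.exists_forall_sum_le h4 ∅
  -- a dominated vertex at maximal distance from `a`
  obtain ⟨b, _, hb, hmax⟩ := hG.exists_forall_sum_le h4 {a}
  refine ⟨a, b, ?_, ha.isBoundaryVertex h4, hb.isBoundaryVertex h4⟩
  rintro rfl
  obtain ⟨c, hc⟩ := exists_ne a
  have := hmax c
  simp only [Finset.sum_singleton, dist_self] at this
  exact absurd (hG.1.pos_dist_of_ne hc.symm) (by omega)

/-- The distances from the neighbour of a vertex of degree `1`. -/
lemma IsBridged.dist_of_leaf (hG : G.IsBridged) {v u x : V}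
    (h : ∀ w, G.Adj v w → w = u) (hx : x ≠ v) : G.dist u x = G.dist v x - 1 := by
  have h1 := hG.1.pos_dist_of_ne hx
  obtain ⟨w, hw, hw'⟩ := hG.1.exists_adj_dist (show G.dist x v = (G.dist x v - 1) + 1 by omega)
  rw [h w hw.symm] at hw'
  rw [dist_comm, hw', dist_comm]

/-- The distances from the dominating vertex `u`, computed from those from two other neighbours
of `v`. This is how a vertex which is not in the matrix gets its row. -/
lemma IsBridged.dist_of_isDominatedBy (hG : G.IsBridged) (h4 : G.CliqueFree 4) {v u w₁ w₂ x : V}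
    (h : G.IsDominatedBy v u) (hw₁ : G.Adj v w₁) (hw₂ : G.Adj v w₂) (h₁ : w₁ ≠ u) (h₂ : w₂ ≠ u)
    (hne : w₁ ≠ w₂) (hx : x ≠ v) : G.dist u x = max (G.dist w₁ x) (G.dist w₂ x) - 1 := by
  have hc := hG.1
  have hu₁ := (h.2 w₁ hw₁).resolve_left h₁
  have hu₂ := (h.2 w₂ hw₂).resolve_left h₂
  have hna := h.not_adj h4 hw₁ hw₂ h₁ h₂
  have e1 := hc.dist_le_dist_add_one hu₁ x
  have e2 := hc.dist_le_dist_add_one hu₂ x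
  rw [dist_comm (u := u), dist_comm (u := w₁), dist_comm (u := w₂)]
  suffices hs : G.dist x u + 1 ≤ max (G.dist x w₁) (G.dist x w₂) by omega
  by_contra! hlt
  have hlt₁ : G.dist x w₁ ≤ G.dist x u := by omega
  have hlt₂ : G.dist x w₂ ≤ G.dist x u := by omega
  clear hlt
  -- `u` is at least as close to `x` as `v`
  have huv : G.dist x u ≤ G.dist x v := by
    have h1 := hc.pos_dist_of_ne hx
    obtain ⟨w, hw, hw'⟩ := hc.exists_adj_dist (show G.dist x v = (G.dist x v - 1) + 1 by omega)
    rcases h.2 w hw.symm with rfl | h2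
    · omega
    · have := hc.dist_le_dist_add_one h2.symm x
      omega
  -- each of `w₁`, `w₂` is closer to `x` than `u` or adjacent to such a neighbour of `u`
  have step : ∀ {w}, G.Adj v w → w ≠ u → G.dist x w ≤ G.dist x u →
      ∃ y, G.Adj u y ∧ G.dist x y + 1 = G.dist x u ∧
        (y = w ∨ (G.Adj w y ∧ G.dist x w = G.dist x u)) := by
    intro w hw hwu hle
    have hwu' := (h.2 w hw).resolve_left hwu
    rcases hle.lt_or_eq with hlt | heq
    · have := hc.dist_le_dist_add_one hwu'.symm x
      exact ⟨w, hwu'.symm, by omega, Or.inl rfl⟩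
    · obtain ⟨y, hyw, hyu, hy⟩ := hG.exists_common_closer hwu' heq
      exact ⟨y, hyu.symm, by omega, Or.inr ⟨hyw.symm, heq⟩⟩
  have hvy : ∀ {w y}, G.Adj v w → w ≠ u → G.Adj u y → G.Adj w y → ¬ G.Adj v y := by
    intro w y hw hwu hy hwy hvy
    exact h4.false_of_four h.1 hw hvy ((h.2 w hw).resolve_left hwu).symm hy hwy
  have hyv : ∀ {y}, G.dist x y + 1 = G.dist x u → y ≠ v := by
    rintro y hy rfl; omega
  obtain ⟨y₁, hy₁, hxy₁, hs₁⟩ := step hw₁ h₁ hlt₁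
  obtain ⟨y₂, hy₂, hxy₂, hs₂⟩ := step hw₂ h₂ hlt₂
  have huv' := h.1.symm
  rcases hG.adj_or_eq_of_closer hy₁ hy₂ hxy₁ hxy₂ with rfl | hyy
  · rcases hs₁ with rfl | ⟨hs₁, -⟩
    · rcases hs₂ with rfl | ⟨hs₂, -⟩
      · exact hne rfl
      · exact hna hs₂.symm
    · rcases hs₂ with rfl | ⟨hs₂, -⟩
      · exact hna hs₁
      · exact hG.link_four_cycle h4 huv' hu₁.symm hy₁ hu₂.symm hw₁ hs₁ hs₂.symm hw₂.symm
          (hyv hxy₁).symm hne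
  · rcases hs₁ with rfl | ⟨hs₁, hd₁⟩
    · rcases hs₂ with rfl | ⟨hs₂, hd₂⟩
      · exact hna hyy
      · exact hG.link_four_cycle h4 huv' hu₁.symm hy₂ hu₂.symm hw₁ hyy hs₂.symm hw₂.symm
          (hyv hxy₂).symm hne
    · rcases hs₂ with rfl | ⟨hs₂, hd₂⟩
      · exact hG.link_four_cycle h4 huv' hu₁.symm hy₁ hu₂.symm hw₁ hs₁ hyy hw₂.symm
          (hyv hxy₁).symm hne
      · refine hG.link_five_cycle h4 huv' hu₁.symm hy₁ hy₂ hu₂.symm hw₁ hs₁ hyy hs₂.symm hw₂.symm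
          (hyv hxy₁).symm (hyv hxy₂).symm ?_ hne ?_
        · rintro rfl; omega
        · rintro rfl; omega

end SimpleGraph

/-! ### Programs and their running time -/

namespace RAM

/-- The configuration with `n` written to register `x`. -/
def State.set (s : State) (x n : ℕ) : State := ⟨Function.update s.reg x n, s.mem⟩

/-- The configuration with `n` written to the entry `i` of array `a`. -/
def State.put (s : State) (a i n : ℕ) : State :=
  ⟨s.reg, Function.update s.mem a (Function.update (s.mem a) i n)⟩

@[simp] lemma State.set_reg (s : State) (x n y : ℕ) :
    (s.set x n).reg y = if y = x then n else s.reg y := by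
  simp [State.set, Function.update_apply]

@[simp] lemma State.set_mem (s : State) (x n : ℕ) : (s.set x n).mem = s.mem := rfl

@[simp] lemma State.put_reg (s : State) (a i n : ℕ) : (s.put a i n).reg = s.reg := rfl

@[simp] lemma State.put_mem (s : State) (a i n b j : ℕ) :
    (s.put a i n).mem b j = if b = a ∧ j = i then n else s.mem b j := by
  simp only [State.put, Function.update_apply]
  split_ifs <;> simp_all

/-- A program halts on each input in at most one way. -/
lemma Exec.deterministic {p : Prog} {s s₁ : State} {t₁ : ℕ} (h₁ : Exec p s t₁ s₁) :
    ∀ {t₂ : ℕ} {s₂ : State}, Exec p s t₂ s₂ → s₁ = s₂ := by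
  induction h₁ with
  | skip | assign | store => intro t₂ s₂ h₂; cases h₂; rfl
  | seq _ _ ih₁ ih₂ =>
    intro t₂ s₂ h₂
    cases h₂ with
    | seq h h' => cases ih₁ h; exact ih₂ h'
  | cond_true he _ ih =>
    intro t₂ s₂ h₂
    cases h₂ with
    | cond_true _ h => exact ih h
    | cond_false he' _ => exact absurd he' he
  | cond_false he _ ih =>
    intro t₂ s₂ h₂
    cases h₂ with
    | cond_true he' _ => exact absurd he he'
    | cond_false _ h => exact ih h
  | loop_true he _ _ ih₁ ih₂ =>
    intro t₂ s₂ h₂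
    cases h₂ with
    | loop_true _ h h' => cases ih₁ h; exact ih₂ h'
    | loop_false he' => exact absurd he' he
  | loop_false he =>
    intro t₂ s₂ h₂
    cases h₂ with
    | loop_true he' _ _ => exact absurd he he'
    | loop_false _ => rfl

/-- Started in `s`, the program `p` halts after at most `c` steps in a configuration
satisfying `Q`. -/
def HaltsWithin (p : Prog) (s : State) (c : ℕ) (Q : State → Prop) : Prop :=
  ∃ t s', Exec p s t s' ∧ t ≤ c ∧ Q s'

lemma HaltsWithin.mono {p : Prog} {s : State} {c c' : ℕ} {Q Q' : State → Prop}
    (h : HaltsWithin p s c Q) (hc : c ≤ c') (hQ : ∀ s, Q s → Q' s) : HaltsWithin p s c' Q' := by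
  obtain ⟨t, s', h1, h2, h3⟩ := h
  exact ⟨t, s', h1, h2.trans hc, hQ _ h3⟩

lemma HaltsWithin.seq {p q : Prog} {s : State} {c c' : ℕ} {Q Q' : State → Prop}
    (hp : HaltsWithin p s c Q) (hq : ∀ s, Q s → HaltsWithin q s c' Q') :
    HaltsWithin (.seq p q) s (c + c') Q' := by
  obtain ⟨t, s', h1, h2, h3⟩ := hp
  obtain ⟨t', s'', h4, h5, h6⟩ := hq s' h3
  exact ⟨t + t', s'', h1.seq h4, by omega, h6⟩

/-- The program contains no loop. -/
def Prog.LoopFree : Prog → Bool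
  | .skip => true
  | .assign _ _ => true
  | .store _ _ _ => true
  | .seq p q => p.LoopFree && q.LoopFree
  | .cond _ p q => p.LoopFree && q.LoopFree
  | .loop _ _ => false

/-- The first of two configurations if `n` is nonzero, and else the second one. -/
def State.pick (n : ℕ) (s s' : State) : State := if n = 0 then s' else s

lemma State.pick_of_eq {n : ℕ} (h : n = 0) (s s' : State) : State.pick n s s' = s' := if_pos h

lemma State.pick_of_ne {n : ℕ} (h : n ≠ 0) (s s' : State) : State.pick n s s' = s := if_neg h

/-- The effect of a loop-free program (loops are ignored). -/
def Prog.run : Prog → State → State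
  | .skip, s => s
  | .assign x e, s => s.set x (e.eval s)
  | .store a i e, s => s.put a (i.eval s) (e.eval s)
  | .seq p q, s => q.run (p.run s)
  | .cond e p q, s => State.pick (e.eval s) (p.run s) (q.run s)
  | .loop _ _, s => s

/-- A bound for the number of steps of a loop-free program. -/
def Prog.bound : Prog → ℕ
  | .skip => 1
  | .assign _ e => e.cost + 1
  | .store _ i e => i.cost + e.cost + 1
  | .seq p q => p.bound + q.bound
  | .cond e p q => e.cost + 1 + (p.bound + q.bound)
  | .loop _ _ => 0

lemma Prog.exec_run {p : Prog} (hp : p.LoopFree) (s : State) :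
    ∃ t ≤ p.bound, Exec p s t (p.run s) := by
  induction p generalizing s with
  | skip => exact ⟨1, le_rfl, .skip s⟩
  | assign x e => exact ⟨_, le_rfl, .assign s x e⟩
  | store a i e => exact ⟨_, le_rfl, .store s a i e⟩
  | seq p q ihp ihq =>
    simp only [LoopFree, Bool.and_eq_true] at hp
    obtain ⟨t, ht, h⟩ := ihp hp.1 s
    obtain ⟨t', ht', h'⟩ := ihq hp.2 (p.run s)
    exact ⟨t + t', Nat.add_le_add ht ht', h.seq h'⟩
  | cond e p q ihp ihq =>
    simp only [LoopFree, Bool.and_eq_true] at hp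
    by_cases he : e.eval s = 0
    · obtain ⟨t, ht, h⟩ := ihq hp.2 s
      refine ⟨_, ?_, by simpa only [run, State.pick_of_eq he] using Exec.cond_false he h⟩
      simp only [bound]; omega
    · obtain ⟨t, ht, h⟩ := ihp hp.1 s
      refine ⟨_, ?_, by simpa only [run, State.pick_of_ne he] using Exec.cond_true he h⟩
      simp only [bound]; omega
  | loop e p ih => simp [LoopFree] at hp

lemma HaltsWithin.of_run {p : Prog} (hp : p.LoopFree) {s : State} {Q : State → Prop}
    (h : Q (p.run s)) : HaltsWithin p s p.bound Q := by
  obtain ⟨t, ht, h'⟩ := Prog.exec_run hp s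
  exact ⟨t, _, h', ht, h⟩

/-- The loop in which register `r` runs through the numbers less than the content of
register `3`. -/
def forLoop (r : ℕ) (body : Prog) : Prog :=
  .seq (.assign r (.lit 0)) (.loop (.sub (.reg 3) (.reg r))
    (.seq body (.assign r (.add (.reg r) (.lit 1)))))

/-- The invariant rule for `forLoop`. -/
lemma HaltsWithin.forLoop {r : ℕ} {body : Prog} {s : State} {k c : ℕ} (Inv : ℕ → State → Prop)
    (h0 : Inv 0 (s.set r 0)) (hInv : ∀ j s, Inv j s → s.reg 3 = k ∧ s.reg r = j)
    (hbody : ∀ j s, j < k → Inv j s →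
      HaltsWithin body s c fun s' => Inv (j + 1) (s'.set r (s'.reg r + 1))) :
    HaltsWithin (forLoop r body) s ((k + 1) * (c + 8)) (Inv k) := by
  have key : ∀ n j s, j + n = k → Inv j s →
      HaltsWithin (.loop (.sub (.reg 3) (.reg r))
        (.seq body (.assign r (.add (.reg r) (.lit 1))))) s (n * (c + 8) + 4) (Inv k) := by
    intro n
    induction n with
    | zero =>
      intro j s hj hs
      obtain ⟨h3, hr⟩ := hInv j s hs
      refine ⟨4, s, ?_, by omega, (by omega : j = k) ▸ hs⟩
      exact Exec.loop_false (e := .sub (.reg 3) (.reg r)) (by simp only [Expr.eval]; omega)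
    | succ n ih =>
      intro j s hj hs
      obtain ⟨h3, hr⟩ := hInv j s hs
      obtain ⟨t, s', h1, h2, h4⟩ := hbody j s (by omega) hs
      obtain ⟨t', s'', h5, h6, h7⟩ := ih (j + 1) _ (by omega) h4
      refine ⟨4 + (t + 4) + t', s'', ?_, ?_, h7⟩
      · refine Exec.loop_true (e := .sub (.reg 3) (.reg r)) (by simp only [Expr.eval]; omega) ?_ h5
        exact h1.seq (.assign s' r (.add (.reg r) (.lit 1)))
      · rw [Nat.succ_mul]; omega
  have := HaltsWithin.seq (HaltsWithin.of_run (p := .assign r (.lit 0)) rfl h0)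
    (fun s' hs' => key k 0 s' (by omega) hs')
  refine this.mono ?_ (fun _ h => h)
  simp only [Prog.bound, Expr.cost]
  rw [Nat.succ_mul]; omega

/-- The configurations `s₀` and `s` agree except for the registers in `R` and the arrays in `A`. -/
def AgreeOff (R A : List ℕ) (s₀ s : State) : Prop :=
  (∀ x, x ∉ R → s.reg x = s₀.reg x) ∧ ∀ a, a ∉ A → s.mem a = s₀.mem a

namespace AgreeOff

variable {R A : List ℕ} {s₀ s : State}

lemma refl (s : State) : AgreeOff R A s s := ⟨fun _ _ => rfl, fun _ _ => rfl⟩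

lemma set (h : AgreeOff R A s₀ s) {x n : ℕ} (hx : x ∈ R) : AgreeOff R A s₀ (s.set x n) :=
  ⟨fun y hy => by
    rw [State.set_reg, if_neg (by rintro rfl; exact hy hx), h.1 y hy], fun a ha => h.2 a ha⟩

lemma put (h : AgreeOff R A s₀ s) {a i n : ℕ} (ha : a ∈ A) : AgreeOff R A s₀ (s.put a i n) :=
  ⟨fun y hy => h.1 y hy, fun b hb => by
    funext j
    rw [State.put_mem, if_neg (by rintro ⟨rfl, -⟩; exact hb ha), h.2 b hb]⟩

end AgreeOff

end RAM

/-! ### Memory layout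

Register `0` holds the next unused name, and the registers `1` and `2` hold the numbers of edges and
triangles listed so far. Register `3` holds the size `k` of the matrix, register `4` the number of
known vertices (those having a row), and register `5` is a loop index. In each round, register `6`
holds the index of the row of the vertex `v` to be removed; the registers `7` and `8` two of its
neighbours `a` and `p`, and register `9` the number of its known neighbours; register `11` a
common neighbour of `v` and `a`, and register `10` the number of the known ones. Register `13` holds
the row of a vertex dominating `v`, or the row of `v` if that vertex is unknown, in which case
register `14` is zero; register `15` holds its name. The registers `12`, `16` and `17` are
auxiliary.

Array `0` holds the matrix, array `9` the positions of its rows, array `8` their sums, array `7` the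
names of their vertices, and array `10` a new row. The arrays `1` to `5` receive the output. -/

namespace RAM

lemma AgreeOff.mem_eq {R : List ℕ} {s₀ s : State} (h : AgreeOff R [] s₀ s) : s.mem = s₀.mem :=
  funext fun a => h.2 a (by simp)

/-- The entry in row `i` and column `j` of the matrix stored row by row in array `0`, the positions
of the rows being stored in array `9`. -/
def State.ent (s : State) (i j : ℕ) : ℕ := s.mem 0 (s.mem 9 i + j)

/-- The expression for a matrix entry. -/
def entExpr (x y : ℕ) : Expr := .get 0 (.add (.get 9 (.reg x)) (.reg y))

lemma eval_entExpr (s : State) (x y : ℕ) : (entExpr x y).eval s = s.ent (s.reg x) (s.reg y) := rfl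

@[simp] lemma State.set_ent (s : State) (x n : ℕ) : (s.set x n).ent = s.ent := rfl

lemma State.ent_congr {s s' : State} (h0 : s.mem 0 = s'.mem 0) (h9 : s.mem 9 = s'.mem 9) :
    s.ent = s'.ent := by
  funext i j; simp only [State.ent, h0, h9]

/-- An expression with value `1` if `e` has value `1`, and `0` otherwise. -/
def isOne (e : Expr) : Expr := .sub e (.add (.sub e (.lit 1)) (.sub e (.lit 1)))

lemma eval_isOne (s : State) (e : Expr) : (isOne e).eval s = if e.eval s = 1 then 1 else 0 := by
  simp only [isOne, Expr.eval]
  split_ifs <;> omega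

/-- An expression which is nonzero if the registers `x` and `y` differ. -/
def differ (x y : ℕ) : Expr := .add (.sub (.reg x) (.reg y)) (.sub (.reg y) (.reg x))

lemma eval_differ_eq_zero (s : State) (x y : ℕ) :
    (differ x y).eval s = 0 ↔ s.reg x = s.reg y := by
  simp only [differ, Expr.eval]; omega

/-! ### Searching for a maximum and for neighbours -/

/-- Puts into register `6` an index of a maximal entry of array `8`. -/
def argmax : Prog :=
  .seq (.assign 6 (.lit 0)) (.seq (.assign 12 (.lit 0)) (forLoop 5
    (.cond (.sub (.get 8 (.reg 5)) (.reg 12))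
      (.seq (.assign 6 (.reg 5)) (.assign 12 (.get 8 (.reg 5)))) .skip)))

lemma argmax_spec {s : State} {k : ℕ} (h3 : s.reg 3 = k) :
    HaltsWithin argmax s ((k + 1) * 100) fun s' => AgreeOff [5, 6, 12] [] s s' ∧
      (∀ i < k, s.mem 8 i ≤ s.mem 8 (s'.reg 6)) ∧ (s'.reg 6 < k ∨ ∀ i < k, s.mem 8 i = 0) := by
  refine HaltsWithin.mono (HaltsWithin.seq (HaltsWithin.of_run rfl rfl) fun s₁ hs₁ =>
    HaltsWithin.seq (HaltsWithin.of_run rfl rfl) fun s₂ hs₂ => HaltsWithin.forLoop (k := k)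
    (fun j s' => AgreeOff [5, 6, 12] [] s s' ∧ s'.reg 5 = j ∧ (∀ i < j, s.mem 8 i ≤ s'.reg 12) ∧
      (s'.reg 12 = 0 ∨ (s'.reg 6 < k ∧ s.mem 8 (s'.reg 6) = s'.reg 12))) ?_ ?_
    fun j s' hj hs' => HaltsWithin.of_run rfl ?_) ?_ ?_
  · subst hs₁ hs₂
    simp only [Prog.run, Expr.eval]
    exact ⟨(((AgreeOff.refl s).set (by simp)).set (by simp)).set (by simp), by simp, by simp,
      by simp⟩
  · rintro j s' ⟨h1, h2, -⟩
    exact ⟨by rw [h1.1 3 (by simp), h3], h2⟩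
  · obtain ⟨h1, h2, h4, h5⟩ := hs'
    have hm := h1.mem_eq
    simp only [Prog.run, Expr.eval, hm, h2]
    simp only [State.pick]
    split_ifs with hc
    · refine ⟨h1.set (by simp), by simp [h2], ?_, by simpa using h5⟩
      intro i hi
      rcases Nat.lt_succ_iff_lt_or_eq.1 hi with h | rfl
      · simpa using h4 i h
      · simp; omega
    · refine ⟨((h1.set (by simp)).set (by simp)).set (by simp), by simp [h2], ?_,
        by simp [hm, h2, hj]⟩
      intro i hi
      rcases Nat.lt_succ_iff_lt_or_eq.1 hi with h | rfl
      · have := h4 i h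
        simp [hm, h2]; omega
      · simp [hm, h2]
  · simp only [Prog.bound, Expr.cost]; omega
  · rintro s' ⟨h1, -, h4, h5⟩
    rcases h5 with h5 | ⟨h5, h6⟩
    · rw [h5] at h4
      refine ⟨h1, fun i hi => ?_, Or.inr fun i hi => ?_⟩ <;> have := h4 i hi <;> omega
    · exact ⟨h1, fun i hi => by rw [h6]; exact h4 i hi, Or.inl h5⟩

/-- The result of searching the numbers less than `k` satisfying `P`: their number is `c` (or at
least `2`, in the last case); if there are any, `a` is one of them, and if there are more, then `p`
is another one. The default value of `a` and `p` is `v`. -/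
def Scanned (P : ℕ → Prop) (k v a p c : ℕ) : Prop :=
  (c = 0 ∧ a = v ∧ p = v ∧ ∀ i < k, ¬ P i) ∨ (c = 1 ∧ a < k ∧ P a ∧ ∀ i < k, P i → i = a) ∨
    (2 ≤ c ∧ a < k ∧ p < k ∧ a ≠ p ∧ P a ∧ P p)

/-- Scans the numbers less than `k` (the content of register `3`) which pass a test,
recording their number in register `c` and the last two of them in the registers `a` and `p`. -/
def scan (e : Expr) (a p c : ℕ) : Prog :=
  .seq (.seq (.assign a (.reg 6)) (.seq (.assign p (.reg 6)) (.assign c (.lit 0)))) (forLoop 5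
    (.cond e (.seq (.assign p (.reg a)) (.seq (.assign a (.reg 5))
      (.assign c (.add (.reg c) (.lit 1))))) .skip))

lemma scan_spec {s : State} {k : ℕ} (h3 : s.reg 3 = k) {e : Expr} {a p c : ℕ} (P : ℕ → Prop)
    (hreg : [3, 5, 6, a, p, c].Nodup) (he : ∀ s', AgreeOff [5, a, p, c] [] s s' →
      (e.eval s' = 0 ↔ ¬ P (s'.reg 5))) :
    HaltsWithin (scan e a p c) s ((k + 1) * (e.cost + 100)) fun s' =>
      AgreeOff [5, a, p, c] [] s s' ∧ Scanned P k (s.reg 6) (s'.reg a) (s'.reg p) (s'.reg c) := by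
  simp only [List.nodup_cons, List.mem_cons, List.not_mem_nil, or_false, not_or] at hreg
  obtain ⟨⟨-, -, ha3, hp3, hc3⟩, ⟨-, ha5, hp5, hc5⟩, ⟨ha6, hp6, hc6⟩, ⟨hap, hac⟩, hpc, -⟩ := hreg
  refine HaltsWithin.mono (HaltsWithin.seq (HaltsWithin.of_run rfl rfl) fun s₁ hs₁ =>
    HaltsWithin.forLoop (k := k)
    (fun j s' => AgreeOff [5, a, p, c] [] s s' ∧ s'.reg 5 = j ∧ j ≤ k ∧
      Scanned P j (s.reg 6) (s'.reg a) (s'.reg p) (s'.reg c)) ?_ ?_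
    fun j s' hj hs' => HaltsWithin.of_run rfl ?_) ?_ ?_
  · subst hs₁
    simp only [Prog.run, Expr.eval]
    refine ⟨((((AgreeOff.refl s).set (by simp)).set (by simp)).set (by simp)).set (by simp),
      by simp, by simp, ?_⟩
    left
    simp [Ne.symm ha5, Ne.symm hp5, Ne.symm hc5, ha6, hap, hac, hpc]
  · rintro j s' ⟨h1, h2, -⟩
    exact ⟨by rw [h1.1 3 (by simp [ha3, hp3, hc3]), h3], h2⟩
  · obtain ⟨h1, h2, hjk, h4⟩ := hs'
    have he' := he s' h1
    rw [h2] at he'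
    simp only [Prog.run, Expr.eval]
    by_cases hP : P j
    · rw [State.pick_of_ne (fun h => he'.1 h hP)]
      refine ⟨(((h1.set (by simp)).set (by simp)).set (by simp)).set (by simp),
        by simp [ha5, hp5, hc5, h2], hj, ?_⟩
      simp only [State.set_reg, Ne.symm ha5, Ne.symm hp5, Ne.symm hc5, hap, hac, hpc, Ne.symm hap,
        Ne.symm hac, Ne.symm hpc, ha5, hp5, hc5, if_true, if_false, h2]
      rcases h4 with ⟨h5, h6, h7, h8⟩ | ⟨h5, h6, h7, h8⟩ | ⟨h5, h6, h7, h8, h9, h10⟩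
      · right; left
        refine ⟨by omega, by omega, hP, fun i hi hPi => ?_⟩
        rcases Nat.lt_succ_iff_lt_or_eq.1 hi with h | rfl
        · exact absurd hPi (h8 i h)
        · rfl
      · right; right
        exact ⟨by omega, by omega, by omega, by omega, hP, h7⟩
      · right; right
        exact ⟨by omega, by omega, by omega, by omega, hP, h9⟩
    · rw [State.pick_of_eq (he'.2 hP)]
      refine ⟨h1.set (by simp), by simp [h2], hj, ?_⟩
      simp only [State.set_reg, Ne.symm ha5, Ne.symm hp5, Ne.symm hc5, if_false]
      have hlast : ∀ i < j + 1, P i → i < j := by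
        intro i hi hPi
        rcases Nat.lt_succ_iff_lt_or_eq.1 hi with h | rfl
        · exact h
        · exact absurd hPi hP
      rcases h4 with ⟨h5, h6, h7, h8⟩ | ⟨h5, h6, h7, h8⟩ | ⟨h5, h6, h7, h8, h9, h10⟩
      · exact Or.inl ⟨h5, h6, h7, fun i hi hPi => h8 i (hlast i hi hPi) hPi⟩
      · exact Or.inr (Or.inl ⟨h5, by omega, h7, fun i hi hPi => h8 i (hlast i hi hPi) hPi⟩)
      · exact Or.inr (Or.inr ⟨h5, by omega, by omega, h8, h9, h10⟩)
  · simp only [Prog.bound, Expr.cost]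
    have : (k + 1) * (e.cost + 100) =
        (k + 1) * (e.cost + 1 + (1 + 1 + (1 + 1 + (1 + 1 + 1 + 1)) + 1) + 8) + (k + 1) * 82 := by
      ring
    omega
  · rintro s' ⟨h1, -, -, h4⟩
    exact ⟨h1, h4⟩

/-- The test whether the loop index is a neighbour of `v`. -/
def nbrTest : Expr := isOne (entExpr 6 5)

/-- The test whether the loop index is a neighbour of both `v` and `a`. -/
def commonTest : Expr := .sub (.add nbrTest (isOne (entExpr 7 5))) (.lit 1)

lemma eval_nbrTest (s : State) : nbrTest.eval s = 0 ↔ ¬ s.ent (s.reg 6) (s.reg 5) = 1 := by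
  rw [nbrTest, eval_isOne, eval_entExpr]
  split_ifs with h <;> simp [h]

lemma eval_commonTest (s : State) : commonTest.eval s = 0 ↔
    ¬ (s.ent (s.reg 6) (s.reg 5) = 1 ∧ s.ent (s.reg 7) (s.reg 5) = 1) := by
  simp only [commonTest, nbrTest, Expr.eval, eval_isOne, eval_entExpr]
  by_cases h : s.ent (s.reg 6) (s.reg 5) = 1 <;> by_cases h' : s.ent (s.reg 7) (s.reg 5) = 1 <;>
  simp [h, h']

/-- Chooses the row and the name of the dominating vertex; the row of `v` stands for a vertex which
has none yet. A known vertex with two common neighbours with `v`, or a common neighbour of `v` and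
`a` if there is just one, or the only known neighbour of `v` is dominating; in the remaining cases
the dominating vertex is unknown. -/
def choose : Prog :=
  .seq (.cond (.reg 10)
      (.cond (.sub (.reg 10) (.lit 1)) (.assign 13 (.reg 7)) (.assign 13 (.reg 11)))
      (.cond (.add (.sub (.reg 9) (.lit 1)) (.sub (.lit 1) (.reg 9)))
        (.assign 13 (.reg 6)) (.assign 13 (.reg 7))))
    (.seq (.assign 14 (differ 6 13)) (.cond (.reg 14) (.assign 15 (.get 7 (.reg 13)))
      (.seq (.assign 15 (.reg 0)) (.assign 0 (.add (.reg 0) (.lit 1))))))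

lemma choose_spec (s : State) :
    HaltsWithin choose s 100 fun s' => AgreeOff [0, 13, 14, 15] [] s s' ∧
      s'.reg 13 = (if s.reg 10 = 0 then (if s.reg 9 = 1 then s.reg 7 else s.reg 6)
        else if s.reg 10 = 1 then s.reg 11 else s.reg 7) ∧
      (s'.reg 14 = 0 ↔ s'.reg 13 = s.reg 6) ∧
      (s'.reg 13 ≠ s.reg 6 → s'.reg 15 = s.mem 7 (s'.reg 13) ∧ s'.reg 0 = s.reg 0) ∧
      (s'.reg 13 = s.reg 6 → s'.reg 15 = s.reg 0 ∧ s'.reg 0 = s.reg 0 + 1) := by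
  have h1 : HaltsWithin (.cond (.reg 10)
      (.cond (.sub (.reg 10) (.lit 1)) (.assign 13 (.reg 7)) (.assign 13 (.reg 11)))
      (.cond (.add (.sub (.reg 9) (.lit 1)) (.sub (.lit 1) (.reg 9)))
        (.assign 13 (.reg 6)) (.assign 13 (.reg 7)))) s 50 fun s₁ => s₁ = s.set 13
          (if s.reg 10 = 0 then (if s.reg 9 = 1 then s.reg 7 else s.reg 6)
            else if s.reg 10 = 1 then s.reg 11 else s.reg 7) := by
    refine HaltsWithin.mono (HaltsWithin.of_run rfl rfl) ?_ ?_
    · simp [Prog.bound, Expr.cost]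
    · rintro s₁ rfl
      simp only [Prog.run, Expr.eval]
      simp only [State.pick]
      split_ifs <;> first | rfl | (exfalso; omega)
  generalize (if s.reg 10 = 0 then (if s.reg 9 = 1 then s.reg 7 else s.reg 6)
    else if s.reg 10 = 1 then s.reg 11 else s.reg 7) = u at h1 ⊢
  refine (h1.seq (c' := 50) fun s₁ hs₁ => HaltsWithin.mono (HaltsWithin.of_run rfl rfl) ?_
    fun s₂ hs₂ => ?_)
  · simp [Prog.bound, Expr.cost, differ]
  · subst hs₁ hs₂
    by_cases hu : s.reg 6 = u
    · simp only [Prog.run, differ, Expr.eval, State.set_reg, if_true]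
      rw [State.pick_of_eq (by simp [hu])]
      refine ⟨((((AgreeOff.refl s).set (by simp)).set (by simp)).set (by simp)).set (by simp), ?_⟩
      simp [hu]
    · simp only [Prog.run, differ, Expr.eval, State.set_reg, if_true]
      rw [State.pick_of_ne (by simp; omega)]
      refine ⟨(((AgreeOff.refl s).set (by simp)).set (by simp)).set (by simp), ?_⟩
      simp [Ne.symm hu]
      omega

end RAM

namespace RAM

/-! ### Listing edges and triangles -/

/-- The edges and triangles written in a configuration. -/
def State.listed (s : State) : Set (Finset ℕ) :=
  {σ | (∃ l < s.reg 1, σ = {s.mem 1 l, s.mem 2 l}) ∨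
    (∃ l < s.reg 2, σ = {s.mem 3 l, s.mem 4 l, s.mem 5 l})}

/-- The configuration with the edge `{x, y}` appended to the list of edges. -/
def State.pushEdge (s : State) (x y : ℕ) : State :=
  ((s.put 1 (s.reg 1) x).put 2 (s.reg 1) y).set 1 (s.reg 1 + 1)

/-- The configuration with the triangle `{x, y, z}` appended to the list of triangles. -/
def State.pushTriangle (s : State) (x y z : ℕ) : State :=
  (((s.put 3 (s.reg 2) x).put 4 (s.reg 2) y).put 5 (s.reg 2) z).set 2 (s.reg 2 + 1)

lemma State.listed_pushEdge (s : State) (x y : ℕ) :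
    (s.pushEdge x y).listed = insert {x, y} s.listed := by
  ext σ
  simp only [listed, pushEdge, Set.mem_ofPred_eq, Set.mem_insert_iff, set_reg, set_mem, put_mem,
    put_reg]
  simp only [if_true, OfNat.ofNat_ne_one, if_false, false_and, true_and,
    OfNat.one_ne_ofNat, Nat.reduceEqDiff, ← or_assoc]
  refine or_congr ⟨?_, ?_⟩ Iff.rfl
  · rintro ⟨l, hl, rfl⟩
    rcases Nat.lt_succ_iff_lt_or_eq.1 hl with h | rfl
    · exact Or.inr ⟨l, h, by simp [h.ne]⟩
    · exact Or.inl (by simp)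
  · rintro (rfl | ⟨l, h, rfl⟩)
    · exact ⟨s.reg 1, by omega, by simp⟩
    · exact ⟨l, by omega, by simp [h.ne]⟩

lemma State.listed_pushTriangle (s : State) (x y z : ℕ) :
    (s.pushTriangle x y z).listed = insert {x, y, z} s.listed := by
  ext σ
  simp only [listed, pushTriangle, Set.mem_ofPred_eq, Set.mem_insert_iff, set_reg, set_mem, put_mem,
    put_reg]
  simp only [if_true, if_false, false_and, true_and, Nat.reduceEqDiff, OfNat.one_ne_ofNat,
    or_left_comm (a := σ = {x, y, z})]
  refine or_congr Iff.rfl ⟨?_, ?_⟩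
  · rintro ⟨l, hl, rfl⟩
    rcases Nat.lt_succ_iff_lt_or_eq.1 hl with h | rfl
    · exact Or.inr ⟨l, h, by simp [h.ne]⟩
    · exact Or.inl (by simp)
  · rintro (rfl | ⟨l, h, rfl⟩)
    · exact ⟨s.reg 2, by omega, by simp⟩
    · exact ⟨l, by omega, by simp [h.ne]⟩

/-- Appends an edge. -/
def addEdge (x y : Expr) : Prog :=
  .seq (.store 1 (.reg 1) x) (.seq (.store 2 (.reg 1) y) (.assign 1 (.add (.reg 1) (.lit 1))))

/-- Appends a triangle. -/
def addTriangle (x y z : Expr) : Prog :=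
  .seq (.store 3 (.reg 2) x) (.seq (.store 4 (.reg 2) y) (.seq (.store 5 (.reg 2) z)
    (.assign 2 (.add (.reg 2) (.lit 1)))))

lemma AgreeOff.pushEdge {R A : List ℕ} {s₀ s : State} (h : AgreeOff R A s₀ s) (h1 : 1 ∈ R)
    (h1' : 1 ∈ A) (h2 : 2 ∈ A) (x y : ℕ) : AgreeOff R A s₀ (s.pushEdge x y) :=
  ((h.put h1').put h2).set h1

lemma AgreeOff.pushTriangle {R A : List ℕ} {s₀ s : State} (h : AgreeOff R A s₀ s) (h2 : 2 ∈ R)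
    (h3 : 3 ∈ A) (h4 : 4 ∈ A) (h5 : 5 ∈ A) (x y z : ℕ) :
    AgreeOff R A s₀ (s.pushTriangle x y z) :=
  (((h.put h3).put h4).put h5).set h2

/-- The simplices of dimension at least `1` which contain the vertex named `x` dominated by the one
named `y`, if the names of its other neighbours are the values of `f` on `W`. -/
def starSimplices (x y : ℕ) (f : ℕ → ℕ) (W : Finset ℕ) : Set (Finset ℕ) :=
  {σ | σ = {x, y} ∨ ∃ i ∈ W, σ = {x, f i} ∨ σ = {x, y, f i}}

lemma starSimplices_insert (x y : ℕ) (f : ℕ → ℕ) (W : Finset ℕ) (j : ℕ) :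
    starSimplices x y f (insert j W) =
      insert {x, y, f j} (insert {x, f j} (starSimplices x y f W)) := by
  ext σ
  simp only [starSimplices, Finset.mem_insert, exists_eq_or_imp, Set.mem_ofPred_eq,
    Set.mem_insert_iff]
  grind

/-- Lists the simplices containing the vertex in the slot given by register `6`, dominated by the
one in the slot given by register `13` with the name given by register `15`. -/
def emit : Prog :=
  .seq (addEdge (.get 7 (.reg 6)) (.reg 15)) (forLoop 5 (.cond nbrTest (.cond (differ 5 13)
    (.seq (addEdge (.get 7 (.reg 6)) (.get 7 (.reg 5)))
      (addTriangle (.get 7 (.reg 6)) (.reg 15) (.get 7 (.reg 5)))) .skip) .skip))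

lemma emit_spec {s : State} {k : ℕ} (h3 : s.reg 3 = k) {W : Finset ℕ}
    (hW : W = (Finset.range k).filter fun i => s.ent (s.reg 6) i = 1 ∧ i ≠ s.reg 13) :
    HaltsWithin emit s ((k + 1) * 200) fun s' => AgreeOff [1, 2, 5] [1, 2, 3, 4, 5] s s' ∧
      s'.reg 1 = s.reg 1 + 1 + W.card ∧ s'.reg 2 = s.reg 2 + W.card ∧
      s'.listed = s.listed ∪ starSimplices (s.mem 7 (s.reg 6)) (s.reg 15) (s.mem 7) W := by
  subst hW
  refine HaltsWithin.mono (HaltsWithin.seq (HaltsWithin.of_run rfl rfl) fun s₁ hs₁ =>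
    HaltsWithin.forLoop (k := k)
    (fun j s' => AgreeOff [1, 2, 5] [1, 2, 3, 4, 5] s s' ∧ s'.reg 5 = j ∧
      s'.reg 1 = s.reg 1 + 1 +
        ((Finset.range j).filter fun i => s.ent (s.reg 6) i = 1 ∧ i ≠ s.reg 13).card ∧
      s'.reg 2 = s.reg 2 +
        ((Finset.range j).filter fun i => s.ent (s.reg 6) i = 1 ∧ i ≠ s.reg 13).card ∧
      s'.listed = s.listed ∪ starSimplices (s.mem 7 (s.reg 6)) (s.reg 15) (s.mem 7)
        ((Finset.range j).filter fun i => s.ent (s.reg 6) i = 1 ∧ i ≠ s.reg 13)) ?_ ?_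
    fun j s' hj hs' => HaltsWithin.of_run rfl ?_) ?_ ?_
  · have hs₂ : s₁ = s.pushEdge (s.mem 7 (s.reg 6)) (s.reg 15) := hs₁.symm
    subst hs₂
    have hl : ((s.pushEdge (s.mem 7 (s.reg 6)) (s.reg 15)).set 5 0).listed =
      (s.pushEdge (s.mem 7 (s.reg 6)) (s.reg 15)).listed := rfl
    refine ⟨((AgreeOff.refl s).pushEdge (by simp) (by simp) (by simp) _ _).set (by simp),
      by simp, by simp [State.pushEdge], by simp [State.pushEdge], ?_⟩
    rw [hl, State.listed_pushEdge]
    simp only [starSimplices, Finset.range_zero, Finset.filter_empty, Finset.notMem_empty,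
      false_and, exists_false, or_false, Set.ofPred_eq_eq_singleton, Set.union_singleton]
  · rintro j s' ⟨h1, h2, -⟩
    exact ⟨by rw [h1.1 3 (by simp), h3], h2⟩
  · obtain ⟨h1, h2, h4, h5, h6⟩ := hs'
    have e6 := h1.1 6 (by simp)
    have e13 := h1.1 13 (by simp)
    have e15 := h1.1 15 (by simp)
    have e7 := h1.2 7 (by simp)
    have hent : s'.ent = s.ent := State.ent_congr (h1.2 0 (by simp)) (h1.2 9 (by simp))
    have ht := eval_nbrTest s'
    rw [h2, e6, hent] at ht
    have hd := eval_differ_eq_zero s' 5 13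
    rw [h2, e13] at hd
    by_cases hP : s.ent (s.reg 6) j = 1 ∧ j ≠ s.reg 13
    · have hrun : (Prog.cond nbrTest (.cond (differ 5 13)
          (.seq (addEdge (.get 7 (.reg 6)) (.get 7 (.reg 5)))
            (addTriangle (.get 7 (.reg 6)) (.reg 15) (.get 7 (.reg 5)))) .skip) .skip).run s' =
          (s'.pushEdge (s.mem 7 (s.reg 6)) (s.mem 7 j)).pushTriangle (s.mem 7 (s.reg 6))
            (s.reg 15) (s.mem 7 j) := by
        simp only [Prog.run]
        rw [State.pick_of_ne (fun h => ht.1 h hP.1), State.pick_of_ne (fun h => hP.2 (hd.1 h))]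
        simp only [addEdge, addTriangle, Prog.run, Expr.eval, State.pushEdge, State.pushTriangle]
        simp [e6, e7, e15, h2]
      rw [hrun]
      refine ⟨((h1.pushEdge (by simp) (by simp) (by simp) _ _).pushTriangle (by simp) (by simp)
        (by simp) (by simp) _ _ _).set (by simp), ?_, ?_, ?_, ?_⟩
      · simp [State.pushEdge, State.pushTriangle, h2]
      · rw [Finset.range_add_one, Finset.filter_insert, if_pos hP,
          Finset.card_insert_of_notMem (by simp)]
        simp [State.pushEdge, State.pushTriangle, h4]; omega
      · rw [Finset.range_add_one, Finset.filter_insert, if_pos hP,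
          Finset.card_insert_of_notMem (by simp)]
        simp [State.pushEdge, State.pushTriangle, h5]; omega
      · have hl : ∀ (t : State) n, (t.set 5 n).listed = t.listed := fun _ _ => rfl
        rw [Finset.range_add_one, Finset.filter_insert, if_pos hP, hl, State.listed_pushTriangle,
          State.listed_pushEdge, h6, starSimplices_insert, Set.union_insert, Set.union_insert]
    · have hrun : (Prog.cond nbrTest (.cond (differ 5 13)
          (.seq (addEdge (.get 7 (.reg 6)) (.get 7 (.reg 5)))
            (addTriangle (.get 7 (.reg 6)) (.reg 15) (.get 7 (.reg 5)))) .skip) .skip).run s' =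
          s' := by
        simp only [Prog.run]
        by_cases h7 : s.ent (s.reg 6) j = 1
        · rw [State.pick_of_ne (fun h => ht.1 h h7),
            State.pick_of_eq (hd.2 (by by_contra h; exact hP ⟨h7, h⟩))]
        · rw [State.pick_of_eq (ht.2 h7)]
      rw [hrun, Finset.range_add_one, Finset.filter_insert, if_neg hP]
      exact ⟨h1.set (by simp), by simp [h2], by simp [h4], by simp [h5], h6⟩
  · simp only [Prog.bound, Expr.cost, addEdge, addTriangle, differ, nbrTest, isOne, entExpr]; omega
  · rintro s' ⟨h1, -, h4⟩
    exact ⟨h1, h4⟩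

/-! ### Removing a vertex -/

lemma State.put_ent_zero (s : State) (l n i j : ℕ) :
    (s.put 0 l n).ent i j = if s.mem 9 i + j = l then n else s.ent i j := by
  simp [State.ent]

lemma State.put_ent_of_ne (s : State) {a : ℕ} (l n : ℕ) (h0 : a ≠ 0) (h9 : a ≠ 9) :
    (s.put a l n).ent = s.ent := by
  funext i j
  simp [State.ent, h0.symm, h9.symm]

/-- The distances from the new vertex, if there is one, and else zero. The subtraction truncates to
`0` in the column of `v` and in those that belong to no vertex. -/
def newDist (s : State) (i : ℕ) : ℕ :=
  if s.reg 14 = 0 then max (s.ent (s.reg 7) i) (s.ent (s.reg 8) i) - 1 else 0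

/-- Computes the distances from the new vertex into array `10`. -/
def computeRow : Prog :=
  forLoop 5 (.cond (.reg 14) (.store 10 (.reg 5) (.lit 0)) (.store 10 (.reg 5)
    (.sub (.add (entExpr 7 5) (.sub (entExpr 8 5) (entExpr 7 5))) (.lit 1))))

lemma computeRow_spec {s : State} {k : ℕ} (h3 : s.reg 3 = k) :
    HaltsWithin computeRow s ((k + 1) * 100) fun s' => AgreeOff [5] [10] s s' ∧
      ∀ i < k, s'.mem 10 i = newDist s i := by
  refine HaltsWithin.mono (HaltsWithin.forLoop (k := k) (fun j s' => AgreeOff [5] [10] s s' ∧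
    s'.reg 5 = j ∧ ∀ i < j, s'.mem 10 i = newDist s i) ?_ ?_
    fun j s' hj hs' => HaltsWithin.of_run rfl ?_) ?_ ?_
  · exact ⟨(AgreeOff.refl s).set (by simp), by simp, by simp⟩
  · rintro j s' ⟨h1, h2, -⟩
    exact ⟨by rw [h1.1 3 (by simp), h3], h2⟩
  · obtain ⟨h1, h2, h4⟩ := hs'
    have hent : s'.ent = s.ent := State.ent_congr (h1.2 0 (by simp)) (h1.2 9 (by simp))
    have hrun : (Prog.cond (.reg 14) (.store 10 (.reg 5) (.lit 0)) (.store 10 (.reg 5)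
        (.sub (.add (entExpr 7 5) (.sub (entExpr 8 5) (entExpr 7 5))) (.lit 1)))).run s' =
        s'.put 10 j (newDist s j) := by
      simp only [Prog.run, Expr.eval, eval_entExpr, h2, hent, newDist,
        h1.1 7 (show 7 ∉ [5] by simp), h1.1 8 (show 8 ∉ [5] by simp),
        h1.1 14 (show 14 ∉ [5] by simp)]
      by_cases h14 : s.reg 14 = 0
      · rw [State.pick_of_eq h14, if_pos h14]
        congr 1; omega
      · rw [State.pick_of_ne h14, if_neg h14]
    rw [hrun]
    refine ⟨(h1.put (by simp)).set (by simp), by simp [h2], fun i hi => ?_⟩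
    rcases Nat.lt_succ_iff_lt_or_eq.1 hi with h | rfl
    · simp [h.ne, h4 i h]
    · simp
  · simp only [Prog.bound, Expr.cost, entExpr]; omega
  · rintro s' ⟨h1, -, h4⟩
    exact ⟨h1, h4⟩

lemma index_inj {k i j i' j' : ℕ} (hj : j < k) (hj' : j' < k) :
    k * i + j = k * i' + j' ↔ i = i' ∧ j = j' := by
  refine ⟨fun h => ?_, by rintro ⟨rfl, rfl⟩; rfl⟩
  have h1 : i = i' := by
    have := congrArg (· / k) h
    simpa [Nat.mul_add_div (show 0 < k by omega), Nat.div_eq_of_lt hj, Nat.div_eq_of_lt hj']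
      using this
  subst h1
  exact ⟨rfl, by omega⟩

/-- Replaces the row and the column of the matrix with the index given by register `6` by
array `10`, and updates the row sums. -/
def writeRow : Prog :=
  .seq (.assign 16 (.lit 0)) (forLoop 5
    (.seq (.store 8 (.reg 5) (.sub (.add (.get 8 (.reg 5)) (.get 10 (.reg 5))) (entExpr 6 5)))
    (.seq (.store 0 (.add (.get 9 (.reg 6)) (.reg 5)) (.get 10 (.reg 5)))
    (.seq (.store 0 (.add (.get 9 (.reg 5)) (.reg 6)) (.get 10 (.reg 5)))
      (.assign 16 (.add (.reg 16) (.get 10 (.reg 5))))))))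

lemma writeRow_spec {s : State} {k : ℕ} (h3 : s.reg 3 = k) (h9 : ∀ i < k, s.mem 9 i = k * i)
    (hv : s.reg 6 < k) :
    HaltsWithin writeRow s ((k + 1) * 100) fun s' => AgreeOff [5, 16] [0, 8] s s' ∧
      (∀ i < k, ∀ j < k, s'.ent i j = if i = s.reg 6 then s.mem 10 j else
        if j = s.reg 6 then s.mem 10 i else s.ent i j) ∧
      (∀ i < k, s'.mem 8 i = s.mem 8 i + s.mem 10 i - s.ent (s.reg 6) i) ∧
      s'.reg 16 = ∑ i ∈ Finset.range k, s.mem 10 i := by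
  refine HaltsWithin.mono (HaltsWithin.seq (HaltsWithin.of_run rfl rfl) fun s₁ hs₁ =>
    HaltsWithin.forLoop (k := k) (fun m s' => AgreeOff [5, 16] [0, 8] s s' ∧ s'.reg 5 = m ∧
      (∀ i < k, ∀ j < k, s'.ent i j = if i = s.reg 6 ∧ j < m then s.mem 10 j else
        if j = s.reg 6 ∧ i < m then s.mem 10 i else s.ent i j) ∧
      (∀ i < k, s'.mem 8 i = if i < m then s.mem 8 i + s.mem 10 i - s.ent (s.reg 6) i
        else s.mem 8 i) ∧
      s'.reg 16 = ∑ i ∈ Finset.range m, s.mem 10 i) ?_ ?_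
    fun m s' hm hs' => HaltsWithin.of_run rfl ?_) ?_ ?_
  · subst hs₁
    simp only [Prog.run, Expr.eval]
    exact ⟨((AgreeOff.refl s).set (by simp)).set (by simp), by simp, by simp, by simp, by simp⟩
  · rintro j s' ⟨h1, h2, -⟩
    exact ⟨by rw [h1.1 3 (by simp), h3], h2⟩
  · obtain ⟨h1, h2, h4, h5, h6⟩ := hs'
    have e6 := h1.1 6 (by simp)
    have e10 := h1.2 10 (by simp)
    have e9 := h1.2 9 (by simp)
    have hent : s'.ent (s.reg 6) m = s.ent (s.reg 6) m := by
      rw [h4 _ hv _ hm, if_neg (by omega), if_neg (by omega)]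
    have hrun : (Prog.seq
        (.store 8 (.reg 5) (.sub (.add (.get 8 (.reg 5)) (.get 10 (.reg 5))) (entExpr 6 5)))
        (.seq (.store 0 (.add (.get 9 (.reg 6)) (.reg 5)) (.get 10 (.reg 5)))
        (.seq (.store 0 (.add (.get 9 (.reg 5)) (.reg 6)) (.get 10 (.reg 5)))
          (.assign 16 (.add (.reg 16) (.get 10 (.reg 5))))))).run s' =
        (((s'.put 8 m (s'.mem 8 m + s.mem 10 m - s.ent (s.reg 6) m)).put 0 (k * s.reg 6 + m)
          (s.mem 10 m)).put 0 (k * m + s.reg 6) (s.mem 10 m)).set 16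
            (s'.reg 16 + s.mem 10 m) := by
      simp only [Prog.run, Expr.eval, eval_entExpr, h2, e6, hent, e10]
      simp [e10, e9, h2, e6, h9 _ hv, h9 m hm]
    rw [hrun]
    refine ⟨((((h1.put (by simp)).put (by simp)).put (by simp)).set (by simp)).set (by simp),
      by simp [h2], ?_, ?_, ?_⟩
    · intro i hi j hj
      simp only [State.set_ent, State.put_ent_zero, State.put_mem]
      rw [State.put_ent_of_ne _ _ _ (by simp) (by simp)]
      simp only [e9, h9 i hi, Nat.reduceEqDiff, OfNat.ofNat_ne_zero, false_and, if_false,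
        index_inj hj hv, index_inj hj hm, h4 i hi j hj]
      by_cases h7 : j = s.reg 6 ∧ i = m
      · rw [if_pos ⟨h7.2, h7.1⟩]
        by_cases h8 : i = s.reg 6 ∧ j < m + 1
        · rw [if_pos h8, show j = m by omega]
        · rw [if_neg h8, if_pos ⟨h7.1, by omega⟩, h7.2]
      · rw [if_neg (by tauto)]
        by_cases h8 : i = s.reg 6 ∧ j = m
        · rw [if_pos h8, if_pos ⟨h8.1, by omega⟩, h8.2]
        · rw [if_neg h8]
          have e1 : (i = s.reg 6 ∧ j < m) ↔ (i = s.reg 6 ∧ j < m + 1) := by omega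
          have e2 : (j = s.reg 6 ∧ i < m) ↔ (j = s.reg 6 ∧ i < m + 1) := by omega
          simp only [e1, e2]
    · intro i hi
      have := h5 i hi
      by_cases him : i = m
      · subst him
        simp [this]
      · simp only [State.set_mem, State.put_mem, him, OfNat.ofNat_ne_zero, false_and, and_false,
          if_false, this]
        have e1 : i < m ↔ i < m + 1 := by omega
        simp only [e1]
    · rw [Finset.sum_range_succ, ← h6]
      simp
  · simp only [Prog.bound, Expr.cost, entExpr]; omega
  · rintro s' ⟨h1, -, h4, h5, h6⟩
    refine ⟨h1, fun i hi j hj => ?_, fun i hi => by rw [h5 i hi, if_pos hi], h6⟩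
    rw [h4 i hi j hj]
    simp only [hi, hj, and_true]

/-- Completes the removal of a vertex: its slot becomes free, or gets the new vertex. -/
def finish : Prog :=
  .seq (.store 8 (.reg 6) (.reg 16))
    (.cond (.reg 14) (.assign 4 (.sub (.reg 4) (.lit 1))) (.store 7 (.reg 6) (.reg 15)))

lemma finish_spec (s : State) :
    HaltsWithin finish s 100 fun s' => AgreeOff [4] [7, 8] s s' ∧
      (∀ i, s'.mem 8 i = if i = s.reg 6 then s.reg 16 else s.mem 8 i) ∧
      (s.reg 14 ≠ 0 → s'.reg 4 = s.reg 4 - 1 ∧ s'.mem 7 = s.mem 7) ∧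
      (s.reg 14 = 0 → s'.reg 4 = s.reg 4 ∧
        ∀ i, s'.mem 7 i = if i = s.reg 6 then s.reg 15 else s.mem 7 i) := by
  refine HaltsWithin.mono (HaltsWithin.of_run rfl rfl) (by simp [finish, Prog.bound, Expr.cost]) ?_
  rintro s' rfl
  simp only [finish, Prog.run, Expr.eval, State.put_reg]
  by_cases h : s.reg 14 = 0
  · rw [State.pick_of_eq h]
    exact ⟨((AgreeOff.refl s).put (by simp)).put (by simp), by simp, by simp [h], by simp⟩
  · rw [State.pick_of_ne h]
    refine ⟨((AgreeOff.refl s).put (by simp)).set (by simp), by simp, ?_, by simp [h]⟩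
    refine fun _ => ⟨by simp, ?_⟩
    funext i; simp

end RAM

namespace RAM

lemma AgreeOff.trans {R R' R'' A A' A'' : List ℕ} {s₀ s₁ s₂ : State} (h : AgreeOff R A s₀ s₁)
    (h' : AgreeOff R' A' s₁ s₂) (hR : R ⊆ R'') (hR' : R' ⊆ R'') (hA : A ⊆ A'') (hA' : A' ⊆ A'') :
    AgreeOff R'' A'' s₀ s₂ :=
  ⟨fun x hx => (h'.1 x fun hh => hx (hR' hh)).trans (h.1 x fun hh => hx (hR hh)),
    fun a ha => (h'.2 a fun hh => ha (hA' hh)).trans (h.2 a fun hh => ha (hA hh))⟩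

/-! ### One round of the main loop -/

/-- Selects a vertex and one which dominates it. -/
def select : Prog :=
  .seq argmax (.seq (scan nbrTest 7 8 9) (.seq (scan commonTest 11 12 10) choose))

lemma select_spec {s : State} {k : ℕ} (h3 : s.reg 3 = k) :
    HaltsWithin select s ((k + 1) * 1000) fun s' =>
      AgreeOff [0, 5, 6, 7, 8, 9, 10, 11, 12, 13, 14, 15] [] s s' ∧
      (∀ i < k, s.mem 8 i ≤ s.mem 8 (s'.reg 6)) ∧ (s'.reg 6 < k ∨ ∀ i < k, s.mem 8 i = 0) ∧
      (∃ c c' b q, Scanned (fun i => s.ent (s'.reg 6) i = 1) k (s'.reg 6) (s'.reg 7) (s'.reg 8) c ∧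
        Scanned (fun i => s.ent (s'.reg 6) i = 1 ∧ s.ent (s'.reg 7) i = 1) k (s'.reg 6) b q c' ∧
        s'.reg 13 = if c' = 0 then (if c = 1 then s'.reg 7 else s'.reg 6)
          else if c' = 1 then b else s'.reg 7) ∧
      (s'.reg 14 = 0 ↔ s'.reg 13 = s'.reg 6) ∧
      (s'.reg 13 ≠ s'.reg 6 → s'.reg 15 = s.mem 7 (s'.reg 13) ∧ s'.reg 0 = s.reg 0) ∧
      (s'.reg 13 = s'.reg 6 → s'.reg 15 = s.reg 0 ∧ s'.reg 0 = s.reg 0 + 1) := by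
  have ent_eq : ∀ {R : List ℕ} {s₁ s₂ : State}, AgreeOff R [] s₁ s₂ → s₂.ent = s₁.ent :=
    fun h => State.ent_congr (by rw [h.mem_eq]) (by rw [h.mem_eq])
  suffices h : HaltsWithin select s ((k + 1) * 100 + ((k + 1) * (nbrTest.cost + 100) +
      ((k + 1) * (commonTest.cost + 100) + 100))) _ from h.mono (by
    simp only [Expr.cost, nbrTest, commonTest, isOne, entExpr]; omega) (fun _ h => h)
  refine (argmax_spec h3).seq fun s₁ ⟨h1, hmax, hlt⟩ => ?_
  refine (scan_spec (k := k) (by rw [h1.1 3 (by simp), h3])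
    (fun i => s.ent (s₁.reg 6) i = 1) (by decide) fun s' h => ?_).seq fun s₂ ⟨h2, hscan⟩ => ?_
  · rw [eval_nbrTest, ent_eq h, ent_eq h1, h.1 6 (by simp)]
  have h2' : AgreeOff [5, 6, 7, 8, 9, 12] [] s s₂ :=
    h1.trans h2 (by simp) (by simp) (by simp) (by simp)
  refine (scan_spec (k := k) (by rw [h2'.1 3 (by simp), h3])
    (fun i => s.ent (s₂.reg 6) i = 1 ∧ s.ent (s₂.reg 7) i = 1) (by decide)
    fun s' h => ?_).seq fun s₃ ⟨h3', hscan'⟩ => ?_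
  · rw [eval_commonTest, ent_eq h, ent_eq h2', h.1 6 (by simp), h.1 7 (by simp)]
  have h3'' : AgreeOff [5, 6, 7, 8, 9, 10, 11, 12] [] s s₃ :=
    h2'.trans h3' (by simp) (by simp) (by simp) (by simp)
  refine (choose_spec s₃).mono le_rfl fun s' ⟨h4, h13, h14, h15, h16⟩ => ?_
  have e6 : s'.reg 6 = s₃.reg 6 := h4.1 6 (by simp)
  have e6' : s₃.reg 6 = s₂.reg 6 := h3'.1 6 (by simp)
  have e6'' : s₂.reg 6 = s₁.reg 6 := h2.1 6 (by simp)
  have e7 : s'.reg 7 = s₃.reg 7 := h4.1 7 (by simp)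
  have e7' : s₃.reg 7 = s₂.reg 7 := h3'.1 7 (by simp)
  have e8 : s'.reg 8 = s₂.reg 8 := (h4.1 8 (by simp)).trans (h3'.1 8 (by simp))
  have e9 : s₃.reg 9 = s₂.reg 9 := h3'.1 9 (by simp)
  have e0 : s₃.reg 0 = s.reg 0 := h3''.1 0 (by simp)
  rw [h3''.mem_eq, e0, ← e6] at h15
  rw [e0, ← e6] at h16
  rw [← e6] at h14
  refine ⟨h3''.trans h4 (by simp) (by simp) (by simp) (by simp), ?_, ?_,
    ⟨s₂.reg 9, s₃.reg 10, s₃.reg 11, s₃.reg 12, ?_, ?_, ?_⟩, h14, h15, h16⟩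
  · rw [e6, e6', e6'']; exact hmax
  · rw [e6, e6', e6'']; exact hlt
  · rw [e6, e6', e6'', e7, e7', e8]; exact hscan
  · rw [e6, e6', e7, e7']; exact hscan'
  · rw [h13, e9, e7, e6]

/-- Removes the selected vertex. -/
def remove : Prog := .seq computeRow (.seq writeRow finish)

lemma remove_spec {s : State} {k : ℕ} (h3 : s.reg 3 = k) (h9 : ∀ i < k, s.mem 9 i = k * i)
    (hv : s.reg 6 < k) :
    HaltsWithin remove s ((k + 1) * 300) fun s' =>
      AgreeOff [4, 5, 16] [0, 7, 8, 10] s s' ∧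
      (∀ i < k, ∀ j < k, s'.ent i j = if i = s.reg 6 then newDist s j else
        if j = s.reg 6 then newDist s i else s.ent i j) ∧
      (∀ i < k, s'.mem 8 i = if i = s.reg 6 then ∑ j ∈ Finset.range k, newDist s j else
        s.mem 8 i + newDist s i - s.ent (s.reg 6) i) ∧
      (s.reg 14 ≠ 0 → s'.reg 4 = s.reg 4 - 1 ∧ s'.mem 7 = s.mem 7) ∧
      (s.reg 14 = 0 → s'.reg 4 = s.reg 4 ∧
        ∀ i, s'.mem 7 i = if i = s.reg 6 then s.reg 15 else s.mem 7 i) := by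
  suffices h : HaltsWithin remove s ((k + 1) * 100 + ((k + 1) * 100 + 100)) _ from
    h.mono (by omega) (fun _ h => h)
  refine (computeRow_spec h3).seq fun s₁ ⟨h1, hq⟩ => ?_
  have e6 : s₁.reg 6 = s.reg 6 := h1.1 6 (by simp)
  have e0 : s₁.mem 0 = s.mem 0 := h1.2 0 (by simp)
  have e9 : s₁.mem 9 = s.mem 9 := h1.2 9 (by simp)
  have e8 : s₁.mem 8 = s.mem 8 := h1.2 8 (by simp)
  have e7 : s₁.mem 7 = s.mem 7 := h1.2 7 (by simp)
  have hent : s₁.ent = s.ent := State.ent_congr e0 e9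
  refine (writeRow_spec (k := k) (by rw [h1.1 3 (by simp), h3]) (by rw [e9]; exact h9)
    (by rw [e6]; exact hv)).seq fun s₂ ⟨h2, hent', hS, hsum⟩ => ?_
  refine (finish_spec s₂).mono le_rfl fun s' ⟨h4, hS', hold, hnew⟩ => ?_
  have e6' : s₂.reg 6 = s₁.reg 6 := h2.1 6 (by simp)
  have e14 : s₂.reg 14 = s.reg 14 := (h2.1 14 (by simp)).trans (h1.1 14 (by simp))
  have e15 : s₂.reg 15 = s.reg 15 := (h2.1 15 (by simp)).trans (h1.1 15 (by simp))
  have e4 : s₂.reg 4 = s.reg 4 := (h2.1 4 (by simp)).trans (h1.1 4 (by simp))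
  have e7' : s₂.mem 7 = s₁.mem 7 := h2.2 7 (by simp)
  have hent'' : s'.ent = s₂.ent := State.ent_congr (h4.2 0 (by simp)) (h4.2 9 (by simp))
  refine ⟨(h1.trans h2 (R'' := [4, 5, 16]) (A'' := [0, 7, 8, 10]) (by simp) (by simp) (by simp)
    (by simp)).trans h4 (by simp) (by simp) (by simp) (by simp), ?_, ?_, ?_, ?_⟩
  · intro i hi j hj
    rw [hent'', hent' i hi j hj, e6, hent, hq i hi, hq j hj]
  · intro i hi
    rw [hS', e6', e6, hsum, hS i hi, hq i hi, e8, e6, hent]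
    congr 1
    exact Finset.sum_congr rfl fun j hj => hq j (Finset.mem_range.1 hj)
  · intro h
    obtain ⟨h5, h6⟩ := hold (by rw [e14]; exact h)
    exact ⟨by rw [h5, e4], by rw [h6, e7', e7]⟩
  · intro h
    obtain ⟨h5, h6⟩ := hnew (by rw [e14]; exact h)
    exact ⟨by rw [h5, e4], fun i => by rw [h6, e6', e6, e15, e7', e7]⟩

end RAM

/-! ### The known part of the distance matrix -/

namespace RAM

open SimpleGraph

/-- The configuration `s` represents the distances between some vertices of `G`, the known ones,
among which are all boundary vertices. The vertex `x` is known if `slot x < k`; then `slot x` is the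
index of its row and of its column in the matrix. The name of `x` is the corresponding entry of
array `7`, and array `8` holds the sums of the rows. Rows and columns which belong to no vertex
are zero. -/
structure Represents {V : Type*} (G : SimpleGraph V) (k : ℕ) (slot : V → ℕ) (s : State) : Prop where
  size : s.reg 3 = k
  offset : ∀ i < k, s.mem 9 i = k * i
  slot_inj : ∀ x y, slot x < k → slot x = slot y → x = y
  dist : ∀ x y, slot x < k → slot y < k → s.ent (slot x) (slot y) = G.dist x y
  ent_eq_zero : ∀ i < k, (∀ x, slot x ≠ i) → ∀ j < k, s.ent i j = 0 ∧ s.ent j i = 0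
  rowSum : ∀ i < k, s.mem 8 i = ∑ j ∈ Finset.range k, s.ent i j
  count : s.reg 4 = {x | slot x < k}.ncard
  boundary : ∀ x, G.IsBoundaryVertex x → slot x < k
  name_lt : ∀ x, slot x < k → s.mem 7 (slot x) < s.reg 0
  name_inj : ∀ x y, slot x < k → slot y < k → s.mem 7 (slot x) = s.mem 7 (slot y) → x = y
  nonempty : ∃ x, slot x < k

namespace Represents

variable {V : Type*} {G : SimpleGraph V} {k : ℕ} {slot : V → ℕ} {s : State}

lemma ent_comm (R : Represents G k slot s) {i j : ℕ} (hi : i < k) (hj : j < k) :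
    s.ent i j = s.ent j i := by
  by_cases hi' : ∃ x, slot x = i
  · by_cases hj' : ∃ y, slot y = j
    · obtain ⟨x, rfl⟩ := hi'
      obtain ⟨y, rfl⟩ := hj'
      rw [R.dist x y hi hj, R.dist y x hj hi, dist_comm]
    · obtain ⟨h1, h2⟩ := R.ent_eq_zero j hj (by push Not at hj'; exact hj') i hi
      rw [h1, h2]
  · obtain ⟨h1, h2⟩ := R.ent_eq_zero i hi (by push Not at hi'; exact hi') j hj
    rw [h1, h2]

lemma rowSum_slot [Fintype V] (R : Represents G k slot s) {v : V} (hv : slot v < k) :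
    s.mem 8 (slot v) = ∑ x with slot x < k, G.dist x v := by
  classical
  rw [R.rowSum _ hv]
  have h : (Finset.univ.filter fun x => slot x < k).image slot ⊆ Finset.range k := by
    intro i hi
    simp only [Finset.mem_image, Finset.mem_filter] at hi
    obtain ⟨x, hx, rfl⟩ := hi
    exact Finset.mem_range.2 hx.2
  rw [← Finset.sum_subset h, Finset.sum_image]
  · refine Finset.sum_congr rfl fun x hx => ?_
    rw [R.dist v x hv (Finset.mem_filter.1 hx).2, dist_comm]
  · intro x hx y _ hxy
    exact R.slot_inj x y (by simpa using hx) hxy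
  · intro j hj hj'
    refine (R.ent_eq_zero j (Finset.mem_range.1 hj) (fun x hx => hj' ?_) _ hv).2
    exact Finset.mem_image.2 ⟨x, by simpa [hx] using hj, hx⟩

/-- A row with maximal sum belongs to a dominated vertex. -/
lemma exists_isDominatedBy [Finite V] [Nontrivial V] (hG : G.IsBridged) (h4 : G.CliqueFree 4)
    (R : Represents G k slot s) {i : ℕ} (hmax : ∀ j < k, s.mem 8 j ≤ s.mem 8 i)
    (hi : i < k ∨ ∀ j < k, s.mem 8 j = 0) :
    ∃ v u, slot v = i ∧ slot v < k ∧ G.IsDominatedBy v u := by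
  classical
  have := Fintype.ofFinite V
  obtain ⟨a, b, hab, ha, hb⟩ := hG.exists_boundary_pair h4
  have ha' := R.boundary a ha
  have hb' := R.boundary b hb
  have hpos : 0 < s.mem 8 (slot a) := by
    rw [R.rowSum_slot ha']
    refine Finset.sum_pos' (fun _ _ => Nat.zero_le _) ⟨b, by simpa using hb', ?_⟩
    exact hG.1.pos_dist_of_ne hab.symm
  have hik : i < k := by
    rcases hi with hi | hi
    · exact hi
    · rw [hi _ ha'] at hpos
      exact absurd hpos (lt_irrefl 0)
  have hocc : ∃ v, slot v = i := by
    by_contra hno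
    push Not at hno
    have h0 : s.mem 8 i = 0 := by
      rw [R.rowSum i hik]
      exact Finset.sum_eq_zero fun j hj => (R.ent_eq_zero i hik hno j (Finset.mem_range.1 hj)).1
    have := hmax _ ha'
    omega
  obtain ⟨v, rfl⟩ := hocc
  obtain ⟨u, hu⟩ := hG.exists_isDominatedBy_of_max h4 (B := {x | slot x < k}) (v := v)
    (fun x hx => by simpa using R.boundary x hx) (by simpa using hik) fun y hy => by
      have hy' : slot y < k := by simpa using hy
      rw [← R.rowSum_slot hy', ← R.rowSum_slot hik]
      exact hmax _ hy'
  exact ⟨v, u, rfl, hik, hu⟩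

lemma exists_adj (R : Represents G k slot s) {x : V} (hx : slot x < k) {i : ℕ} (hi : i < k)
    (h : s.ent (slot x) i = 1) : ∃ w, slot w = i ∧ G.Adj x w := by
  by_contra hno
  by_cases hocc : ∃ w, slot w = i
  · obtain ⟨w, rfl⟩ := hocc
    rw [R.dist x w hx hi, dist_eq_one_iff_adj] at h
    exact hno ⟨w, rfl, h⟩
  · push Not at hocc
    rw [(R.ent_eq_zero i hi hocc _ hx).2] at h
    exact absurd h (by omega)

lemma ent_eq_one (R : Represents G k slot s) {x y : V} (hx : slot x < k) (hy : slot y < k) :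
    s.ent (slot x) (slot y) = 1 ↔ G.Adj x y := by
  rw [R.dist x y hx hy, dist_eq_one_iff_adj]

/-- The search among the known neighbours of a dominated vertex `v` finds a known vertex which
dominates `v`, or else it shows that an unknown vertex does, and finds two neighbours from which
the distances of that vertex can be computed. -/
lemma exists_dominating (hG : G.IsBridged) (h4 : G.CliqueFree 4) (R : Represents G k slot s)
    {v u₀ : V} (hv : slot v < k) (hu₀ : G.IsDominatedBy v u₀) {a p c b q c' r : ℕ}
    (h1 : Scanned (fun i => s.ent (slot v) i = 1) k (slot v) a p c)
    (h2 : Scanned (fun i => s.ent (slot v) i = 1 ∧ s.ent a i = 1) k (slot v) b q c')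
    (hr : r = if c' = 0 then (if c = 1 then a else slot v) else if c' = 1 then b else a) :
    ∃ u, G.IsDominatedBy v u ∧ ((r ≠ slot v ∧ slot u = r ∧ slot u < k) ∨
      (r = slot v ∧ k ≤ slot u ∧ (∀ i < k, (∀ x, slot x ≠ i) → s.ent a i = 0 ∧ s.ent p i = 0) ∧
        s.ent a (slot v) ≤ 1 ∧ s.ent p (slot v) ≤ 1 ∧
        ∀ x, slot x < k → x ≠ v → G.dist u x = max (s.ent a (slot x)) (s.ent p (slot x)) - 1)) := by
  have hknown : ∀ w, G.Adj v w → w ≠ u₀ → slot w < k := fun w hw hwu =>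
    R.boundary w (hu₀.isBoundaryVertex_leaf h4 hw hwu)
  have hone : ∀ w, G.Adj v w → slot w < k → s.ent (slot v) (slot w) = 1 := fun w hw hwk =>
    (R.ent_eq_one hv hwk).2 hw
  have hne : ∀ w, G.Adj v w → slot w ≠ slot v := fun w hw h =>
    hw.ne (R.slot_inj v w hv h.symm)
  have hz : ∀ x, slot x < k → ∀ i < k, (∀ y, slot y ≠ i) → s.ent (slot x) i = 0 :=
    fun x hx i hi h => (R.ent_eq_zero i hi h _ hx).2
  rcases h1 with ⟨rfl, rfl, rfl, hno⟩ | ⟨rfl, hak, ha, huniq⟩ | ⟨hc, hak, hpk, hap, ha, hp⟩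
  · -- `v` is a leaf whose neighbour is unknown
    have hall : ∀ w, G.Adj v w → w = u₀ := fun w hw => by
      by_contra hwu
      exact hno _ (hknown w hw hwu) (hone w hw (hknown w hw hwu))
    have hu : k ≤ slot u₀ := by
      by_contra hlt
      exact hno _ (not_le.1 hlt) (hone u₀ hu₀.1 (not_le.1 hlt))
    have hc' : c' = 0 := by
      rcases h2 with h | h | h
      · exact h.1
      · exact absurd h.2.2.1.1 (hno _ h.2.1)
      · exact absurd h.2.2.2.2.1.1 (hno _ h.2.1)
    refine ⟨u₀, hu₀, Or.inr ⟨by simp [hr, hc'], hu, fun i hi h => ⟨hz v hv i hi h, hz v hv i hi h⟩,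
      by simp [R.dist v v hv hv], by simp [R.dist v v hv hv], fun x hx hxv => ?_⟩⟩
    rw [hG.dist_of_leaf hall hxv, R.dist v x hv hx, max_self]
  · -- `v` has one known neighbour; if that were not `u₀`, then `u₀` would be a boundary vertex
    obtain ⟨w, rfl, hw⟩ := R.exists_adj hv hak ha
    have hc' : c' = 0 := by
      have hself : ¬ s.ent (slot w) (slot w) = 1 := by simp [R.dist w w hak hak]
      rcases h2 with h | h | h
      · exact h.1
      · exact absurd (huniq _ h.2.1 h.2.2.1.1 ▸ h.2.2.1.2) hself
      · exact absurd (huniq _ h.2.1 h.2.2.2.2.1.1 ▸ h.2.2.2.2.1.2) hself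
    have hwu : w = u₀ := by
      by_contra hwu
      have hu : slot u₀ < k := R.boundary u₀ <| hu₀.isBoundaryVertex_center hw hwu fun d hd => by
        by_contra! hd'
        refine hd'.2 (R.slot_inj d w (hknown d hd hd'.1) (huniq _ (hknown d hd hd'.1) ?_))
        exact hone d hd (hknown d hd hd'.1)
      exact hwu (R.slot_inj w u₀ hak (huniq _ hu (hone u₀ hu₀.1 hu)).symm)
    refine ⟨u₀, hu₀, Or.inl ⟨?_, ?_, hwu ▸ hak⟩⟩
    · simpa [hr, hc'] using hne w hw
    · simp [hr, hc', hwu]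
  · obtain ⟨w₁, rfl, hw₁⟩ := R.exists_adj hv hak ha
    obtain ⟨w₂, rfl, hw₂⟩ := R.exists_adj hv hpk hp
    have hw : w₁ ≠ w₂ := fun h => hap (h ▸ rfl)
    have hcom : ∀ z, G.Adj v z → G.Adj w₁ z → slot z < k →
        s.ent (slot v) (slot z) = 1 ∧ s.ent (slot w₁) (slot z) = 1 := fun z hz hz' hk =>
      ⟨hone z hz hk, (R.ent_eq_one hak hk).2 hz'⟩
    rcases h2 with ⟨rfl, -, -, hno⟩ | ⟨rfl, hbk, hb, huniq⟩ | ⟨hc', hbk, hqk, hbq, hb, hq⟩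
    · -- no known vertex is adjacent to both `v` and `w₁`
      have h1u : w₁ ≠ u₀ := by
        rintro rfl
        exact hno _ hpk (hcom w₂ hw₂ ((hu₀.2 w₂ hw₂).resolve_left hw.symm).symm hpk)
      have hu : k ≤ slot u₀ := by
        by_contra hlt
        exact hno _ (not_le.1 hlt)
          (hcom u₀ hu₀.1 ((hu₀.2 w₁ hw₁).resolve_left h1u) (not_le.1 hlt))
      have h2u : w₂ ≠ u₀ := by
        rintro rfl
        exact absurd hpk (not_lt.2 hu)
      have hc1 : c ≠ 1 := by omega
      refine ⟨u₀, hu₀, Or.inr ⟨by simp [hr, hc1], hu, fun i hi h => ⟨hz w₁ hak i hi h,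
        hz w₂ hpk i hi h⟩, ((R.ent_eq_one hak hv).2 hw₁.symm).le,
        ((R.ent_eq_one hpk hv).2 hw₂.symm).le, fun x hx hxv => ?_⟩⟩
      rw [R.dist w₁ x hak hx, R.dist w₂ x hpk hx]
      exact hG.dist_of_isDominatedBy h4 hu₀ hw₁ hw₂ h1u h2u hw hxv
    · obtain ⟨z, rfl, hz⟩ := R.exists_adj hv hbk hb.1
      have hz' : G.Adj w₁ z := (R.ent_eq_one hak hbk).1 hb.2
      have hr' : r = slot z := by simp [hr]
      by_cases h1u : w₁ = u₀
      · -- `v` has two neighbours, and each of them dominates it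
        subst h1u
        refine ⟨z, hu₀.of_two hz fun d hd => ?_, Or.inl ⟨hr' ▸ hne z hz, hr'.symm, hbk⟩⟩
        by_contra! hd'
        have hdk := hknown d hd hd'.1
        exact hd'.2 (R.slot_inj d z hdk (huniq _ hdk
          (hcom d hd ((hu₀.2 d hd).resolve_left hd'.1).symm hdk)))
      · have hzu : z = u₀ := by
          by_contra hzu
          exact hu₀.not_adj h4 hw₁ hz h1u hzu hz'
        exact ⟨u₀, hu₀, Or.inl ⟨hr' ▸ hne z hz, by rw [hr', hzu], hzu ▸ hbk⟩⟩
    · -- only `u₀` can have two common neighbours with `v`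
      obtain ⟨z, rfl, hz⟩ := R.exists_adj hv hbk hb.1
      obtain ⟨z', rfl, hz₁⟩ := R.exists_adj hv hqk hq.1
      have hz' : G.Adj w₁ z := (R.ent_eq_one hak hbk).1 hb.2
      have hz₁' : G.Adj w₁ z' := (R.ent_eq_one hak hqk).1 hq.2
      have h1u : w₁ = u₀ := by
        by_contra h1u
        have e : ∀ z, G.Adj v z → G.Adj w₁ z → z = u₀ := fun z hz hz' => by
          by_contra hzu
          exact hu₀.not_adj h4 hw₁ hz h1u hzu hz'
        exact hbq (by rw [e z hz hz', e z' hz₁ hz₁'])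
      have hr' : r = slot w₁ := by
        rw [hr, if_neg (by omega), if_neg (by omega)]
      exact ⟨u₀, hu₀, Or.inl ⟨hr' ▸ hne w₁ hw₁, by rw [hr', h1u], h1u ▸ hak⟩⟩

end Represents

end RAM

/-! ### Updating the known part of the distance matrix -/

namespace RAM

open SimpleGraph

/-- The matrix of `s'` is obtained from that of `s` by writing `d` to the row and to the column with
index `v`, and the row sums are updated accordingly. -/
structure RowReplaced (k v : ℕ) (d : ℕ → ℕ) (s s' : State) : Prop where
  size : s'.reg 3 = s.reg 3
  offset : s'.mem 9 = s.mem 9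
  ent : ∀ i < k, ∀ j < k, s'.ent i j = if i = v then d j else if j = v then d i else s.ent i j
  rowSum : ∀ i < k, s'.mem 8 i =
    if i = v then ∑ j ∈ Finset.range k, d j else s.mem 8 i + d i - s.ent v i

namespace Represents

variable {V : Type*} {G : SimpleGraph V} {k : ℕ} {slot : V → ℕ} {s s' : State}

lemma rowSum_of_rowReplaced (R : Represents G k slot s) {v : ℕ} (hv : v < k) {d : ℕ → ℕ}
    (hr : RowReplaced k v d s s') : ∀ i < k, s'.mem 8 i = ∑ j ∈ Finset.range k, s'.ent i j := by
  intro i hi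
  rw [hr.rowSum i hi]
  split_ifs with h
  · subst h
    exact Finset.sum_congr rfl fun j hj => by rw [hr.ent _ hi j (Finset.mem_range.1 hj), if_pos rfl]
  · rw [R.rowSum i hi, R.ent_comm hv hi, ← Finset.add_sum_erase _ _ (Finset.mem_range.2 hv),
      ← Finset.add_sum_erase (f := s'.ent i) _ (Finset.mem_range.2 hv), hr.ent i hi v hv, if_neg h,
      if_pos rfl]
    have : ∑ j ∈ (Finset.range k).erase v, s'.ent i j =
        ∑ j ∈ (Finset.range k).erase v, s.ent i j := Finset.sum_congr rfl fun j hj => by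
      obtain ⟨hj1, hj2⟩ := Finset.mem_erase.1 hj
      rw [hr.ent i hi j (Finset.mem_range.1 hj2), if_neg h, if_neg hj1]
    rw [this]
    omega

/-- If a known vertex dominates `v`, then it suffices to delete `v`. -/
lemma forget [Finite V] (hc : G.Connected) (h4 : G.CliqueFree 4) (R : Represents G k slot s)
    {v u : V} (hv : slot v < k) (hu : G.IsDominatedBy v u) (huk : slot u < k) {d : ℕ → ℕ}
    (hd : ∀ i < k, d i = 0) (hr : RowReplaced k (slot v) d s s') (hcount : s'.reg 4 = s.reg 4 - 1)
    (hname : s'.mem 7 = s.mem 7) (h0 : s'.reg 0 = s.reg 0) :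
    Represents (G.delVertex v) k (fun x => slot x.1) s' where
  size := by rw [hr.size, R.size]
  offset := by rw [hr.offset]; exact R.offset
  slot_inj x y hx hxy := Subtype.ext (R.slot_inj _ _ hx hxy)
  dist x y hx hy := by
    have hne : ∀ z : {x // x ≠ v}, slot z.1 ≠ slot v := fun z h =>
      z.2 (R.slot_inj _ _ hv h.symm).symm
    rw [hr.ent _ hx _ hy, if_neg (hne x), if_neg (hne y), R.dist _ _ hx hy,
      (hu.dist_delVertex hc x y).2]
  ent_eq_zero i hi hno j hj := by
    rw [hr.ent i hi j hj, hr.ent j hj i hi, hd i hi, hd j hj]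
    by_cases h : i = slot v
    · simp [h]
    · obtain ⟨h1, h2⟩ := R.ent_eq_zero i hi (fun x hx => hno ⟨x, fun hxv => h (hxv ▸ hx.symm)⟩ hx)
        j hj
      simp [h1, h2]
  rowSum := R.rowSum_of_rowReplaced hv hr
  count := by
    rw [hcount, R.count, ← Set.ncard_sdiff_singleton_of_mem (a := v) hv,
      ← Set.ncard_image_of_injective _ Subtype.val_injective]
    congr 1
    ext x
    simp [and_comm]
  boundary x hx := by
    rcases hu.isBoundaryVertex_of_delVertex h4 hx with h | h
    · exact R.boundary _ h
    · rw [h]; exact huk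
  name_lt x hx := by rw [hname, h0]; exact R.name_lt _ hx
  name_inj x y hx hy hxy := by
    rw [hname] at hxy
    exact Subtype.ext (R.name_inj _ _ hx hy hxy)
  nonempty := ⟨⟨u, hu.1.ne'⟩, huk⟩

/-- If an unknown vertex `u` dominates `v`, then `u` takes over the slot of `v` and gets a
new name. -/
lemma replace [Finite V] [DecidableEq V] (hc : G.Connected) (h4 : G.CliqueFree 4)
    (R : Represents G k slot s) {v u : V} (hv : slot v < k) (hu : G.IsDominatedBy v u)
    (huk : k ≤ slot u) {d : ℕ → ℕ} (hdv : d (slot v) = 0)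
    (hdz : ∀ i < k, (∀ x, slot x ≠ i) → d i = 0)
    (hd : ∀ x, slot x < k → x ≠ v → G.dist u x = d (slot x))
    (hr : RowReplaced k (slot v) d s s') (hcount : s'.reg 4 = s.reg 4)
    (hname : ∀ i, s'.mem 7 i = if i = slot v then s.reg 0 else s.mem 7 i)
    (h0 : s'.reg 0 = s.reg 0 + 1) :
    Represents (G.delVertex v) k (fun x => if x.1 = u then slot v else slot x.1) s' := by
  have hne : ∀ x, x ≠ v → slot x ≠ slot v := fun x hx h => hx (R.slot_inj _ _ hv h.symm).symm
  have hknown : ∀ x : {x // x ≠ v}, x.1 ≠ u → (if x.1 = u then slot v else slot x.1) = slot x.1 :=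
    fun x hx => if_neg hx
  refine { size := ?_, offset := ?_, slot_inj := ?_, dist := ?_, ent_eq_zero := ?_, rowSum := ?_,
           count := ?_, boundary := ?_, name_lt := ?_, name_inj := ?_, nonempty := ?_ }
  · rw [hr.size, R.size]
  · rw [hr.offset]; exact R.offset
  · intro x y hx hxy
    by_cases hxu : x.1 = u <;> by_cases hyu : y.1 = u
    · exact Subtype.ext (hxu.trans hyu.symm)
    · rw [if_pos hxu, if_neg hyu] at hxy
      exact absurd hxy.symm (hne _ y.2)
    · rw [if_neg hxu, if_pos hyu] at hxy
      exact absurd hxy (hne _ x.2)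
    · rw [if_neg hxu] at hx hxy
      rw [if_neg hyu] at hxy
      exact Subtype.ext (R.slot_inj _ _ hx hxy)
  · intro x y hx hy
    rw [(hu.dist_delVertex hc x y).2, hr.ent _ hx _ hy]
    by_cases hxu : x.1 = u <;> by_cases hyu : y.1 = u
    · simp [hxu, hyu, hdv]
    · rw [if_neg hyu] at hy
      simp [hxu, hyu, hd _ hy y.2]
    · rw [if_neg hxu] at hx
      simp [hxu, hyu, hne _ x.2, dist_comm (G := G) (u := x.1), hd _ hx x.2]
    · rw [if_neg hyu] at hy
      rw [if_neg hxu] at hx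
      simp [hxu, hyu, hne _ x.2, hne _ y.2, R.dist _ _ hx hy]
  · intro i hi hno j hj
    have hiv : i ≠ slot v := fun h => hno ⟨u, hu.1.ne'⟩ (by simp [h])
    have hno' : ∀ x, slot x ≠ i := by
      intro x hx
      have hxu : x ≠ u := by rintro rfl; omega
      exact hno ⟨x, by rintro rfl; exact hiv hx.symm⟩ (by simp [hxu, hx])
    obtain ⟨h1, h2⟩ := R.ent_eq_zero i hi hno' j hj
    rw [hr.ent i hi j hj, hr.ent j hj i hi, hdz i hi hno', if_neg hiv, if_neg hiv, h1, h2]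
    simp
  · exact R.rowSum_of_rowReplaced hv hr
  · have hv' : v ∈ {x | slot x < k} := hv
    rw [hcount, R.count, ← Set.ncard_sdiff_singleton_add_one hv',
      ← Set.ncard_insert_of_notMem (a := u) (s := {x | slot x < k} \ {v}) (by simp [huk]),
      ← Set.ncard_image_of_injective _ Subtype.val_injective]
    congr 1
    ext x
    have hvu := hu.1.ne
    simp only [Set.mem_insert_iff, Set.mem_sdiff, Set.mem_ofPred_eq, Set.mem_singleton_iff,
      Set.mem_image, Subtype.exists, exists_and_right, exists_eq_right]
    constructor
    · rintro (rfl | ⟨h1, h2⟩)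
      · exact ⟨hvu.symm, by simpa using hv⟩
      · have hxu : x ≠ u := by rintro rfl; omega
        exact ⟨h2, by simpa [hxu] using h1⟩
    · rintro ⟨h1, h2⟩
      by_cases hxu : x = u
      · exact Or.inl hxu
      · exact Or.inr ⟨by simpa [hxu] using h2, h1⟩
  · intro x hx
    by_cases hxu : x.1 = u
    · simp [hxu, hv]
    · rcases hu.isBoundaryVertex_of_delVertex h4 hx with h | h
      · simp [hxu, R.boundary _ h]
      · exact absurd h hxu
  · intro x hx
    rw [hname, h0]
    by_cases hxu : x.1 = u
    · simp [hxu]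
    · rw [if_neg hxu] at hx
      have := R.name_lt _ hx
      simp only [hxu, if_false, hne _ x.2]
      omega
  · intro x y hx hy hxy
    rw [hname, hname] at hxy
    by_cases hxu : x.1 = u <;> by_cases hyu : y.1 = u
    · exact Subtype.ext (hxu.trans hyu.symm)
    · rw [if_neg hyu] at hy
      have := R.name_lt _ hy
      simp only [hxu, hyu, if_true, if_false, hne _ y.2] at hxy
      omega
    · rw [if_neg hxu] at hx
      have := R.name_lt _ hx
      simp only [hxu, hyu, if_true, if_false, hne _ x.2] at hxy
      omega
    · rw [if_neg hxu] at hx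
      rw [if_neg hyu] at hy
      simp only [hxu, hyu, if_false, hne _ x.2, hne _ y.2] at hxy
      exact Subtype.ext (R.name_inj _ _ hx hy hxy)
  · exact ⟨⟨u, hu.1.ne'⟩, by simpa using hv⟩

end Represents

end RAM

/-! ### Correctness of one round -/

namespace RAM

open SimpleGraph

/-- The result of one round of the main loop: the vertex `v`, dominated by `u`, is removed, its star
is listed, and `u` is known afterwards. -/
structure Round {V : Type*} (G : SimpleGraph V) (k : ℕ) (slot : V → ℕ) (s : State) (v : V)
    (u : {x // x ≠ v}) (slot' : {x // x ≠ v} → ℕ) (s' : State) : Prop where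
  dominated : G.IsDominatedBy v u.1
  known : slot v < k
  known' : slot' u < k
  represents : Represents (G.delVertex v) k slot' s'
  edges : s'.reg 1 = s.reg 1 + 1 + {w | G.Adj v w ∧ w ≠ u}.ncard
  triangles : s'.reg 2 = s.reg 2 + {w | G.Adj v w ∧ w ≠ u}.ncard
  listed : s'.listed = s.listed ∪ {σ | σ = {s.mem 7 (slot v), s'.mem 7 (slot' u)} ∨
    ∃ w, G.Adj v w ∧ w ≠ u ∧ (σ = {s.mem 7 (slot v), s.mem 7 (slot w)} ∨
      σ = {s.mem 7 (slot v), s'.mem 7 (slot' u), s.mem 7 (slot w)})}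
  names_le : s.reg 0 ≤ s'.reg 0
  names_add : s'.reg 0 + s.reg 4 = s.reg 0 + s'.reg 4 + 1
  name_eq : ∀ x : {x // x ≠ v}, slot x < k →
    slot' x < k ∧ s'.mem 7 (slot' x) = s.mem 7 (slot x)
  le_name : ∀ x : {x // x ≠ v}, k ≤ slot x → slot' x < k → s.reg 0 ≤ s'.mem 7 (slot' x)

/-- One round of the main loop. -/
def round : Prog := .seq select (.seq emit remove)

lemma Represents.neighbour_slots {V : Type*} [Finite V] {G : SimpleGraph V} {k : ℕ} {slot : V → ℕ}
    {s : State} (h4 : G.CliqueFree 4) (R : Represents G k slot s) {v u : V} (hv : slot v < k)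
    (hu : G.IsDominatedBy v u) {r : ℕ}
    (hr : (r ≠ slot v ∧ slot u = r ∧ slot u < k) ∨ (r = slot v ∧ k ≤ slot u)) :
    (((Finset.range k).filter fun i => s.ent (slot v) i = 1 ∧ i ≠ r : Finset ℕ) : Set ℕ) =
      slot '' {w | G.Adj v w ∧ w ≠ u} := by
  ext i
  simp only [Finset.coe_filter, Finset.mem_range, Set.mem_ofPred_eq, Set.mem_image]
  constructor
  · rintro ⟨hi, h1, h2⟩
    obtain ⟨w, rfl, hw⟩ := R.exists_adj hv hi h1
    refine ⟨w, ⟨hw, ?_⟩, rfl⟩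
    rintro rfl
    rcases hr with hr | hr
    · exact h2 hr.2.1
    · omega
  · rintro ⟨w, ⟨hw, hwu⟩, rfl⟩
    have hk := R.boundary w (hu.isBoundaryVertex_leaf h4 hw hwu)
    refine ⟨hk, (R.ent_eq_one hv hk).2 hw, ?_⟩
    rintro h
    rcases hr with hr | hr
    · exact hwu (R.slot_inj _ _ hk (by rw [h, hr.2.1]))
    · exact hw.ne (R.slot_inj _ _ hv (by rw [h, hr.1]))

lemma round_spec {V : Type*} [Finite V] [Nontrivial V] {G : SimpleGraph V} {k : ℕ} {slot : V → ℕ}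
    {s : State} (hG : G.IsBridged) (h4 : G.CliqueFree 4) (R : Represents G k slot s) :
    HaltsWithin round s ((k + 1) * 1500) fun s' => ∃ v u slot', Round G k slot s v u slot' s' := by
  classical
  suffices h : HaltsWithin round s ((k + 1) * 1000 + ((k + 1) * 200 + (k + 1) * 300)) _ from
    h.mono (by omega) (fun _ h => h)
  refine (select_spec R.size).seq fun s₁ ⟨h1, hmax, hlt, ⟨c, c', b, q, hsc, hsc', h13⟩, h14, hA,
    hB⟩ => ?_
  obtain ⟨v, u₀, hv6, hv, hu₀⟩ := R.exists_isDominatedBy hG h4 hmax hlt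
  rw [← hv6] at hsc hsc' h13 h14 hA hB
  obtain ⟨u, hu, hcase⟩ := R.exists_dominating hG h4 hv hu₀ hsc hsc' h13
  have hW := R.neighbour_slots h4 hv hu (hcase.imp_right fun h => ⟨h.1, h.2.1⟩)
  have hmem1 := h1.mem_eq
  have hent1 : s₁.ent = s.ent := State.ent_congr (by rw [hmem1]) (by rw [hmem1])
  set W := (Finset.range k).filter fun i => s.ent (slot v) i = 1 ∧ i ≠ s₁.reg 13 with hWdef
  have h31 : s₁.reg 3 = k := by rw [h1.1 3 (by simp), R.size]
  refine (emit_spec h31 (W := W) (by rw [hWdef, hent1, hv6])).seq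
    fun s₂ ⟨h2, hr1, hr2, hlist⟩ => ?_
  have e6 : s₂.reg 6 = slot v := by rw [h2.1 6 (by simp), hv6]
  have e7 : s₂.reg 7 = s₁.reg 7 := h2.1 7 (by simp)
  have e8 : s₂.reg 8 = s₁.reg 8 := h2.1 8 (by simp)
  have e14 : s₂.reg 14 = s₁.reg 14 := h2.1 14 (by simp)
  have e15 : s₂.reg 15 = s₁.reg 15 := h2.1 15 (by simp)
  have m0 : s₂.mem 0 = s.mem 0 := by rw [h2.2 0 (by simp), hmem1]
  have m7 : s₂.mem 7 = s.mem 7 := by rw [h2.2 7 (by simp), hmem1]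
  have m8 : s₂.mem 8 = s.mem 8 := by rw [h2.2 8 (by simp), hmem1]
  have m9 : s₂.mem 9 = s.mem 9 := by rw [h2.2 9 (by simp), hmem1]
  have hent2 : s₂.ent = s.ent := State.ent_congr m0 m9
  refine (remove_spec (k := k) (by rw [h2.1 3 (by simp), h31]) (by rw [m9]; exact R.offset)
    (by rw [e6]; exact hv)).mono le_rfl fun s' ⟨h3, hent, h8, hold, hnew⟩ => ?_
  have hrow : RowReplaced k (slot v) (newDist s₂) s s' :=
    { size := by rw [h3.1 3 (by simp), h2.1 3 (by simp), h1.1 3 (by simp)]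
      offset := by rw [h3.2 9 (by simp), m9]
      ent := by rw [← e6, ← hent2]; exact hent
      rowSum := by rw [← e6, ← hent2, ← m8]; exact h8 }
  have hWc : W.card = {w | G.Adj v w ∧ w ≠ u}.ncard := by
    rw [← Set.ncard_coe_finset, hW]
    exact Set.InjOn.ncard_image fun x hx y _ hxy =>
      R.slot_inj x y (R.boundary x (hu.isBoundaryVertex_leaf h4 hx.1 hx.2)) hxy
  have r1 : s'.reg 1 = s.reg 1 + 1 + {w | G.Adj v w ∧ w ≠ u}.ncard := by
    rw [h3.1 1 (by simp), hr1, hWc, h1.1 1 (by simp)]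
  have r2 : s'.reg 2 = s.reg 2 + {w | G.Adj v w ∧ w ≠ u}.ncard := by
    rw [h3.1 2 (by simp), hr2, hWc, h1.1 2 (by simp)]
  have r0 : s'.reg 0 = s₁.reg 0 := by rw [h3.1 0 (by simp), h2.1 0 (by simp)]
  have r4 : s₂.reg 4 = s.reg 4 := by rw [h2.1 4 (by simp), h1.1 4 (by simp)]
  have hpos : 1 ≤ s.reg 4 := by
    rw [R.count]
    exact (Set.ncard_pos).2 ⟨v, hv⟩
  have hlist' : s'.listed = s.listed ∪ {σ | σ = {s.mem 7 (slot v), s₁.reg 15} ∨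
      ∃ w, G.Adj v w ∧ w ≠ u ∧ (σ = {s.mem 7 (slot v), s.mem 7 (slot w)} ∨
        σ = {s.mem 7 (slot v), s₁.reg 15, s.mem 7 (slot w)})} := by
    have hl : s'.listed = s₂.listed := by
      simp only [State.listed, h3.1 1 (by simp), h3.1 2 (by simp), h3.2 1 (by simp),
        h3.2 2 (by simp), h3.2 3 (by simp), h3.2 4 (by simp), h3.2 5 (by simp)]
    have hl1 : s₁.listed = s.listed := by
      simp only [State.listed, hmem1, h1.1 1 (by simp), h1.1 2 (by simp)]
    rw [hl, hlist, hl1, hmem1, ← hv6]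
    congr 1
    have hmW : ∀ i, i ∈ W ↔ ∃ w, (G.Adj v w ∧ w ≠ u) ∧ slot w = i := fun i => by
      rw [← Finset.mem_coe, hW]; rfl
    ext σ
    simp only [starSimplices, Set.mem_ofPred_eq, hmW]
    grind
  rcases hcase with ⟨hne, hur, huk⟩ | ⟨heq, huk, hz, hav, hpv, hd⟩
  · obtain ⟨h15, h0⟩ := hA hne
    have h14' : s₂.reg 14 ≠ 0 := by rw [e14]; exact fun h => hne (h14.1 h)
    obtain ⟨hc4, hn⟩ := hold h14'
    rw [m7] at hn
    have R' := R.forget hG.1 h4 hv hu huk (fun i _ => by simp [newDist, h14']) hrow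
      (by rw [hc4, r4]) hn (by rw [r0, h0])
    refine ⟨v, ⟨u, hu.1.ne'⟩, fun x => slot x.1, hu, hv, huk, R', r1, r2, ?_, by omega, by omega,
      fun x hx => ⟨hx, by rw [hn]⟩, fun x hx hx' => absurd hx' (not_lt.2 hx)⟩
    rw [hlist', h15, hn, ← hur]
  · obtain ⟨h15, h0⟩ := hB heq
    have h14' : s₂.reg 14 = 0 := by rw [e14]; exact h14.2 heq
    obtain ⟨hc4, hn⟩ := hnew h14'
    rw [m7, e6, e15, h15] at hn
    have hnd : ∀ i, newDist s₂ i = max (s.ent (s₁.reg 7) i) (s.ent (s₁.reg 8) i) - 1 := fun i => by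
      rw [newDist, if_pos h14', e7, e8, hent2]
    have R' := R.replace (u := u) hG.1 h4 hv hu huk (by rw [hnd]; omega)
      (fun i hi hno => by simp [hnd, hz i hi hno]) (fun x hx hxv => by rw [hnd, hd x hx hxv]) hrow
      (by rw [hc4, r4]) hn (by rw [r0, h0])
    refine ⟨v, ⟨u, hu.1.ne'⟩, _, hu, hv, by simpa using hv, R', r1, r2, ?_, by omega, by omega,
      fun x hx => ?_, fun x hx hx' => ?_⟩
    · rw [hlist', h15]
      simp [hn]
    · have hxu : x.1 ≠ u := fun h => absurd hx (not_lt.2 (h ▸ huk))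
      refine ⟨by simpa [hxu] using hx, ?_⟩
      simp only [hn, hxu, if_false]
      exact if_neg fun h => x.2 (R.slot_inj _ _ hv h.symm).symm
    · by_cases hxu : x.1 = u
      · simp [hn, hxu]
      · rw [if_neg hxu] at hx'
        exact absurd hx' (not_lt.2 hx)

end RAM

/-! ### Cliques containing a dominated vertex -/

namespace SimpleGraph

variable {V : Type*} {G : SimpleGraph V} {v u : V}

/-- The cliques of a `K₄`-free graph which contain a dominated vertex. -/
lemma IsDominatedBy.isClique_iff [DecidableEq V] (h4 : G.CliqueFree 4) (h : G.IsDominatedBy v u)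
    {σ : Finset V} (hv : v ∈ σ) : G.IsClique (σ : Set V) ∧ 2 ≤ σ.card ↔
      σ = {v, u} ∨ ∃ w, G.Adj v w ∧ w ≠ u ∧ (σ = {v, w} ∨ σ = {v, u, w}) := by
  constructor
  · rintro ⟨hc, hσ⟩
    have hadj : ∀ w ∈ σ, w ≠ v → G.Adj v w := fun w hw hwv => hc hv hw hwv.symm
    by_cases hw : ∃ w ∈ σ, w ≠ v ∧ w ≠ u
    · obtain ⟨w, hw, hwv, hwu⟩ := hw
      have huniq : ∀ z ∈ σ, z = v ∨ z = u ∨ z = w := by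
        intro z hz
        by_contra! hz'
        exact h.not_adj h4 (hadj w hw hwv) (hadj z hz hz'.1) hwu hz'.2.1 (hc hw hz hz'.2.2.symm)
      refine Or.inr ⟨w, hadj w hw hwv, hwu, ?_⟩
      by_cases huσ : u ∈ σ
      · right
        ext z
        simp only [Finset.mem_insert, Finset.mem_singleton]
        exact ⟨huniq z, by rintro (rfl | rfl | rfl) <;> assumption⟩
      · left
        ext z
        simp only [Finset.mem_insert, Finset.mem_singleton]
        constructor
        · intro hz
          rcases huniq z hz with rfl | rfl | rfl
          · exact Or.inl rfl
          · exact absurd hz huσ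
          · exact Or.inr rfl
        · rintro (rfl | rfl) <;> assumption
    · push Not at hw
      left
      obtain ⟨z, hz, hzv⟩ := Finset.exists_mem_ne (by omega : 1 < σ.card) v
      have hzu := hw z hz hzv
      subst hzu
      ext y
      simp only [Finset.mem_insert, Finset.mem_singleton]
      constructor
      · intro hy
        by_cases hyv : y = v
        · exact Or.inl hyv
        · exact Or.inr (hw y hy hyv)
      · rintro (rfl | rfl) <;> assumption
  · rintro (rfl | ⟨w, hw, hwu, rfl | rfl⟩)
    · refine ⟨?_, (Finset.card_pair h.1.ne).ge⟩
      simp [h.1]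
    · refine ⟨?_, (Finset.card_pair hw.ne).ge⟩
      simp [hw]
    · have huw : G.Adj u w := ((h.2 w hw).resolve_left hwu).symm
      refine ⟨?_, ?_⟩
      · simp [isClique_insert, h.1, hw, huw]
      · rw [Finset.card_eq_three.2 ⟨v, u, w, h.1.ne, hw.ne, hwu.symm, rfl⟩]
        omega

lemma isClique_delVertex {σ : Finset {x // x ≠ v}} :
    (G.delVertex v).IsClique (σ : Set {x // x ≠ v}) ↔
      G.IsClique (σ.map (Function.Embedding.subtype _) : Finset V) := by
  simp only [IsClique, Set.Pairwise, Finset.coe_map, Set.mem_image, Finset.mem_coe,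
    Function.Embedding.subtype_apply]
  constructor
  · rintro h _ ⟨x, hx, rfl⟩ _ ⟨y, hy, rfl⟩ hxy
    exact h hx hy fun e => hxy (e ▸ rfl)
  · intro h x hx y hy hxy
    exact h ⟨x, hx, rfl⟩ ⟨y, hy, rfl⟩ fun e => hxy (Subtype.ext e)

lemma exists_map_subtype_iff {v : V} {σ : Finset V} :
    (∃ τ : Finset {x // x ≠ v}, τ.map (Function.Embedding.subtype _) = σ) ↔ v ∉ σ := by
  classical
  constructor
  · rintro ⟨τ, rfl⟩
    simp
  · intro h
    refine ⟨σ.subtype _, Finset.subtype_map_of_mem fun x hx => ?_⟩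
    rintro rfl
    exact h hx

lemma ncard_cliqueSet_eq_add [Finite V] (G : SimpleGraph V) (v : V) (n : ℕ) :
    (G.cliqueSet n).ncard =
      ((G.delVertex v).cliqueSet n).ncard + {σ | σ ∈ G.cliqueSet n ∧ v ∈ σ}.ncard := by
  have hinj := Finset.map_injective (Function.Embedding.subtype fun x => x ≠ v)
  rw [← Set.ncard_image_of_injective _ hinj, ← Set.ncard_union_eq]
  · congr 1
    ext σ
    simp only [Set.mem_union, Set.mem_image, Set.mem_ofPred_eq, mem_cliqueSet_iff, isNClique_iff,
      isClique_delVertex]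
    constructor
    · intro h
      by_cases hv : v ∈ σ
      · exact Or.inr ⟨h, hv⟩
      · obtain ⟨τ, rfl⟩ := exists_map_subtype_iff.2 hv
        exact Or.inl ⟨τ, ⟨h.1, by simpa using h.2⟩, rfl⟩
    · rintro (⟨τ, h, rfl⟩ | h)
      · exact ⟨h.1, by simpa using h.2⟩
      · exact h.1
  · rw [Set.disjoint_left]
    rintro _ ⟨τ, -, rfl⟩ ⟨-, h⟩
    simp at h

lemma IsDominatedBy.ncard_cliqueSet_two [Finite V] (h : G.IsDominatedBy v u) :
    (G.cliqueSet 2).ncard =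
      ((G.delVertex v).cliqueSet 2).ncard + (1 + {w | G.Adj v w ∧ w ≠ u}.ncard) := by
  classical
  have hn : u ∉ {w | G.Adj v w ∧ w ≠ u} := fun h => h.2 rfl
  rw [G.ncard_cliqueSet_eq_add v, add_comm 1, ← Set.ncard_insert_of_notMem hn,
    ← Set.InjOn.ncard_image (f := fun w => ({v, w} : Finset V))]
  · congr 2
    ext σ
    simp only [Set.mem_ofPred_eq, Set.mem_image, Set.mem_insert_iff, mem_cliqueSet_iff,
      isNClique_iff]
    constructor
    · rintro ⟨⟨h1, h2⟩, h3⟩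
      obtain ⟨w, hw⟩ := Finset.card_eq_one.1 (by rw [Finset.card_erase_of_mem h3, h2] :
        (σ.erase v).card = 1)
      have hσ : σ = {v, w} := by rw [← Finset.insert_erase h3, hw]
      have hwv : w ≠ v := fun e => by simp [hσ, e] at h2
      have hadj : G.Adj v w := h1 h3 (by simp [hσ]) hwv.symm
      refine ⟨w, ?_, hσ.symm⟩
      by_cases hwu : w = u
      · exact Or.inl hwu
      · exact Or.inr ⟨hadj, hwu⟩
    · rintro ⟨w, hw, rfl⟩
      have hw' : G.Adj v w := by
        rcases hw with rfl | hw
        · exact h.1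
        · exact hw.1
      exact ⟨⟨by simp [hw'], Finset.card_pair hw'.ne⟩, by simp⟩
  · intro x hx y hy hxy
    have hne : ∀ w ∈ insert u {w | G.Adj v w ∧ w ≠ u}, w ≠ v := by
      rintro w (rfl | hw)
      · exact h.1.ne'
      · exact hw.1.ne'
    have hx' : x ∈ ({v, y} : Finset V) := by
      rw [← show ({v, x} : Finset V) = {v, y} from hxy]; simp
    simpa [hne x hx] using hx'

lemma IsDominatedBy.ncard_cliqueSet_three [Finite V] (h4 : G.CliqueFree 4)
    (h : G.IsDominatedBy v u) :
    (G.cliqueSet 3).ncard =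
      ((G.delVertex v).cliqueSet 3).ncard + {w | G.Adj v w ∧ w ≠ u}.ncard := by
  classical
  rw [G.ncard_cliqueSet_eq_add v, ← Set.InjOn.ncard_image (f := fun w => ({v, u, w} : Finset V))]
  · congr 2
    ext σ
    simp only [Set.mem_ofPred_eq, Set.mem_image, mem_cliqueSet_iff, isNClique_iff]
    constructor
    · rintro ⟨⟨h1, h2⟩, h3⟩
      rcases (h.isClique_iff h4 h3).1 ⟨h1, by omega⟩ with rfl | ⟨w, hw, hwu, rfl | rfl⟩
      · have := Finset.card_le_two (a := v) (b := u)
        omega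
      · have := Finset.card_le_two (a := v) (b := w)
        omega
      · exact ⟨w, ⟨hw, hwu⟩, rfl⟩
    · rintro ⟨w, ⟨hw, hwu⟩, rfl⟩
      exact ⟨⟨((h.isClique_iff h4 (by simp)).2 (Or.inr ⟨w, hw, hwu, Or.inr rfl⟩)).1,
        Finset.card_eq_three.2 ⟨v, u, w, h.1.ne, hw.ne, hwu.symm, rfl⟩⟩, by simp⟩
  · intro x hx y hy hxy
    have hx' : x ∈ ({v, u, y} : Finset V) := by
      rw [← show ({v, u, x} : Finset V) = {v, u, y} from hxy]; simp
    simpa [hx.1.ne', hx.2] using hx'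

end SimpleGraph

/-! ### Correctness of the main loop -/

namespace RAM

open SimpleGraph

/-- The configuration `s'` is reached from `s` by listing all simplices of dimension at least `1` of
the clique complex of `G`, where the vertex `x` has the name `φ x`. The unknown vertices
get new names, consecutive numbers beginning with the content of register `0`. -/
structure Lists {V : Type*} (G : SimpleGraph V) (k : ℕ) (slot : V → ℕ) (s : State) (φ : V → ℕ)
    (s' : State) : Prop where
  inj : Function.Injective φ
  name_eq : ∀ x, slot x < k → φ x = s.mem 7 (slot x)
  le_name : ∀ x, k ≤ slot x → s.reg 0 ≤ φ x
  name_lt : ∀ x, φ x < s'.reg 0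
  names_add : s'.reg 0 + s.reg 4 = s.reg 0 + Nat.card V
  listed : s'.listed = s.listed ∪
    {τ | ∃ σ : Finset V, G.IsClique (σ : Set V) ∧ 2 ≤ σ.card ∧ τ = σ.image φ}
  edges : s'.reg 1 = s.reg 1 + (G.cliqueSet 2).ncard
  triangles : s'.reg 2 = s.reg 2 + (G.cliqueSet 3).ncard

lemma Lists.of_subsingleton {V : Type*} [Subsingleton V] {G : SimpleGraph V} {k : ℕ}
    {slot : V → ℕ} {s : State} (R : Represents G k slot s) :
    Lists G k slot s (fun x => s.mem 7 (slot x)) s := by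
  have hcard : ∀ σ : Finset V, σ.card ≤ 1 := fun σ => Finset.card_le_one_of_subsingleton σ
  obtain ⟨x₀, hx₀⟩ := R.nonempty
  have hknown : ∀ x, slot x < k := fun x => Subsingleton.elim x₀ x ▸ hx₀
  have hempty : ∀ n, 2 ≤ n → (G.cliqueSet n).ncard = 0 := fun n hn => by
    have : G.cliqueSet n = ∅ := by
      ext σ
      have := hcard σ
      simp only [mem_cliqueSet_iff, isNClique_iff, Set.mem_empty_iff_false, iff_false]
      omega
    rw [this, Set.ncard_empty]
  refine ⟨Function.injective_of_subsingleton _, fun _ _ => rfl, fun x hx =>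
    absurd (hknown x) (not_lt.2 hx), fun x => R.name_lt x (hknown x), ?_, ?_, ?_, ?_⟩
  · rw [R.count, ← Set.ncard_univ]
    congr 2
    ext x
    simp [hknown x]
  · ext τ
    simp only [Set.mem_union, Set.mem_ofPred_eq]
    refine ⟨Or.inl, ?_⟩
    rintro (h | ⟨σ, -, h, -⟩)
    · exact h
    · have := hcard σ
      omega
  · rw [hempty 2 le_rfl, add_zero]
  · rw [hempty 3 (by omega), add_zero]

/-- One round, followed by the listing of the rest, lists the whole complex. -/
lemma Round.lists {V : Type*} [Finite V] [DecidableEq V] {G : SimpleGraph V} {k : ℕ}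
    {slot : V → ℕ} {s s₁ s' : State} (h4 : G.CliqueFree 4) (R : Represents G k slot s) {v : V}
    {u : {x // x ≠ v}} {slot' : {x // x ≠ v} → ℕ} (h : Round G k slot s v u slot' s₁)
    {φ : {x // x ≠ v} → ℕ} (hφ : Lists (G.delVertex v) k slot' s₁ φ s') :
    Lists G k slot s (fun x => if hx : x = v then s.mem 7 (slot v) else φ ⟨x, hx⟩) s' := by
  set ψ : V → ℕ := fun x => if hx : x = v then s.mem 7 (slot v) else φ ⟨x, hx⟩ with hψ
  have hψv : ψ v = s.mem 7 (slot v) := by simp [hψ]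
  have hψx : ∀ x : {x // x ≠ v}, ψ x.1 = φ x := fun x => by simp [hψ, x.2]
  have hvlt := R.name_lt v h.known
  have hknown : ∀ x : {x // x ≠ v}, slot x.1 < k → φ x = s.mem 7 (slot x.1) := fun x hx => by
    obtain ⟨h1, h2⟩ := h.name_eq x hx
    rw [hφ.name_eq x h1, h2]
  have hunknown : ∀ x : {x // x ≠ v}, k ≤ slot x.1 → s.reg 0 ≤ φ x := fun x hx => by
    by_cases hx' : slot' x < k
    · rw [hφ.name_eq x hx']
      exact h.le_name x hx hx'
    · exact h.names_le.trans (hφ.le_name x (not_lt.1 hx'))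
  have hne : ∀ x : {x // x ≠ v}, φ x ≠ s.mem 7 (slot v) := fun x => by
    by_cases hx : slot x.1 < k
    · rw [hknown x hx]
      exact fun e => x.2 (R.name_inj _ _ hx h.known e)
    · have := hunknown x (not_lt.1 hx)
      omega
  have hcard : Nat.card V = Nat.card {x // x ≠ v} + 1 := by
    have := Nat.card_congr (Equiv.optionSubtypeNe v)
    rw [← this, Finite.card_option]
  have hcount : s₁.reg 4 ≤ Nat.card {x // x ≠ v} := by
    rw [h.represents.count]
    exact Set.ncard_le_card _
  have hψu : s₁.mem 7 (slot' u) = ψ u.1 := by rw [hψx, hφ.name_eq u h.known']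
  have hnames := hφ.names_add
  have hnames' := h.names_add
  refine { inj := ?_, name_eq := ?_, le_name := ?_, name_lt := ?_, names_add := ?_, listed := ?_,
           edges := ?_, triangles := ?_ }
  · intro x y hxy
    by_cases hx : x = v <;> by_cases hy : y = v
    · rw [hx, hy]
    · rw [hx, hψv, hψx ⟨y, hy⟩] at hxy
      exact absurd hxy.symm (hne _)
    · rw [hy, hψv, hψx ⟨x, hx⟩] at hxy
      exact absurd hxy (hne _)
    · rw [hψx ⟨x, hx⟩, hψx ⟨y, hy⟩] at hxy
      exact congrArg Subtype.val (hφ.inj hxy)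
  · intro x hx
    by_cases hxv : x = v
    · rw [hxv, hψv]
    · rw [hψx ⟨x, hxv⟩, hknown ⟨x, hxv⟩ hx]
  · intro x hx
    have hxv : x ≠ v := fun e => absurd h.known (not_lt.2 (e ▸ hx))
    rw [hψx ⟨x, hxv⟩]
    exact hunknown ⟨x, hxv⟩ hx
  · intro x
    by_cases hxv : x = v
    · rw [hxv, hψv]
      have := h.names_le
      omega
    · rw [hψx ⟨x, hxv⟩]
      exact hφ.name_lt _
  · omega
  · have hw : ∀ w, G.Adj v w → w ≠ u → ψ w = s.mem 7 (slot w) := fun w hw hwu => by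
      have hk := R.boundary w (h.dominated.isBoundaryVertex_leaf h4 hw hwu)
      rw [hψx ⟨w, hw.ne'⟩, hknown ⟨w, hw.ne'⟩ hk]
    rw [hφ.listed, h.listed, Set.union_assoc, hψu]
    congr 1
    ext τ
    simp only [Set.mem_union, Set.mem_ofPred_eq]
    constructor
    · rintro (h' | ⟨σ, hσ, hσ2, rfl⟩)
      · suffices h'' : ∃ σ : Finset V, (σ = {v, u.1} ∨ ∃ w, G.Adj v w ∧ w ≠ u.1 ∧
            (σ = {v, w} ∨ σ = {v, u.1, w})) ∧ τ = σ.image ψ by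
          obtain ⟨σ, h1, h2⟩ := h''
          have hvσ : v ∈ σ := by
            rcases h1 with rfl | ⟨w, -, -, rfl | rfl⟩ <;> simp
          obtain ⟨h3, h5⟩ := (h.dominated.isClique_iff h4 hvσ).2 h1
          exact ⟨σ, h3, h5, h2⟩
        rcases h' with rfl | ⟨w, hw1, hw2, rfl | rfl⟩
        · exact ⟨_, Or.inl rfl, by simp [hψv]⟩
        · exact ⟨_, Or.inr ⟨w, hw1, hw2, Or.inl rfl⟩, by simp [hψv, hw w hw1 hw2]⟩
        · exact ⟨_, Or.inr ⟨w, hw1, hw2, Or.inr rfl⟩, by simp [hψv, hw w hw1 hw2]⟩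
      · refine ⟨_, isClique_delVertex.1 hσ, by simpa using hσ2, ?_⟩
        rw [Finset.map_eq_image, Finset.image_image]
        exact Finset.image_congr fun x _ => (hψx x).symm
    · rintro ⟨σ, hσ, hσ2, rfl⟩
      by_cases hv : v ∈ σ
      · left
        rcases (h.dominated.isClique_iff h4 hv).1 ⟨hσ, hσ2⟩ with
          rfl | ⟨w, hw1, hw2, rfl | rfl⟩
        · exact Or.inl (by simp [hψv])
        · exact Or.inr ⟨w, hw1, hw2, Or.inl (by simp [hψv, hw w hw1 hw2])⟩
        · exact Or.inr ⟨w, hw1, hw2, Or.inr (by simp [hψv, hw w hw1 hw2])⟩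
      · right
        obtain ⟨ρ, rfl⟩ := exists_map_subtype_iff.2 hv
        refine ⟨ρ, isClique_delVertex.2 hσ, by simpa using hσ2, ?_⟩
        rw [Finset.map_eq_image, Finset.image_image]
        exact Finset.image_congr fun x _ => hψx x
  · rw [hφ.edges, h.edges, h.dominated.ncard_cliqueSet_two]
    omega
  · rw [hφ.triangles, h.triangles, h.dominated.ncard_cliqueSet_three h4]
    omega

/-- The main loop: as long as there are two known vertices, one is removed. -/
def mainLoop : Prog := .loop (.sub (.reg 4) (.lit 1)) round

/-- The main loop is fast enough since each of its rounds lists at least one edge. -/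
lemma mainLoop_spec {V : Type*} [Finite V] {G : SimpleGraph V} {k : ℕ} {slot : V → ℕ} {s : State}
    (hG : G.IsBridged) (h4 : G.CliqueFree 4) (R : Represents G k slot s) :
    HaltsWithin mainLoop s ((G.cliqueSet 2).ncard * ((k + 1) * 1500 + 4) + 4) fun s' =>
      ∃ φ, Lists G k slot s φ s' := by
  classical
  induction hn : Nat.card V generalizing V s with
  | zero =>
    obtain ⟨x, -⟩ := R.nonempty
    exact absurd hn (Nat.card_ne_zero.2 ⟨⟨x⟩, inferInstance⟩)
  | succ n ih =>
    rcases subsingleton_or_nontrivial V with hV | hV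
    · have hcount : s.reg 4 ≤ 1 := by
        rw [R.count]
        exact (Set.ncard_le_card _).trans (Finite.card_le_one_iff_subsingleton.2 hV)
      refine ⟨4, s, ?_, Nat.le_add_left _ _, _, Lists.of_subsingleton R⟩
      exact Exec.loop_false (e := .sub (.reg 4) (.lit 1)) (by simp only [Expr.eval]; omega)
    · obtain ⟨a, b, hab, ha, hb⟩ := hG.exists_boundary_pair h4
      have hcount : 2 ≤ s.reg 4 := by
        rw [R.count, ← Set.ncard_pair hab]
        refine Set.ncard_le_ncard ?_ (Set.toFinite _)
        rintro x (rfl | rfl)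
        · exact R.boundary _ ha
        · exact R.boundary _ hb
      obtain ⟨t, s₁, h1, h2, v, u, slot', h3⟩ := round_spec hG h4 R
      have hcard : Nat.card {x // x ≠ v} = n := by
        have := Nat.card_congr (Equiv.optionSubtypeNe v)
        rw [Finite.card_option] at this
        omega
      obtain ⟨t', s', h5, h6, φ, h7⟩ := ih (h3.dominated.isBridged_delVertex hG)
        (h4.delVertex v) h3.represents hcard
      refine ⟨4 + t + t', s', ?_, ?_, _, h3.lists h4 R h7⟩
      · exact Exec.loop_true (e := .sub (.reg 4) (.lit 1)) (by simp only [Expr.eval]; omega) h1 h5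
      · rw [h3.dominated.ncard_cliqueSet_two]
        generalize ((G.delVertex v).cliqueSet 2).ncard = m at *
        generalize {w | G.Adj v w ∧ w ≠ u}.ncard = l
        generalize (k + 1) * 1500 = K at *
        have : (m + (1 + l)) * (K + 4) = m * (K + 4) + (K + 4) + l * (K + 4) := by ring
        rw [this]
        generalize l * (K + 4) = q
        omega

end RAM

/-! ### Initialization -/

namespace RAM

open SimpleGraph

/-- Computes the position of each row, its sum, and the name of its vertex. -/
def initRows : Prog := forLoop 5 (.seq (.store 9 (.reg 5) (.reg 16)) (.seq
  (.store 7 (.reg 5) (.reg 5)) (.seq (.seq (.assign 12 (.lit 0)) (forLoop 17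
    (.assign 12 (.add (.reg 12) (.get 0 (.add (.reg 16) (.reg 17)))))))
  (.seq (.store 8 (.reg 5) (.reg 12)) (.assign 16 (.add (.reg 16) (.reg 3)))))))

/-- The preparations for the main loop. An empty matrix belongs to the complex with one vertex. -/
def init : Prog :=
  .seq (.seq (.assign 3 (.reg 0)) (.seq (.assign 4 (.reg 0))
    (.cond (.reg 0) .skip (.assign 0 (.lit 1))))) initRows

lemma sum_row_spec {s : State} {k : ℕ} (h3 : s.reg 3 = k) :
    HaltsWithin (.seq (.assign 12 (.lit 0)) (forLoop 17
      (.assign 12 (.add (.reg 12) (.get 0 (.add (.reg 16) (.reg 17))))))) s ((k + 1) * 100)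
      fun s' => AgreeOff [12, 17] [] s s' ∧
        s'.reg 12 = ∑ j ∈ Finset.range k, s.mem 0 (s.reg 16 + j) := by
  refine HaltsWithin.mono (HaltsWithin.seq (HaltsWithin.of_run rfl rfl) fun s₁ hs₁ =>
    HaltsWithin.forLoop (k := k) (fun j s' => AgreeOff [12, 17] [] s s' ∧ s'.reg 17 = j ∧
      s'.reg 12 = ∑ j ∈ Finset.range j, s.mem 0 (s.reg 16 + j)) ?_ ?_
      fun j s' hj hs' => HaltsWithin.of_run rfl ?_) ?_ ?_
  · subst hs₁
    simp only [Prog.run, Expr.eval]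
    exact ⟨((AgreeOff.refl s).set (by simp)).set (by simp), by simp, by simp⟩
  · rintro j s' ⟨h1, h2, -⟩
    exact ⟨by rw [h1.1 3 (by simp), h3], h2⟩
  · obtain ⟨h1, h2, h4⟩ := hs'
    simp only [Prog.run, Expr.eval, h1.mem_eq, h1.1 16 (by simp), h2]
    exact ⟨(h1.set (by simp)).set (by simp), by simp [h2], by simp [h4, Finset.sum_range_succ]⟩
  · simp only [Prog.bound, Expr.cost]; omega
  · rintro s' ⟨h1, -, h4⟩
    exact ⟨h1, h4⟩

lemma initRows_spec {s : State} {k : ℕ} (h3 : s.reg 3 = k) (h16 : s.reg 16 = 0) :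
    HaltsWithin initRows s ((k + 1) * ((k + 1) * 200)) fun s' =>
      AgreeOff [5, 12, 16, 17] [7, 8, 9] s s' ∧ ∀ i < k, s'.mem 9 i = k * i ∧ s'.mem 7 i = i ∧
        s'.mem 8 i = ∑ j ∈ Finset.range k, s.mem 0 (k * i + j) := by
  refine HaltsWithin.mono (HaltsWithin.forLoop (k := k) (c := (k + 1) * 100 + 50)
    (fun l s' => AgreeOff [5, 12, 16, 17] [7, 8, 9] s s' ∧ s'.reg 5 = l ∧ s'.reg 16 = k * l ∧
      ∀ i < l, s'.mem 9 i = k * i ∧ s'.mem 7 i = i ∧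
        s'.mem 8 i = ∑ j ∈ Finset.range k, s.mem 0 (k * i + j)) ?_ ?_ fun l s' hl hs' => ?_) ?_ ?_
  · exact ⟨(AgreeOff.refl s).set (by simp), by simp, by simp [h16], by simp⟩
  · rintro j s' ⟨h1, h2, -⟩
    exact ⟨by rw [h1.1 3 (by simp), h3], h2⟩
  · obtain ⟨h1, h2, h4, h5⟩ := hs'
    have hk : s'.reg 3 = k := by rw [h1.1 3 (by simp), h3]
    suffices h : HaltsWithin (.seq (.store 9 (.reg 5) (.reg 16)) (.seq
        (.store 7 (.reg 5) (.reg 5)) (.seq (.seq (.assign 12 (.lit 0)) (forLoop 17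
          (.assign 12 (.add (.reg 12) (.get 0 (.add (.reg 16) (.reg 17)))))))
        (.seq (.store 8 (.reg 5) (.reg 12)) (.assign 16 (.add (.reg 16) (.reg 3)))))))
        s' (3 + (3 + ((k + 1) * 100 + (3 + 4)))) _ from h.mono (by omega) fun _ h => h
    refine (HaltsWithin.of_run (p := .store 9 (.reg 5) (.reg 16)) rfl rfl).seq fun s₁ hs₁ => ?_
    refine (HaltsWithin.of_run (p := .store 7 (.reg 5) (.reg 5)) rfl rfl).seq fun s₂ hs₂ => ?_
    simp only [Prog.run, Expr.eval, h2, h4] at hs₁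
    subst hs₁
    simp only [Prog.run, Expr.eval, State.put_reg, h2] at hs₂
    subst hs₂
    refine (sum_row_spec (k := k) (by simpa using hk)).seq fun s₃ ⟨h6, h7⟩ => ?_
    refine (HaltsWithin.of_run (p := .seq (.store 8 (.reg 5) (.reg 12))
      (.assign 16 (.add (.reg 16) (.reg 3)))) rfl ?_).mono le_rfl fun _ h => h
    have e3 : s₃.reg 3 = k := by rw [h6.1 3 (by simp)]; simpa using hk
    have e5 : s₃.reg 5 = l := by rw [h6.1 5 (by simp)]; simpa using h2
    have e16 : s₃.reg 16 = k * l := by rw [h6.1 16 (by simp)]; simpa using h4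
    have m0 : s'.mem 0 = s.mem 0 := h1.2 0 (by simp)
    have h6' : AgreeOff [5, 12, 16, 17] [7, 8, 9] s s₃ :=
      ((h1.put (by simp)).put (by simp)).trans h6 (by simp) (by simp) (by simp) (by simp)
    simp only [Prog.run, Expr.eval]
    refine ⟨((h6'.put (by simp)).set (by simp)).set (by simp), by simp [e5],
      by simp [e16, e3, Nat.mul_succ], fun i hi => ?_⟩
    simp only [State.put_reg, State.put_mem, h4, m0] at h7
    rcases Nat.lt_succ_iff_lt_or_eq.1 hi with hi | rfl
    · obtain ⟨h8, h9, h10⟩ := h5 i hi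
      simp [e5, h6.mem_eq, hi.ne, h8, h9, h10]
    · simp [e5, h6.mem_eq, h7]
  · generalize k + 1 = q
    have : q * (q * 100 + 50 + 8) = q * (q * 100) + q * 58 := by ring
    have h2 : q * (q * 200) = q * (q * 100) + q * (q * 100) := by ring
    have h3 : q * 58 ≤ q * (q * 100) := by
      rcases Nat.eq_zero_or_pos q with rfl | h
      · simp
      · exact Nat.mul_le_mul_left q (by omega)
    omega
  · rintro s' ⟨h1, -, -, h5⟩
    exact ⟨h1, h5⟩

lemma input_mem (k : ℕ) (D : Matrix (Fin k) (Fin k) ℕ) (i j : Fin k) :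
    (input k D).mem 0 (k * i + j) = D i j := by
  have h : (k * i + j : ℕ) < k * k := by
    have := (finProdFinEquiv (i, j)).2
    simpa [add_comm] using this
  have h' : (⟨k * i + j, h⟩ : Fin (k * k)) = finProdFinEquiv (i, j) := by
    ext
    simp [add_comm]
  simp only [input]
  rw [dif_pos ⟨trivial, h⟩, h', Equiv.symm_apply_apply]

lemma init_spec (k : ℕ) (D : Matrix (Fin k) (Fin k) ℕ) :
    HaltsWithin init (input k D) (20 + (k + 1) * ((k + 1) * 200)) fun s =>
      s.reg 0 = (if k = 0 then 1 else k) ∧ s.reg 1 = 0 ∧ s.reg 2 = 0 ∧ s.reg 3 = k ∧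
      s.reg 4 = k ∧ (∀ i j : Fin k, s.ent i j = D i j) ∧
      ∀ i < k, s.mem 9 i = k * i ∧ s.mem 7 i = i ∧
        s.mem 8 i = ∑ j ∈ Finset.range k, s.ent i j := by
  refine HaltsWithin.seq (Q := fun s => s.reg 0 = (if k = 0 then 1 else k) ∧ s.reg 1 = 0 ∧
    s.reg 2 = 0 ∧ s.reg 3 = k ∧ s.reg 4 = k ∧ s.reg 16 = 0 ∧ s.mem = (input k D).mem)
    ((HaltsWithin.of_run rfl ?_).mono ?_ fun _ h => h)
    fun s₁ ⟨h0, h1, h2, h3, h4, h16, hm⟩ => (initRows_spec h3 h16).mono le_rfl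
      fun s ⟨h5, h6⟩ => ?_
  · simp only [Prog.run, Expr.eval]
    by_cases hk : k = 0
    · rw [State.pick_of_eq (by simp [input, hk])]
      simp [input, hk]
    · rw [State.pick_of_ne (by simp [input, hk])]
      simp [input, hk]
  · simp only [Prog.bound, Expr.cost]; omega
  · have hent : ∀ i < k, ∀ j, s.ent i j = (input k D).mem 0 (k * i + j) := fun i hi j => by
      rw [State.ent, (h6 i hi).1, h5.2 0 (by simp), hm]
    refine ⟨by rw [h5.1 0 (by simp), h0], by rw [h5.1 1 (by simp), h1],
      by rw [h5.1 2 (by simp), h2], by rw [h5.1 3 (by simp), h3], by rw [h5.1 4 (by simp), h4],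
      fun i j => by rw [hent i i.2, input_mem], fun i hi => ⟨(h6 i hi).1, (h6 i hi).2.1, ?_⟩⟩
    rw [(h6 i hi).2.2, hm]
    exact Finset.sum_congr rfl fun j _ => (hent i hi j).symm

end RAM

/-! ### The boundary of a clique complex -/

namespace SimpleGraph

variable {V : Type*} {G : SimpleGraph V}

lemma oneSkeleton_cliqueComplex (G : SimpleGraph V) : G.cliqueComplex.oneSkeleton = G := by
  classical
  ext u v
  constructor
  · rintro ⟨hne, s, hs, h⟩
    exact hs.2 (by rw [h]; simp) (by rw [h]; simp) hne
  · intro h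
    refine ⟨h.ne, {u, v}, ⟨by simp, by simp [h]⟩, by simp⟩

lemma cliqueFree_of_dimLE {d : ℕ} (h : G.cliqueComplex.DimLE d) : G.CliqueFree (d + 2) := by
  intro t ht
  have := h t ⟨Finset.card_pos.1 (by rw [ht.card_eq]; omega), ht.isClique⟩
  rw [ht.card_eq] at this
  omega

lemma numSimplices_cliqueComplex (G : SimpleGraph V) (d : ℕ) :
    G.cliqueComplex.numSimplices d = (G.cliqueSet (d + 1)).ncard := by
  rw [AbstractSimplicialComplex.numSimplices]
  congr 1
  ext s
  simp only [Set.mem_ofPred_eq, mem_cliqueSet_iff, isNClique_iff]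
  exact ⟨fun h => ⟨h.1.2, h.2⟩, fun h => ⟨⟨Finset.card_pos.1 (by omega), h.1⟩, h.2⟩⟩

/-- The vertices of a clique with exactly one common neighbour are boundary vertices. -/
lemma mem_boundaryVertices_of_existsUnique {σ : Finset V} {a : V} (ha : a ∈ σ)
    (hσ : G.IsClique (σ : Set V)) (h : ∃! c, ∀ x ∈ σ, G.Adj c x) :
    a ∈ G.cliqueComplex.boundaryVertices := by
  classical
  obtain ⟨c, hc, huniq⟩ := h
  have hcσ : c ∉ σ := fun h => (hc c h).ne rfl
  have hρ : insert c σ ∈ G.cliqueComplex.faces := by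
    refine ⟨by simp, ?_⟩
    rw [Finset.coe_insert]
    exact hσ.insert fun x hx _ => hc x hx
  refine ⟨by simp, σ, ⟨⟨a, ha⟩, hσ⟩, fun hmax => ?_, ⟨insert c σ, ⟨hρ, Finset.subset_insert _ _,
    Finset.card_insert_of_notMem hcσ⟩, ?_⟩, by simpa using ha⟩
  · exact hcσ (hmax.2 hρ (Finset.subset_insert c σ) (Finset.mem_insert_self c σ))
  · rintro ρ ⟨hρ', hsub, hcard⟩
    obtain ⟨d, hd⟩ := Finset.card_eq_one.1 (by rw [Finset.card_sdiff_of_subset hsub]; omega :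
      (ρ \ σ).card = 1)
    have hρd : ρ = insert d σ := by
      rw [← Finset.sdiff_union_of_subset hsub, hd]
      rfl
    have hdσ : d ∉ σ := (Finset.mem_sdiff.1 (hd ▸ Finset.mem_singleton_self d)).2
    rw [hρd, huniq d fun x hx => hρ'.2 (by simp [hρd]) (by simp [hρd, hx])
      (by rintro rfl; exact hdσ hx)]

lemma IsBoundaryVertex.mem_boundaryVertices {a : V} (h : G.IsBoundaryVertex a) :
    a ∈ G.cliqueComplex.boundaryVertices := by
  classical
  rcases h with ⟨b, hb, hb'⟩ | ⟨b, hab, c, hc, hc'⟩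
  · refine mem_boundaryVertices_of_existsUnique (σ := {a}) (by simp) (by simp)
      ⟨b, by simpa using hb.symm, fun c hc => hb' c ?_⟩
    exact (hc a (by simp)).symm
  · refine mem_boundaryVertices_of_existsUnique (σ := {a, b}) (by simp) (by simp [hab])
      ⟨c, by simpa using ⟨hc.1.symm, hc.2.symm⟩, fun d hd => hc' d ?_⟩
    exact ⟨(hd a (by simp)).symm, (hd b (by simp)).symm⟩

lemma Connected.card_le_ncard_cliqueSet_two [Finite V] (hc : G.Connected) :
    Nat.card V ≤ (G.cliqueSet 2).ncard + 1 := by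
  classical
  refine hc.card_vert_le_card_edgeSet_add_one.trans (Nat.add_le_add_right ?_ 1)
  refine Set.ncard_le_ncard_of_injOn Sym2.toFinset ?_ ?_ (Set.toFinite _)
  · intro z
    induction z with
    | _ x y =>
      intro h
      rw [mem_edgeSet] at h
      rw [mem_cliqueSet_iff, isNClique_iff, Sym2.toFinset_mk_eq]
      exact ⟨by simp [h], Finset.card_pair h.ne⟩
  · intro z _ z' _ h
    refine Sym2.ext fun x => ?_
    rw [← Sym2.mem_toFinset, ← Sym2.mem_toFinset, h]

end SimpleGraph

lemma AbstractSimplicialComplex.nontrivial_of_mem_boundaryVertices {V : Type*}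
    {X : AbstractSimplicialComplex V} {a : V} (h : a ∈ X.boundaryVertices) : Nontrivial V := by
  obtain ⟨-, σ, -, -, ⟨ρ, ⟨-, -, hρ⟩, -⟩, haσ⟩ := h
  have := Finset.card_pos.2 ⟨a, haσ (Finset.mem_singleton_self a)⟩
  obtain ⟨x, -, y, -, hxy⟩ := Finset.one_lt_card.1 (by omega : 1 < ρ.card)
  exact ⟨x, y, hxy⟩

/-! ### Reconstruction -/

namespace RAM

open SimpleGraph

/-- The program which reconstructs a complex from its boundary distance matrix. -/
def reconstruct : Prog := .seq init mainLoop

lemma State.describes_of_listed {V : Type*} [Finite V] {G : SimpleGraph V} {k : ℕ}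
    (e : Fin k ≃ G.cliqueComplex.boundaryVertices) {s : State} {φ : V → ℕ}
    (hφ : Function.Injective φ) (hlt : ∀ x, φ x < s.reg 0) (h0 : s.reg 0 = Nat.card V)
    (he : ∀ i, φ (e i) = i)
    (hs : s.listed = {τ | ∃ σ : Finset V, G.IsClique (σ : Set V) ∧ 2 ≤ σ.card ∧ τ = σ.image φ})
    (h1 : s.reg 1 = (G.cliqueSet 2).ncard) (h2 : s.reg 2 = (G.cliqueSet 3).ncard) :
    s.Describes G.cliqueComplex e := by
  have hbij : Function.Bijective fun x => (⟨φ x, hlt x⟩ : Fin (s.reg 0)) :=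
    (Nat.bijective_iff_injective_and_card _).2
      ⟨fun x y h => hφ (Fin.mk.inj_iff.1 h), by rw [Nat.card_fin, h0]⟩
  refine ⟨Equiv.ofBijective _ hbij, he, ?_, ?_, ?_⟩
  · have hsimp : s.simplices = {σ | ∃ i < s.reg 0, σ = {i}} ∪ s.listed := by
      ext σ
      simp only [simplices, listed, Set.mem_union, Set.mem_ofPred_eq]
    rw [hsimp, hs]
    ext τ
    simp only [Set.mem_union, Set.mem_ofPred_eq, Set.mem_image, Equiv.ofBijective_apply]
    constructor
    · rintro (⟨i, hi, rfl⟩ | ⟨σ, hσ, hσ2, rfl⟩)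
      · obtain ⟨x, hx⟩ := hbij.2 ⟨i, hi⟩
        refine ⟨{x}, ⟨by simp, by simp⟩, ?_⟩
        simpa using congrArg Fin.val hx
      · exact ⟨σ, ⟨Finset.card_pos.1 (by omega), hσ⟩, rfl⟩
    · rintro ⟨σ, ⟨hne, hσ⟩, rfl⟩
      rcases (Nat.succ_le_of_lt (Finset.card_pos.2 hne)).lt_or_eq with h | h
      · exact Or.inr ⟨σ, hσ, h, rfl⟩
      · obtain ⟨x, rfl⟩ := Finset.card_eq_one.1 h.symm
        exact Or.inl ⟨φ x, hlt x, by simp⟩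
  · rw [h1, numSimplices_cliqueComplex]
  · rw [h2, numSimplices_cliqueComplex]

lemma reconstruct_spec {V : Type*} [Finite V] {G : SimpleGraph V} (hG : G.IsBridged)
    (h4 : G.CliqueFree 4) {k : ℕ} (e : Fin k ≃ G.cliqueComplex.boundaryVertices) :
    HaltsWithin reconstruct (input k (Matrix.of fun i j => G.dist (e i : V) (e j)))
      (10000 * (k * (G.cliqueSet 2).ncard + 1)) fun s => s.Describes G.cliqueComplex e := by
  classical
  obtain ⟨t, s, hexec, ht, h0, h1, h2, h3, h4', hent, hrows⟩ :=
    init_spec k (Matrix.of fun i j => G.dist (e i : V) (e j))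
  have hlisted : s.listed = ∅ := by
    ext σ
    simp [State.listed, h1, h2]
  have := hG.1.nonempty
  rcases Nat.eq_zero_or_pos k with rfl | hk
  · -- without boundary vertices there is only one vertex
    have hV : Subsingleton V := by
      by_contra hV
      rw [not_subsingleton_iff_nontrivial] at hV
      obtain ⟨a, -, -, ha, -⟩ := hG.exists_boundary_pair h4
      exact (e.symm ⟨a, ha.mem_boundaryVertices⟩).elim0
    have hempty : ∀ n, 2 ≤ n → G.cliqueSet n = ∅ := fun n hn => by
      ext σ
      have := Finset.card_le_one_of_subsingleton σ
      simp only [mem_cliqueSet_iff, isNClique_iff, Set.mem_empty_iff_false, iff_false]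
      omega
    refine ⟨t + 4, s, hexec.seq (Exec.loop_false (e := .sub (.reg 4) (.lit 1))
      (by simp only [Expr.eval]; omega)), by omega, ?_⟩
    refine State.describes_of_listed e (φ := fun _ => 0) (Function.injective_of_subsingleton _)
      (fun x => by simp [h0]) ?_ (fun i => i.elim0) ?_ ?_ ?_
    · rw [h0, if_pos rfl, Nat.card_unique]
    · rw [hlisted]
      ext τ
      simp only [Set.mem_empty_iff_false, Set.mem_ofPred_eq, false_iff, not_exists]
      rintro σ ⟨-, h, -⟩
      have := Finset.card_le_one_of_subsingleton σ
      omega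
    · rw [h1, hempty 2 le_rfl, Set.ncard_empty]
    · rw [h2, hempty 3 (by omega), Set.ncard_empty]
  · set slot : V → ℕ := fun x =>
      if hx : x ∈ G.cliqueComplex.boundaryVertices then e.symm ⟨x, hx⟩ else k with hslot
    have hslot_lt : ∀ x, slot x < k → ∃ i : Fin k, x = e i ∧ slot x = i := by
      intro x hx
      by_cases hx' : x ∈ G.cliqueComplex.boundaryVertices
      · exact ⟨e.symm ⟨x, hx'⟩, by simp, by simp [hslot, hx']⟩
      · simp [hslot, hx'] at hx
    have hslot_e : ∀ i : Fin k, slot (e i) = i := fun i => by simp [hslot]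
    have hk0 : s.reg 0 = k := by rw [h0, if_neg hk.ne']
    have R : Represents G k slot s :=
      { size := h3
        offset := fun i hi => (hrows i hi).1
        slot_inj := fun x y hx hxy => by
          obtain ⟨i, rfl, hi⟩ := hslot_lt x hx
          obtain ⟨j, rfl, hj⟩ := hslot_lt y (hxy ▸ hx)
          rw [hi, hj] at hxy
          rw [Fin.ext hxy]
        dist := fun x y hx hy => by
          obtain ⟨i, rfl, hi⟩ := hslot_lt x hx
          obtain ⟨j, rfl, hj⟩ := hslot_lt y hy
          rw [hi, hj, hent, Matrix.of_apply]
        ent_eq_zero := fun i hi hno => absurd (hslot_e ⟨i, hi⟩) (hno _)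
        rowSum := fun i hi => (hrows i hi).2.2
        count := by
          have : {x | slot x < k} = Set.range fun i : Fin k => (e i : V) := by
            ext x
            constructor
            · intro hx
              obtain ⟨i, hi, -⟩ := hslot_lt x hx
              exact ⟨i, hi.symm⟩
            · rintro ⟨i, rfl⟩
              simp [hslot_e]
          have hinj : Function.Injective fun i : Fin k => (e i : V) :=
            Subtype.val_injective.comp e.injective
          rw [h4', this, ← Set.image_univ, Set.ncard_image_of_injective _ hinj, Set.ncard_univ,
            Nat.card_fin]
        boundary := fun x hx => by
          simp [hslot, hx.mem_boundaryVertices]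
        name_lt := fun x hx => by rw [(hrows _ hx).2.1, hk0]; exact hx
        name_inj := fun x y hx hy hxy => by
          rw [(hrows _ hx).2.1, (hrows _ hy).2.1] at hxy
          obtain ⟨i, rfl, hi⟩ := hslot_lt x hx
          obtain ⟨j, rfl, hj⟩ := hslot_lt y hy
          rw [hi, hj] at hxy
          rw [Fin.ext hxy]
        nonempty := ⟨e ⟨0, hk⟩, by simp [hslot_e, hk]⟩ }
    obtain ⟨t', s', hexec', ht', φ, hφ⟩ := mainLoop_spec hG h4 R
    refine ⟨t + t', s', hexec.seq hexec', ?_, ?_⟩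
    · have hV := AbstractSimplicialComplex.nontrivial_of_mem_boundaryVertices (e ⟨0, hk⟩).2
      have hkm : k ≤ (G.cliqueSet 2).ncard + 1 := by
        refine le_trans ?_ hG.1.card_le_ncard_cliqueSet_two
        have := Nat.card_le_card_of_injective (fun i => (e i : V))
          (Subtype.val_injective.comp e.injective)
        rwa [Nat.card_fin] at this
      have hm : 1 ≤ (G.cliqueSet 2).ncard := by
        have := hG.1.card_le_ncard_cliqueSet_two
        have := Finite.one_lt_card (α := V)
        omega
      generalize (G.cliqueSet 2).ncard = m at *
      have e1 : m ≤ k * m := Nat.le_mul_of_pos_left m hk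
      have e2 : k ≤ k * m := Nat.le_mul_of_pos_right k hm
      have e3 : k * k ≤ k * m + k := (Nat.mul_le_mul_left k hkm).trans_eq (by ring)
      have e4 : (k + 1) * ((k + 1) * 200) = 200 * (k * k) + 400 * k + 200 := by ring
      have e5 : m * ((k + 1) * 1500 + 4) + 4 = 1500 * (k * m) + 1504 * m + 4 := by ring
      omega
    · refine State.describes_of_listed e hφ.inj hφ.name_lt ?_ (fun i => ?_) ?_ ?_ ?_
      · have := hφ.names_add
        omega
      · have hi : slot (e i) < k := by simp [hslot_e]
        rw [hφ.name_eq _ hi, hslot_e, (hrows _ i.2).2.1]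
      · rw [hφ.listed, hlisted, Set.empty_union]
      · rw [hφ.edges, h1, zero_add]
      · rw [hφ.triangles, h2, zero_add]

/-- Two complexes described by the same configuration are isomorphic, by an isomorphism which
respects the numbering of the boundary vertices. -/
lemma State.Describes.exists_equiv {V W : Type*} {X : AbstractSimplicialComplex V}
    {Y : AbstractSimplicialComplex W} {k : ℕ} {e : Fin k ≃ X.boundaryVertices}
    {π : X.boundaryVertices ≃ Y.boundaryVertices} {s : State} (hX : s.Describes X e)
    (hY : s.Describes Y (e.trans π)) :
    ∃ φ : V ≃ W, (∀ σ : Finset V, σ ∈ X.faces ↔ σ.map φ.toEmbedding ∈ Y.faces) ∧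
      ∀ a : X.boundaryVertices, φ a = π a := by
  classical
  obtain ⟨φ, hφ, hφX, -⟩ := hX
  obtain ⟨ψ, hψ, hψY, -⟩ := hY
  have hinj : Function.Injective fun σ : Finset V => σ.image fun x => (φ x : ℕ) :=
    Finset.image_injective (Fin.val_injective.comp φ.injective)
  have hinj' : Function.Injective fun σ : Finset W => σ.image fun x => (ψ x : ℕ) :=
    Finset.image_injective (Fin.val_injective.comp ψ.injective)
  refine ⟨φ.trans ψ.symm, fun σ => ?_, fun a => ?_⟩
  · rw [← hinj.mem_set_image, ← hφX, hψY, ← hinj'.mem_set_image]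
    have : (σ.map (φ.trans ψ.symm).toEmbedding).image (fun x => (ψ x : ℕ)) =
        σ.image fun x => (φ x : ℕ) := by
      rw [Finset.map_eq_image, Finset.image_image]
      exact Finset.image_congr fun x _ => by simp
    rw [this]
  · obtain ⟨i, rfl⟩ := e.surjective a
    rw [Equiv.trans_apply, Equiv.symm_apply_eq]
    ext
    rw [hφ i]
    exact (hψ i).symm

end RAM

theorem theorem1p2 :
    -- boundary rigidity
    (∀ {V : Type*} {W : Type*} [Finite V] [Finite W]
      (X : AbstractSimplicialComplex V) (Y : AbstractSimplicialComplex W),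
      X.IsSystolic → X.DimLE 2 → Y.IsSystolic → Y.DimLE 2 →
      ∀ π : X.boundaryVertices ≃ Y.boundaryVertices,
        (∀ a b, Y.oneSkeleton.dist (π a : W) (π b) = X.oneSkeleton.dist (a : V) b) →
        ∃ φ : V ≃ W, (∀ s : Finset V, s ∈ X.faces ↔ s.map φ.toEmbedding ∈ Y.faces) ∧
          ∀ a : X.boundaryVertices, φ a = π a) ∧
    -- reconstruction of `X` from its boundary distance matrix in time `O(n₀ m)`
    (∃ (P : RAM.Prog) (C : ℕ), ∀ {V : Type*} [Finite V] (X : AbstractSimplicialComplex V),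
      X.IsSystolic → X.DimLE 2 →
      ∀ (n₀ : ℕ) (e : Fin n₀ ≃ X.boundaryVertices),
        ∃ (t : ℕ) (s : RAM.State),
          RAM.Exec P
            (RAM.input n₀ (Matrix.of fun i j => X.oneSkeleton.dist (e i : V) (e j))) t s ∧
          t ≤ C * (n₀ * X.numSimplices 1 + 1) ∧
          s.Describes X e) := by
  constructor
  · -- the program gets the same input for both complexes, and so it gives the same output
    rintro V W _ _ X Y ⟨G, hG, rfl⟩ hX ⟨H, hH, rfl⟩ hY π hπ
    rw [G.oneSkeleton_cliqueComplex, H.oneSkeleton_cliqueComplex] at hπ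
    let e := (Finite.equivFin G.cliqueComplex.boundaryVertices).symm
    obtain ⟨t, s, hs, -, hsX⟩ :=
      RAM.reconstruct_spec hG (SimpleGraph.cliqueFree_of_dimLE hX) e
    obtain ⟨t', s', hs', -, hsY⟩ :=
      RAM.reconstruct_spec hH (SimpleGraph.cliqueFree_of_dimLE hY) (e.trans π)
    have hD : (Matrix.of fun i j => H.dist (e.trans π i : W) (e.trans π j)) =
        Matrix.of fun i j => G.dist (e i : V) (e j) := by
      ext i j
      exact hπ (e i) (e j)
    rw [hD] at hs'
    obtain rfl := hs.deterministic hs'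
    exact hsX.exists_equiv hsY
  · refine ⟨RAM.reconstruct, 10000, ?_⟩
    rintro V _ X ⟨G, hG, rfl⟩ hX k e
    rw [G.oneSkeleton_cliqueComplex, SimpleGraph.numSimplices_cliqueComplex]
    exact RAM.reconstruct_spec hG (SimpleGraph.cliqueFree_of_dimLE hX) e
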